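/- **Setting.** Graded manifolds are finite-dimensional smooth $\mathbb Z$-graded manifolds; parity is the ghost degree $\mathrm{gh}$ mod 2. $T[1]X$, with $\dim X=n$, is the shifted tangent bundle with its de Rham vector field $d_X$. All ideals of forms and distributions are understood as sheaves (so membership is local). Signs follow the total degree of forms: $i_Xi_Y=(-1)^{(|X|+1)(|Y|+1)}i_Yi_X$ and $L_X=i_Xd+(-1)^{|X|}di_X$. A *presymplectic gauge PDE* $(E,Q,\omega)$ is a graded fibre bundle $\pi:E\to T[1]X$ with a vector field $Q$ of degree $1$ such that $Q\circ\pi^*=\pi^*\circ d_X$, a 2-form $\omega$ of degree $n-1$ and a function $\mathcal L$ of degree $n$ with $$d\omega=0,\qquad i_Q\omega+d\mathcal L\in\mathcal I,\qquad \tfrac12 i_Qi_Q\omega+Q\mathcal L=0,$$ where $\mathcal I$ is the ideal generated by the pullbacks $\pi^*\alpha$ of forms of positive degree on $T[1]X$. A *weak gauge PDE* $(B,\gamma,\mathcal K_B,T[1]X)$ is a graded fibre bundle $B\to T[1]X$ with a degree $1$ vector field $\gamma$ projecting to $d_X$ and a vertical, involutive distribution $\mathcal K_B$ (a finitely generated graded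 submodule of vector fields) with $[\gamma,\mathcal K_B]\subseteq\mathcal K_B$ and $\gamma^2=\tfrac12[\gamma,\gamma]\in\mathcal K_B$. (Quasi-regularity of $\mathcal K_B$ is a separate regularity assumption; it is neither assumed nor asserted below.) A *presymplectic gauge PDE over the background* $(B,\gamma,\mathcal K_B)$ is a graded fibre bundle $\pi_B:F\to B$ over such a weak gauge PDE, with a degree $1$ vector field $Q_F$ projecting to $\gamma$, a 2-form $\omega_F$ of degree $n-1$ and a function $\mathcal L_F$ of degree $n$ such that $$d\omega_F=0,\qquad i_{Q_F}\omega_F+d\mathcal L_F\in\mathcal I_B,\qquad \tfrac12 i_{Q_F}i_{Q_F}\omega_F+Q_F\mathcal L_F=0,$$ where $\mathcal I_B$ is the ideal generated by the $\pi_B^*\alpha$ with $\alpha$ a 1-form on $B$ and $i_k\alpha=0$ for all $k\in\mathcal K_B$; moreover the distribution generated by the projectable vector fields $k$ with $i_k\omega_F\in\mathcal I_B$ and $\pi_{B*}k\in\mathcal K_B$ projects onto $\mathcal K_B$. **Proposition.** Let $(E,Q,\omega)$ be a presymplectic gauge PDE over $T[1]X$ with function $\mathcal L$, and let $\chi$ be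 a 1-form of degree $n-1$ with $\omega=d\chi$. Let $\mathcal K_\omega$ consist of the vertical vector fields $k$ on $E$ with $i_k\omega\in\mathcal I$, and suppose that $\mathcal K_\omega$ is finitely generated. Let $\Pi:VE\to E$ be the vertical tangent bundle, with coordinates $(x,\theta,\psi^A,\phi^A)$ induced by adapted coordinates $(x,\theta,\psi^A)$ of $E$, and for a function $f$ on $E$ let $Df=\phi^A\,\partial f/\partial\psi^A$. Let $\tilde Q$ be the complete lift of $Q$, that is, the vector field on $VE$ with $\tilde Q\,\Pi^*f=\Pi^*(Qf)$ and $\tilde Q\,Df=D(Qf)$. Let $\nabla$ be a symmetric affine connection on $E$ such that the covariant derivative of a vertical vector field along a vertical vector field is vertical, and let $$V=\phi^A\frac{\partial}{\partial\psi^A}-\phi^A\phi^B\,\Gamma_{BA}^C\frac{\partial}{\partial\phi^C},\qquad \nabla_{\partial_B}\partial_A=\Gamma_{BA}^C\,\partial_C ,$$ be the associated vector field on $VE$. Put $$\tilde\chi=\tfrac12L_VL_V\Pi^*\chi,\qquad \tilde\omega=d\tilde\chi,\qquad \tilde{\mathcal L}=\tfrac12\,V(V(\Pi^*\mathcal L)).$$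 Then $(VE,\tilde Q,\tilde\omega)\xrightarrow{\ \Pi\ }(E,Q,\mathcal K_\omega)$, with the function $\tilde{\mathcal L}$, is a presymplectic gauge PDE over background. In particular, $(E,Q,\mathcal K_\omega,T[1]X)$ is a weak gauge PDE. -/

import Mathlib

open TopologicalSpace CategoryTheory Opposite
open scoped TensorProduct

noncomputable section

universe u

namespace GPDE

/-- The Koszul sign `(-1)^n`. -/
def sgn (n : ℤ) : ℝ := if Even n then 1 else -1

/-! ## Local models of graded manifolds -/

section Model

variable {ι : Type} (deg : ι → ℤ)

/-- Indices of the coordinates of degree zero (the smooth ones). -/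
abbrev ZeroIdx : Type := {i : ι // deg i = 0}

/-- Indices of the commuting coordinates of nonzero (even) degree. -/
abbrev EvenIdx : Type := {i : ι // Even (deg i) ∧ deg i ≠ 0}

/-- Indices of the anticommuting coordinates. -/
abbrev OddIdx : Type := {i : ι // Odd (deg i)}

/-- The exterior algebra on the odd coordinates. -/
abbrev OddAlg : Type := ExteriorAlgebra ℝ (OddIdx deg → ℝ)

variable [Fintype ι]

/-- Smooth functions of the degree zero coordinates on an open set `O`. -/
abbrev SmoothFn (O : Opens (ZeroIdx deg → ℝ)) : Type :=
  ContMDiffMap (modelWithCornersSelf ℝ (ZeroIdx deg → ℝ)) (modelWithCornersSelf ℝ ℝ) O ℝ ((⊤ : ℕ∞) : WithTop ℕ∞)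

/-- Functions on the graded domain over `O`: formal power series in the even coordinates of nonzero
degree with coefficients in `C^∞(O) ⊗ Λ(odd coordinates)`. -/
abbrev Model (O : Opens (ZeroIdx deg → ℝ)) : Type :=
  MvPowerSeries (EvenIdx deg) (SmoothFn deg O ⊗[ℝ] OddAlg deg)

/-- Restriction of smooth functions as a homomorphism of algebras. -/
def smoothRes {O O' : Opens (ZeroIdx deg → ℝ)} (h : O' ≤ O) :
    SmoothFn deg O →ₐ[ℝ] SmoothFn deg O' :=
  { ContMDiffMap.restrictRingHom (modelWithCornersSelf ℝ (ZeroIdx deg → ℝ)) (modelWithCornersSelf ℝ ℝ) ℝ h with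
    commutes' := fun _ => rfl }

/-- Restriction of functions on a graded domain. -/
def modelRes {O O' : Opens (ZeroIdx deg → ℝ)} (h : O' ≤ O) : Model deg O →+* Model deg O' :=
  MvPowerSeries.map
    (Algebra.TensorProduct.map (smoothRes deg h) (AlgHom.id ℝ (OddAlg deg))).toRingHom

/-- The part of degree `k` of the exterior algebra, for the ghost degree: it is spanned by the
products of odd coordinates whose degrees sum up to `k`. -/
def oddHomog (k : ℤ) : Submodule ℝ (OddAlg deg) :=
  open Classical in
  Submodule.span ℝ {a | ∃ l : List (OddIdx deg), (l.map fun i => deg i).sum = k ∧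
    a = (l.map fun i => ExteriorAlgebra.ι ℝ (Pi.single i (1 : ℝ) : OddIdx deg → ℝ)).prod}

/-- Functions of ghost degree `k` on a graded domain. -/
def modelHomog (O : Opens (ZeroIdx deg → ℝ)) (k : ℤ) : Set (Model deg O) :=
  {f | ∀ m : EvenIdx deg →₀ ℕ, MvPowerSeries.coeff m f ∈
    Submodule.span ℝ {a | ∃ (s : SmoothFn deg O) (l : OddAlg deg),
      l ∈ oddHomog deg (k - m.sum fun i e => (e : ℤ) * deg i) ∧ a = s ⊗ₜ[ℝ] l}}

/-- The coordinate function of a degree zero coordinate. -/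
def smoothCoord (O : Opens (ZeroIdx deg → ℝ)) (i : ZeroIdx deg) : SmoothFn deg O :=
  ⟨fun x => (x : ZeroIdx deg → ℝ) i,
    ((ContinuousLinearMap.proj (R := ℝ) (φ := fun _ : ZeroIdx deg => ℝ) i).contMDiff).comp
      contMDiff_subtype_val⟩

/-- The coordinate functions of a graded domain. -/
def modelCoord (O : Opens (ZeroIdx deg → ℝ)) (i : ι) : Model deg O :=
  open Classical in
  if h₀ : deg i = 0 then MvPowerSeries.C (smoothCoord deg O ⟨i, h₀⟩ ⊗ₜ[ℝ] 1)
  else if h₁ : Even (deg i) then MvPowerSeries.X ⟨i, h₁, h₀⟩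
  else MvPowerSeries.C
    (1 ⊗ₜ[ℝ] ExteriorAlgebra.ι ℝ (Pi.single ⟨i, Int.not_even_iff_odd.mp h₁⟩ (1 : ℝ)))

end Model

/-! ## Graded manifolds -/

/-- A space with a sheaf of `ℤ`-graded, graded-commutative real algebras. The algebra of sections
also contains infinite sums of homogeneous sections; the parity of a homogeneous section is that of
its degree. -/
structure GradedSpace where
  X : TopCat.{u}
  sheaf : TopCat.Sheaf (AlgCat.{u} ℝ) X
  /-- sections of degree `k` -/
  homog : ∀ (U : Opens X) (_ : ℤ), Submodule ℝ (sheaf.presheaf.obj (op U))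
  one_mem : ∀ U, 1 ∈ homog U 0
  mul_mem : ∀ {U k l} {f g : sheaf.presheaf.obj (op U)},
    f ∈ homog U k → g ∈ homog U l → f * g ∈ homog U (k + l)
  comm : ∀ {U k l} {f g : sheaf.presheaf.obj (op U)},
    f ∈ homog U k → g ∈ homog U l → f * g = sgn (k * l) • (g * f)
  res_mem : ∀ {U V k} (h : V ≤ U) {f : sheaf.presheaf.obj (op U)},
    f ∈ homog U k → (sheaf.presheaf.map (homOfLE h).op).hom f ∈ homog V k
  mem_of_locally : ∀ {U k} (f : sheaf.presheaf.obj (op U)),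
    (∀ p ∈ U, ∃ (V : Opens X) (h : V ≤ U), p ∈ V ∧
      (sheaf.presheaf.map (homOfLE h).op).hom f ∈ homog V k) → f ∈ homog U k

namespace GradedSpace

variable (M : GradedSpace.{u})

/-- Functions over an open set. -/
abbrev Fn (U : Opens M.X) : Type u := M.sheaf.presheaf.obj (op U)

/-- Restriction of functions. -/
def res {U V : Opens M.X} (h : V ≤ U) : M.Fn U →ₐ[ℝ] M.Fn V :=
  (M.sheaf.presheaf.map (homOfLE h).op).hom

end GradedSpace

/-- A coordinate chart: a finite set of coordinates with degrees, coordinates for the degree zero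
directions of the underlying space, and compatible isomorphisms of graded algebras between the
functions and those on the graded domain. -/
structure Chart (M : GradedSpace.{u}) where
  ι : Type
  [fin : Fintype ι]
  deg : ι → ℤ
  κ : OpenPartialHomeomorph M.X (ZeroIdx deg → ℝ)
  iso : ∀ (V : Opens M.X) (h : (V : Set M.X) ⊆ κ.source),
    M.Fn V ≃ₐ[ℝ] Model deg ⟨κ '' V, κ.isOpen_image_of_subset_source V.isOpen h⟩
  iso_res : ∀ (V W : Opens M.X) (h : (V : Set M.X) ⊆ κ.source) (hWV : W ≤ V) (f : M.Fn V),
    iso W (fun _ hp => h (hWV hp)) (M.res hWV f) =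
      modelRes deg (O := ⟨κ '' V, κ.isOpen_image_of_subset_source V.isOpen h⟩)
        (Set.image_mono hWV) (iso V h f)
  iso_homog : ∀ (V : Opens M.X) (h : (V : Set M.X) ⊆ κ.source) (k : ℤ) (f : M.Fn V),
    f ∈ M.homog V k ↔ iso V h f ∈ modelHomog deg _ k

attribute [instance] Chart.fin

namespace Chart

variable {M : GradedSpace.{u}} (c : Chart M)

/-- The domain of a chart. -/
def source : Opens M.X := ⟨c.κ.source, c.κ.open_source⟩

/-- The coordinate functions of a chart. -/
def coord (i : c.ι) : M.Fn c.source :=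
  (c.iso c.source subset_rfl).symm (modelCoord c.deg _ i)

end Chart

/-- A (finite-dimensional, smooth) `ℤ`-graded manifold. -/
structure GradedManifold extends GradedSpace.{u} where
  t2 : T2Space X
  secondCountable : SecondCountableTopology X
  exists_chart : ∀ p : X, ∃ c : Chart toGradedSpace, p ∈ c.source

/-! ## Cartan calculus -/

section Calculus

variable {M : GradedSpace.{u}}

theorem sgn_sq (n : ℤ) : sgn n * sgn n = 1 := by
  unfold sgn; split_ifs <;> norm_num

theorem GradedSpace.res_res {U V W : Opens M.X} (h : V ≤ U) (h' : W ≤ V) (f : M.Fn U) :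
    M.res h' (M.res h f) = M.res (h'.trans h) f := by
  have := M.sheaf.presheaf.map_comp (homOfLE h).op (homOfLE h').op
  exact (DFunLike.congr_fun (congrArg AlgCat.Hom.hom this) f).symm

theorem GradedSpace.res_self {U : Opens M.X} (h : U ≤ U) (f : M.Fn U) : M.res h f = f :=
  DFunLike.congr_fun (congrArg AlgCat.Hom.hom (M.sheaf.presheaf.map_id (op U))) f

theorem GradedSpace.res_homog {U V : Opens M.X} (h : V ≤ U) {k : ℤ} {f : M.Fn U}
    (hf : f ∈ M.homog U k) : M.res h f ∈ M.homog V k :=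
  M.res_mem h hf

/-- A vector field of degree `j` on the open set `U`: a derivation of degree `j` of the sheaf of
functions restricted to `U`. -/
@[ext]
structure VField (M : GradedSpace.{u}) (U : Opens M.X) (j : ℤ) where
  app : ∀ V : Opens M.X, V ≤ U → (M.Fn V →ₗ[ℝ] M.Fn V)
  app_res : ∀ {V W : Opens M.X} (hV : V ≤ U) (hW : W ≤ V) (f : M.Fn V),
    app W (hW.trans hV) (M.res hW f) = M.res hW (app V hV f)
  app_mem : ∀ {V : Opens M.X} (hV : V ≤ U) {k : ℤ} {f : M.Fn V},
    f ∈ M.homog V k → app V hV f ∈ M.homog V (j + k)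
  leibniz : ∀ {V : Opens M.X} (hV : V ≤ U) {k : ℤ} {f : M.Fn V}, f ∈ M.homog V k →
    ∀ g : M.Fn V, app V hV (f * g) = app V hV f * g + sgn (j * k) • (f * app V hV g)

namespace VField

variable {U V : Opens M.X} {i j : ℤ}

/-- Restriction of a vector field. -/
def restrict (X : VField M U j) (h : V ≤ U) : VField M V j where
  app W hW := X.app W (hW.trans h)
  app_res hV hW f := X.app_res (hV.trans h) hW f
  app_mem hV _ _ hf := X.app_mem (hV.trans h) hf
  leibniz hV _ _ hf g := X.leibniz (hV.trans h) hf g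

/-- The same vector field, with its degree written differently. -/
def cast (X : VField M U i) (h : i = j) : VField M U j where
  app := X.app
  app_res := X.app_res
  app_mem := h ▸ X.app_mem
  leibniz := h ▸ X.leibniz

instance : Zero (VField M U j) where
  zero :=
    { app := fun _ _ => 0
      app_res := fun _ _ _ => by simp
      app_mem := fun _ _ _ _ => by simp
      leibniz := fun _ _ _ _ _ => by simp }

instance : Add (VField M U j) where
  add X Y :=
    { app := fun V h => X.app V h + Y.app V h
      app_res := fun h h' f => by simp [X.app_res h h', Y.app_res h h']
      app_mem := fun h _ _ hf => add_mem (X.app_mem h hf) (Y.app_mem h hf)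
      leibniz := fun h _ _ hf g => by
        simp only [LinearMap.add_apply, X.leibniz h hf, Y.leibniz h hf, add_mul, mul_add, smul_add]
        abel }

instance : SMul ℝ (VField M U j) where
  smul r X :=
    { app := fun V h => r • X.app V h
      app_res := fun h h' f => by simp [X.app_res h h']
      app_mem := fun h _ _ hf => Submodule.smul_mem _ r (X.app_mem h hf)
      leibniz := fun h _ _ hf g => by
        simp only [LinearMap.smul_apply, X.leibniz h hf, smul_mul_assoc, mul_smul_comm, smul_add,
          smul_smul, mul_comm] }

/-- The product `f X` of a function of degree `i` and a vector field. -/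
def fmul (f : M.Fn U) (hf : f ∈ M.homog U i) (X : VField M U j) : VField M U (i + j) where
  app V h := (LinearMap.mulLeft ℝ (M.res h f)).comp (X.app V h)
  app_res h h' g := by
    simp [X.app_res h h', GradedSpace.res_res]
  app_mem h k g hg := by
    rw [add_assoc]
    exact M.mul_mem (GradedSpace.res_homog h hf) (X.app_mem h hg)
  leibniz {V} h k g hg t := by
    have hc : M.res h f * g = sgn (i * k) • (g * M.res h f) := M.comm (GradedSpace.res_homog h hf) hg
    have hs : sgn ((i + j) * k) = sgn (j * k) * sgn (i * k) := by
      unfold sgn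
      by_cases h1 : Even i <;> by_cases h2 : Even j <;> by_cases h3 : Even k <;>
        simp only [Int.even_add, Int.even_mul, h1, h2, h3] <;> norm_num
    simp only [LinearMap.comp_apply, LinearMap.mulLeft_apply, X.leibniz h hg, mul_add,
      mul_smul_comm, hs]
    rw [← mul_assoc (M.res h f) g, hc, smul_mul_assoc, smul_smul, mul_assoc, mul_assoc]

/-- The graded commutator `[X, Y] = X Y - (-1)^{|X||Y|} Y X`. -/
def bracket (X : VField M U i) (Y : VField M U j) : VField M U (i + j) where
  app V h := (X.app V h).comp (Y.app V h) - sgn (i * j) • (Y.app V h).comp (X.app V h)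
  app_res h h' f := by simp [X.app_res h h', Y.app_res h h']
  app_mem h k f hf := by
    have h1 := X.app_mem h (Y.app_mem h hf)
    have h2 := Y.app_mem h (X.app_mem h hf)
    rw [← add_assoc] at h1 h2
    rw [add_comm j i] at h2
    exact sub_mem h1 (Submodule.smul_mem _ _ h2)
  leibniz h k f hf g := by
    have e1 := Y.leibniz h hf g
    have e2 := X.leibniz h hf g
    simp only [LinearMap.sub_apply, LinearMap.smul_apply, LinearMap.comp_apply, e1, e2, map_add,
      map_smul, X.leibniz h hf, X.leibniz h (Y.app_mem h hf), Y.leibniz h hf,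
      Y.leibniz h (X.app_mem h hf), sub_mul, mul_sub, smul_add, smul_sub, smul_smul,
      smul_mul_assoc, mul_smul_comm]
    have s1 : sgn (i * (j + k)) = sgn (i * j) * sgn (i * k) := by
      unfold sgn
      by_cases h1 : Even i <;> by_cases h2 : Even j <;> by_cases h3 : Even k <;>
        simp only [Int.even_add, Int.even_mul, h1, h2, h3] <;> norm_num
    have s2 : sgn (j * (i + k)) = sgn (i * j) * sgn (j * k) := by
      unfold sgn
      by_cases h1 : Even i <;> by_cases h2 : Even j <;> by_cases h3 : Even k <;>
        simp only [Int.even_add, Int.even_mul, h1, h2, h3] <;> norm_num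
    have s3 : sgn ((i + j) * k) = sgn (i * k) * sgn (j * k) := by
      unfold sgn
      by_cases h1 : Even i <;> by_cases h2 : Even j <;> by_cases h3 : Even k <;>
        simp only [Int.even_add, Int.even_mul, h1, h2, h3] <;> norm_num
    have s4 := sgn_sq (i * j)
    simp only [s1, s2, s3]
    have c1 : sgn (i * j) * (sgn (i * j) * sgn (j * k)) = sgn (j * k) := by
      rw [← mul_assoc, s4, one_mul]
    rw [c1]
    have c2 : sgn (i * k) * sgn (j * k) * sgn (i * j) = sgn (i * j) * (sgn (j * k) * sgn (i * k)) := by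
      ring
    rw [c2, mul_comm (sgn (j * k)) (sgn (i * k))]
    abel

end VField

/-- A differential 1-form on the open set `U`, given by its contractions `ev X = i_X α` with vector
fields; these are linear over functions, `i_{fX} α = f i_X α`. -/
@[ext]
structure OneForm (M : GradedSpace.{u}) (U : Opens M.X) where
  ev : ∀ (V : Opens M.X), V ≤ U → ∀ {j : ℤ}, VField M V j → M.Fn V
  ev_res : ∀ {V W : Opens M.X} (hV : V ≤ U) (hW : W ≤ V) {j : ℤ} (X : VField M V j),
    ev W (hW.trans hV) (X.restrict hW) = M.res hW (ev V hV X)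
  ev_add : ∀ {V : Opens M.X} (hV : V ≤ U) {j : ℤ} (X Y : VField M V j),
    ev V hV (X + Y) = ev V hV X + ev V hV Y
  ev_fmul : ∀ {V : Opens M.X} (hV : V ≤ U) {i j : ℤ} (f : M.Fn V) (hf : f ∈ M.homog V i)
    (X : VField M V j), ev V hV (X.fmul f hf) = f * ev V hV X

/-- A differential 2-form on the open set `U`, given by its contractions
`ev X Y = i_X i_Y ω`; here `i_X i_Y = (-1)^{(|X|+1)(|Y|+1)} i_Y i_X`. -/
@[ext]
structure TwoForm (M : GradedSpace.{u}) (U : Opens M.X) where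
  ev : ∀ (V : Opens M.X), V ≤ U → ∀ {i j : ℤ}, VField M V i → VField M V j → M.Fn V
  ev_res : ∀ {V W : Opens M.X} (hV : V ≤ U) (hW : W ≤ V) {i j : ℤ} (X : VField M V i)
    (Y : VField M V j),
    ev W (hW.trans hV) (X.restrict hW) (Y.restrict hW) = M.res hW (ev V hV X Y)
  ev_add : ∀ {V : Opens M.X} (hV : V ≤ U) {i j : ℤ} (X X' : VField M V i) (Y : VField M V j),
    ev V hV (X + X') Y = ev V hV X Y + ev V hV X' Y
  ev_fmul : ∀ {V : Opens M.X} (hV : V ≤ U) {i j k : ℤ} (f : M.Fn V) (hf : f ∈ M.homog V k)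
    (X : VField M V i) (Y : VField M V j), ev V hV (X.fmul f hf) Y = f * ev V hV X Y
  ev_symm : ∀ {V : Opens M.X} (hV : V ≤ U) {i j : ℤ} (X : VField M V i) (Y : VField M V j),
    ev V hV X Y = sgn ((i + 1) * (j + 1)) • ev V hV Y X

theorem OneForm.ev_cast {U V : Opens M.X} (α : OneForm M U) (hV : V ≤ U) {i j : ℤ} (hij : i = j)
    (X : VField M V i) : α.ev V hV (X.cast hij) = α.ev V hV X := by
  subst hij
  rfl

theorem OneForm.ev_congr {U V : Opens M.X} (α : OneForm M U) (hV : V ≤ U) {i j : ℤ} (hij : i = j)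
    (X : VField M V i) (Y : VField M V j) (h : X.app = Y.app) : α.ev V hV X = α.ev V hV Y := by
  subst hij
  rw [VField.ext h]

namespace OneForm

variable {U V : Opens M.X} {i j : ℤ}

/-- A 1-form of ghost degree `a`. -/
def HasDegree (α : OneForm M U) (a : ℤ) : Prop :=
  ∀ (V : Opens M.X) (hV : V ≤ U) (j : ℤ) (X : VField M V j), α.ev V hV X ∈ M.homog V (a + j)

/-- Restriction of a 1-form. -/
def restrict (α : OneForm M U) (h : V ≤ U) : OneForm M V where
  ev W hW _ X := α.ev W (hW.trans h) X
  ev_res hV hW _ X := α.ev_res (hV.trans h) hW X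
  ev_add hV _ X Y := α.ev_add (hV.trans h) X Y
  ev_fmul hV _ _ f hf X := α.ev_fmul (hV.trans h) f hf X

instance : Add (OneForm M U) where
  add α β :=
    { ev := fun V h _ X => α.ev V h X + β.ev V h X
      ev_res := fun h h' _ X => by simp [α.ev_res h h', β.ev_res h h']
      ev_add := fun h _ X Y => by rw [α.ev_add, β.ev_add]; abel
      ev_fmul := fun h _ _ f hf X => by rw [α.ev_fmul, β.ev_fmul, mul_add] }

instance : SMul ℝ (OneForm M U) where
  smul r α :=
    { ev := fun V h _ X => r • α.ev V h X
      ev_res := fun h h' _ X => by simp [α.ev_res h h']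
      ev_add := fun h _ X Y => by rw [α.ev_add, smul_add]
      ev_fmul := fun h _ _ f hf X => by rw [α.ev_fmul, mul_smul_comm] }

/-- The bracket of `Z` with `f X`. -/
theorem ev_bracket_fmul (α : OneForm M U) (hV : V ≤ U) {k : ℤ} (Z : VField M V k) (f : M.Fn V)
    (hf : f ∈ M.homog V i) (X : VField M V j) :
    α.ev V hV (Z.bracket (X.fmul f hf)) =
      Z.app V le_rfl f * α.ev V hV X + sgn (k * i) • (f * α.ev V hV (Z.bracket X)) := by
  have hs : sgn (k * i) • f ∈ M.homog V i := Submodule.smul_mem _ _ hf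
  have key : α.ev V hV (Z.bracket (X.fmul f hf)) =
      α.ev V hV ((X.fmul _ (Z.app_mem le_rfl hf)).cast (by ring) +
        ((Z.bracket X).fmul (sgn (k * i) • f) hs).cast (by ring) : VField M V (k + (i + j))) := by
    apply ev_congr _ _ rfl
    funext W hW
    ext g
    have e : Z.app W hW (M.res hW f * X.app W hW g) =
        M.res hW (Z.app V le_rfl f) * X.app W hW g +
          sgn (k * i) • (M.res hW f * Z.app W hW (X.app W hW g)) := by
      rw [Z.leibniz hW (GradedSpace.res_homog hW hf), ← Z.app_res le_rfl hW]
    have hs' : sgn (k * (i + j)) = sgn (k * i) * sgn (k * j) := by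
      unfold sgn
      by_cases h1 : Even i <;> by_cases h2 : Even j <;> by_cases h3 : Even k <;>
        simp only [Int.even_add, Int.even_mul, h1, h2, h3] <;> norm_num
    change Z.app W hW (M.res hW f * X.app W hW g) - sgn (k * (i + j)) • (M.res hW f *
      X.app W hW (Z.app W hW g)) = M.res hW (Z.app V le_rfl f) * X.app W hW g +
      M.res hW (sgn (k * i) • f) * (Z.app W hW (X.app W hW g) - sgn (k * j) •
        X.app W hW (Z.app W hW g))
    rw [e, hs', map_smul, mul_sub, smul_mul_assoc, smul_mul_assoc, mul_smul_comm, smul_smul]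
    abel
  rw [key, ev_add, ev_cast, ev_cast, ev_fmul, ev_fmul, smul_mul_assoc]

/-- The differential of a function, `i_X df = X f`. -/
def dFun (f : M.Fn U) : OneForm M U where
  ev V h _ X := X.app V le_rfl (M.res h f)
  ev_res {V W} h h' _ X := by
    rw [← X.app_res le_rfl h', GradedSpace.res_res]; rfl
  ev_add _ _ _ _ := rfl
  ev_fmul {V} h _ _ g hg X := by
    change M.res le_rfl g * _ = _
    rw [GradedSpace.res_self]

theorem ev_smul (α : OneForm M U) (hV : V ≤ U) (r : ℝ) (X : VField M V j) :
    α.ev V hV (r • X) = r • α.ev V hV X := by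
  have hr : r • (1 : M.Fn V) ∈ M.homog V 0 := Submodule.smul_mem _ _ (M.one_mem V)
  rw [α.ev_congr hV (zero_add j).symm (r • X) (X.fmul _ hr), ev_fmul, smul_mul_assoc, one_mul]
  funext W hW
  ext g
  change r • X.app W hW g = M.res hW (r • 1) * X.app W hW g
  rw [map_smul, map_one, smul_mul_assoc, one_mul]

theorem ev_bracket_symm (α : OneForm M U) (hV : V ≤ U) (X : VField M V i) (Y : VField M V j) :
    α.ev V hV (X.bracket Y) = -(sgn (i * j) • α.ev V hV (Y.bracket X)) := by
  rw [← neg_smul, ← ev_smul]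
  apply ev_congr _ _ (add_comm i j)
  funext W hW
  ext g
  change X.app W hW (Y.app W hW g) - sgn (i * j) • Y.app W hW (X.app W hW g) =
    (-sgn (i * j)) • (Y.app W hW (X.app W hW g) - sgn (j * i) • X.app W hW (Y.app W hW g))
  rw [mul_comm j i, smul_sub, smul_smul, neg_mul, sgn_sq]
  simp only [neg_smul, one_smul]
  abel

theorem ev_bracket_add (α : OneForm M U) (hV : V ≤ U) {k : ℤ} (Z : VField M V k)
    (X Y : VField M V j) :
    α.ev V hV (Z.bracket (X + Y)) = α.ev V hV (Z.bracket X) + α.ev V hV (Z.bracket Y) := by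
  rw [← ev_add]
  apply ev_congr _ _ rfl
  funext W hW
  ext g
  change Z.app W hW (X.app W hW g + Y.app W hW g) - sgn (k * j) • (X.app W hW (Z.app W hW g) +
    Y.app W hW (Z.app W hW g)) = (Z.app W hW (X.app W hW g) - sgn (k * j) •
    X.app W hW (Z.app W hW g)) + (Z.app W hW (Y.app W hW g) - sgn (k * j) •
    Y.app W hW (Z.app W hW g))
  rw [map_add, smul_add]
  abel

/-- The Lie derivative of a 1-form along `Z`, determined by
`L_Z i_X - (-1)^{|Z|(|X|+1)} i_X L_Z = i_{[Z,X]}`. -/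
def lie {k : ℤ} (Z : VField M U k) (α : OneForm M U) : OneForm M U where
  ev V h j X := sgn (k * (j + 1)) •
    (Z.app V h (α.ev V h X) - α.ev V h ((Z.restrict h).bracket X))
  ev_res h h' j X := by
    rw [α.ev_res h h', Z.app_res h h', map_smul, map_sub, ← α.ev_res h h']
    rfl
  ev_add {V} h j X Y := by
    rw [α.ev_add, map_add, ev_bracket_add, ← smul_add]
    congr 1
    abel
  ev_fmul {V} h i j f hf X := by
    have e := ev_bracket_fmul α h (Z.restrict h) f hf X
    have hs : sgn (k * (i + j + 1)) * sgn (k * i) = sgn (k * (j + 1)) := by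
      unfold sgn
      by_cases h1 : Even i <;> by_cases h2 : Even j <;> by_cases h3 : Even k <;>
        simp only [Int.even_add, Int.even_mul, Int.not_even_one, h1, h2, h3] <;> norm_num
    rw [e, α.ev_fmul, Z.leibniz h hf, mul_smul_comm, ← hs, mul_smul]
    change _ • (Z.app V h f * _ + _ - (Z.app V h f * _ + _)) = _
    rw [add_sub_add_left_eq_sub, ← smul_sub, mul_sub]

/-- The exterior differential of a 1-form, determined by `L_Y = i_Y d + (-1)^{|Y|} d i_Y`. -/
def extDeriv (α : OneForm M U) : TwoForm M U where
  ev V h i j X Y := sgn (j * (i + 1)) •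
      (Y.app V le_rfl (α.ev V h X) - α.ev V h (Y.bracket X)) -
    sgn j • X.app V le_rfl (α.ev V h Y)
  ev_res h h' i j X Y := by
    rw [α.ev_res h h' X, α.ev_res h h' Y, map_sub, map_smul, map_smul, map_sub,
      ← α.ev_res h h' (Y.bracket X), ← X.app_res le_rfl h', ← Y.app_res le_rfl h']
    rfl
  ev_add {V} h i j X X' Y := by
    rw [α.ev_add, map_add, ev_bracket_add]
    change _ - sgn j • (X.app V le_rfl (α.ev V h Y) + X'.app V le_rfl (α.ev V h Y)) = _
    simp only [smul_add, smul_sub]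
    abel
  ev_fmul {V} h i j k f hf X Y := by
    have e := ev_bracket_fmul α h Y f hf X
    have hs : sgn (j * (k + i + 1)) * sgn (j * k) = sgn (j * (i + 1)) := by
      unfold sgn
      by_cases h1 : Even i <;> by_cases h2 : Even j <;> by_cases h3 : Even k <;>
        simp only [Int.even_add, Int.even_mul, Int.not_even_one, h1, h2, h3] <;> norm_num
    rw [e, α.ev_fmul, Y.leibniz le_rfl hf, add_sub_add_left_eq_sub, ← smul_sub, smul_smul, hs]
    change _ - sgn j • (M.res le_rfl f * X.app V le_rfl (α.ev V h Y)) = _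
    rw [GradedSpace.res_self, ← mul_sub, mul_sub f (_ • _), mul_smul_comm, mul_smul_comm]
  ev_symm {V} h i j X Y := by
    rw [ev_bracket_symm α h Y X]
    simp only [smul_sub, smul_add, smul_smul, sub_neg_eq_add]
    have s1 : sgn ((i + 1) * (j + 1)) * sgn (i * (j + 1)) = -(- sgn (j + 1)) := by
      unfold sgn
      by_cases h1 : Even i <;> by_cases h2 : Even j <;>
        simp only [Int.even_add, Int.even_mul, Int.not_even_one, h1, h2] <;> norm_num
    have s2 : sgn ((i + 1) * (j + 1)) * sgn i = -sgn (j * (i + 1)) := by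
      unfold sgn
      by_cases h1 : Even i <;> by_cases h2 : Even j <;>
        simp only [Int.even_add, Int.even_mul, Int.not_even_one, h1, h2] <;> norm_num
    have s3 : sgn (j * (i + 1)) * sgn (j * i) = sgn j := by
      unfold sgn
      by_cases h1 : Even i <;> by_cases h2 : Even j <;>
        simp only [Int.even_add, Int.even_mul, Int.not_even_one, h1, h2] <;> norm_num
    have s4 : sgn (j + 1) = - sgn j := by
      unfold sgn
      by_cases h2 : Even j <;> simp only [Int.even_add, Int.not_even_one, h2] <;> norm_num
    rw [s1, s2, s3, s4]
    simp only [neg_smul, neg_neg, sub_neg_eq_add]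
    abel

end OneForm

namespace TwoForm

variable {U : Opens M.X} {i j : ℤ}

/-- A 2-form of ghost degree `a`. -/
def HasDegree (ω : TwoForm M U) (a : ℤ) : Prop :=
  ∀ (V : Opens M.X) (hV : V ≤ U) (i j : ℤ) (X : VField M V i) (Y : VField M V j),
    ω.ev V hV X Y ∈ M.homog V (a + i + j)

/-- The contraction `i_Y ω` on the (smaller) open set where `Y` is defined. -/
def contract (ω : TwoForm M U) {V : Opens M.X} (hV : V ≤ U) (Y : VField M V j) :
    OneForm M V where
  ev W h _ X := ω.ev W (h.trans hV) X (Y.restrict h)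
  ev_res h h' _ X := ω.ev_res (h.trans hV) h' X (Y.restrict h)
  ev_add h _ X X' := ω.ev_add (h.trans hV) X X' _
  ev_fmul h _ _ f hf X := ω.ev_fmul (h.trans hV) f hf X _

/-- `i_X i_Y L_Z ω`, for the Lie derivative determined by
`L_Z i_X - (-1)^{|Z|(|X|+1)} i_X L_Z = i_{[Z,X]}`. -/
def lieEv (ω : TwoForm M U) {V : Opens M.X} (hV : V ≤ U) {k : ℤ} (Z : VField M V k)
    (X : VField M V i) (Y : VField M V j) : M.Fn V :=
  sgn (k * (j + 1)) • (sgn (k * (i + 1)) •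
    (Z.app V le_rfl (ω.ev V hV X Y) - ω.ev V hV (Z.bracket X) Y) - ω.ev V hV X (Z.bracket Y))

/-- `dω = 0`, that is, `i_Z dω = L_Z ω - (-1)^{|Z|} d i_Z ω` vanishes for all `Z`. -/
def IsClosed (ω : TwoForm M U) : Prop :=
  ∀ (V : Opens M.X) (hV : V ≤ U) (k i j : ℤ) (Z : VField M V k) (X : VField M V i)
    (Y : VField M V j),
    ω.lieEv hV Z X Y - sgn k • (ω.contract hV Z).extDeriv.ev V le_rfl X Y = 0

end TwoForm

end Calculus

/-! ## Morphisms, bundles and pullbacks -/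

/-- A morphism of graded manifolds. -/
structure Hom (M N : GradedManifold.{u}) where
  body : C(M.X, N.X)
  pull : ∀ V : Opens N.X, N.Fn V →ₐ[ℝ] M.Fn (V.comap body)
  pull_res : ∀ {V W : Opens N.X} (h : W ≤ V) (f : N.Fn V),
    pull W (N.res h f) = M.res (fun _ hp => h hp) (pull V f)
  pull_mem : ∀ {V : Opens N.X} {k : ℤ} {f : N.Fn V}, f ∈ N.homog V k →
    pull V f ∈ M.homog (V.comap body) k

/-- The preimage of an open set. -/
abbrev Hom.pre {M N : GradedManifold.{u}} (φ : Hom M N) (V : Opens N.X) : Opens M.X :=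
  V.comap φ.body

/-- Pullback of a function, restricted to an open set in the preimage of its domain. -/
def Hom.pullOn {M N : GradedManifold.{u}} (φ : Hom M N) {V : Opens N.X} {W : Opens M.X}
    (h : W ≤ φ.pre V) : N.Fn V →ₐ[ℝ] M.Fn W :=
  (M.res h).comp (φ.pull V)

/-- A morphism from the open submanifold `U` of `M` to `N`. -/
structure LocalHom (M : GradedManifold.{u}) (U : Opens M.X) (N : GradedManifold.{u}) where
  body : C(U, N.X)
  pull : ∀ (V : Opens N.X) (W : Opens M.X) (_ : W ≤ U)
    (_ : ∀ p : U, (p : M.X) ∈ W → body p ∈ V), N.Fn V →ₐ[ℝ] M.Fn W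
  pull_res : ∀ {V V' : Opens N.X} {W W' : Opens M.X} (hV : V' ≤ V) (hW : W' ≤ W) (h : W ≤ U)
    (h₁ : ∀ p : U, (p : M.X) ∈ W → body p ∈ V) (h₂ : ∀ p : U, (p : M.X) ∈ W' → body p ∈ V')
    (f : N.Fn V), pull V' W' (hW.trans h) h₂ (N.res hV f) = M.res hW (pull V W h h₁ f)
  pull_mem : ∀ {V : Opens N.X} {W : Opens M.X} (h : W ≤ U)
    (h₁ : ∀ p : U, (p : M.X) ∈ W → body p ∈ V) {k : ℤ} {f : N.Fn V}, f ∈ N.homog V k →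
    pull V W h h₁ f ∈ M.homog W k

section Bundles

variable {E B F : GradedManifold.{u}}

/-- `q` exhibits the part of `E` over `U` as the product `U × F`: the underlying space is the
product, and coordinates on `U` and on `F` together are coordinates on `E`. -/
def IsTrivialization (π : Hom E B) (U : Opens B.X) (q : LocalHom E (π.pre U) F) : Prop :=
  (∃ h : π.pre U ≃ₜ U × F.X, ∀ p, ((h p).1 : B.X) = π.body p ∧ (h p).2 = q.body p) ∧
  ∀ (b : Chart B.toGradedSpace) (f : Chart F.toGradedSpace), b.source ≤ U →
    ∃ (c : Chart E.toGradedSpace) (ε : b.ι ⊕ f.ι ≃ c.ι)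
      (hb : c.source ≤ π.pre b.source) (hU : c.source ≤ π.pre U)
      (hf : ∀ p : π.pre U, (p : E.X) ∈ c.source → q.body p ∈ f.source),
      (∀ p : π.pre U, π.body p ∈ b.source → q.body p ∈ f.source → (p : E.X) ∈ c.source) ∧
      (∀ i, c.deg (ε (.inl i)) = b.deg i ∧
        c.coord (ε (.inl i)) = π.pullOn hb (b.coord i)) ∧
      (∀ a, c.deg (ε (.inr a)) = f.deg a ∧
        c.coord (ε (.inr a)) = q.pull f.source c.source hU hf (f.coord a))

/-- A graded fibre bundle: a locally trivial morphism of graded manifolds. -/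
def IsFibreBundle (π : Hom E B) : Prop :=
  ∀ p : B.X, ∃ (U : Opens B.X) (F : GradedManifold.{u}) (q : LocalHom E (π.pre U) F),
    p ∈ U ∧ IsTrivialization π U q

/-- Adapted coordinates of `π : E → B`: part of the coordinates are pulled back from coordinates of
the base, the remaining ones are the fibre coordinates. -/
structure AdaptedChart (π : Hom E B) where
  total : Chart E.toGradedSpace
  base : Chart B.toGradedSpace
  le_pre : total.source ≤ π.pre base.source
  emb : base.ι ↪ total.ι
  deg_emb : ∀ i, total.deg (emb i) = base.deg i
  coord_emb : ∀ i, total.coord (emb i) = π.pullOn le_pre (base.coord i)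

namespace AdaptedChart

variable {π : Hom E B} (a : AdaptedChart π)

/-- Indices of the fibre coordinates. -/
abbrev FibIdx : Type := {A : a.total.ι // A ∉ Set.range a.emb}

instance : Fintype a.FibIdx := Fintype.ofFinite _

/-- The domain of the adapted coordinates in the total space. -/
abbrev source : Opens E.X := a.total.source

end AdaptedChart

/-- The coordinate vector fields `∂_i` of a chart: the frame of the tangent bundle dual to the
coordinates, `∂_i z^j = δ_i^j` and `X = ∑ X(z^i) ∂_i` for every vector field `X`. -/
def IsCoordFrame {M : GradedSpace.{u}} (c : Chart M)
    (d : ∀ i : c.ι, VField M c.source (-c.deg i)) : Prop :=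
  (∀ i, (d i).app c.source le_rfl (c.coord i) = 1) ∧
  (∀ i j, i ≠ j → (d i).app c.source le_rfl (c.coord j) = 0) ∧
  ∀ (V : Opens M.X) (hV : V ≤ c.source) (k : ℤ) (X : VField M V k) (W : Opens M.X) (hW : W ≤ V)
    (f : M.Fn W), X.app W hW f =
      ∑ i, X.app W hW (M.res (hW.trans hV) (c.coord i)) * (d i).app W (hW.trans hV) f

/-- The vector field `X` on `E` projects to `v` on the base: `X ∘ π^* = π^* ∘ v`. -/
def Projects (π : Hom E B) {W : Opens E.X} {U : Opens B.X} {j : ℤ} (X : VField E.toGradedSpace W j)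
    (v : VField B.toGradedSpace U j) : Prop :=
  ∀ (V : Opens B.X) (hV : V ≤ U) (W' : Opens E.X) (hW' : W' ≤ W) (h : W' ≤ π.pre V) (f : B.Fn V),
    X.app W' hW' (π.pullOn h f) = π.pullOn h (v.app V hV f)

/-- A vector field is vertical if it annihilates all functions pulled back from the base. -/
def IsVertical (π : Hom E B) {W : Opens E.X} {j : ℤ} (X : VField E.toGradedSpace W j) : Prop :=
  ∀ (V : Opens B.X) (W' : Opens E.X) (hW' : W' ≤ W) (h : W' ≤ π.pre V) (f : B.Fn V),
    X.app W' hW' (π.pullOn h f) = 0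

/-- `η` is the pullback `π^* β`: locally `β = ∑ dg_a s_a` with
homogeneous `g_a`, and `η = ∑ d(π^* g_a) π^* s_a`. -/
def IsPullback (π : Hom E B) {U : Opens B.X} {W : Opens E.X} (β : OneForm B.toGradedSpace U)
    (η : OneForm E.toGradedSpace W) : Prop :=
  ∀ p ∈ W, ∃ (O : Opens B.X) (W' : Opens E.X) (hO : O ≤ U) (hW' : W' ≤ W) (h : W' ≤ π.pre O)
    (m : ℕ) (e : Fin m → ℤ) (g s : Fin m → B.Fn O), p ∈ W' ∧ (∀ a, g a ∈ B.homog O (e a)) ∧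
    (∀ (V : Opens B.X) (hV : V ≤ O) (j : ℤ) (X : VField B.toGradedSpace V j),
      β.ev V (hV.trans hO) X = ∑ a, X.app V le_rfl (B.res hV (g a)) * B.res hV (s a)) ∧
    (∀ (V : Opens E.X) (hV : V ≤ W') (j : ℤ) (X : VField E.toGradedSpace V j),
      η.ev V (hV.trans hW') X =
        ∑ a, X.app V le_rfl (π.pullOn (hV.trans h) (g a)) * π.pullOn (hV.trans h) (s a))

/-- The 1-form `α` belongs to the ideal (sheaf) generated by the pullbacks of the 1-forms `β` on the
base with property `S`: locally `α = ∑ (π^* β_a) f_a`. -/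
def InPullbackIdeal (π : Hom E B) (S : ∀ O : Opens B.X, OneForm B.toGradedSpace O → Prop)
    {U : Opens E.X} (α : OneForm E.toGradedSpace U) : Prop :=
  ∀ p ∈ U, ∃ (W : Opens E.X) (hW : W ≤ U) (O : Opens B.X) (m : ℕ)
    (β : Fin m → OneForm B.toGradedSpace O) (η : Fin m → OneForm E.toGradedSpace W)
    (f : Fin m → E.Fn W), p ∈ W ∧ W ≤ π.pre O ∧
    (∀ a, S O (β a) ∧ IsPullback π (β a) (η a)) ∧
    ∀ (V : Opens E.X) (hV : V ≤ W) (j : ℤ) (X : VField E.toGradedSpace V j),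
      α.ev V (hV.trans hW) X = ∑ a, (η a).ev V hV X * E.res hV (f a)

/-- The 1-forms of the ideal generated by all forms of positive degree pulled back from the base. -/
def InBaseIdeal (π : Hom E B) {U : Opens E.X} (α : OneForm E.toGradedSpace U) : Prop :=
  InPullbackIdeal π (fun _ _ => True) α

end Bundles

/-! ## Distributions and gauge PDEs -/

/-- A family of homogeneous vector fields on open sets. -/
abbrev FieldFamily (M : GradedManifold.{u}) : Type u :=
  ∀ (U : Opens M.X) (j : ℤ), VField M.toGradedSpace U j → Prop

/-- A family of vector fields is finitely generated: it consists of the combinations of finitely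
many of its global members. -/
def IsFinitelyGenerated {M : GradedManifold.{u}} (K : FieldFamily M) : Prop :=
  ∃ (m : ℕ) (d : Fin m → ℤ) (k : ∀ a, VField M.toGradedSpace ⊤ (d a)), (∀ a, K ⊤ (d a) (k a)) ∧
    ∀ (U : Opens M.X) (j : ℤ) (X : VField M.toGradedSpace U j), K U j X →
      ∃ f : Fin m → M.Fn U, (∀ a, f a ∈ M.homog U (j - d a)) ∧
        ∀ (V : Opens M.X) (hV : V ≤ U) (g : M.Fn V),
          X.app V hV g = ∑ a, M.res hV (f a) * (k a).app V le_top g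

/-- A distribution: a finitely generated (sheaf of) graded submodule(s) of vector fields. -/
structure IsDistribution {M : GradedManifold.{u}} (K : FieldFamily M) : Prop where
  zero : ∀ U j, K U j 0
  add : ∀ U j X Y, K U j X → K U j Y → K U j (X + Y)
  fmul : ∀ U i j (f : M.Fn U) (hf : f ∈ M.homog U i) X, K U j X → K U (i + j) (X.fmul f hf)
  restrict : ∀ U V j X (h : V ≤ U), K U j X → K V j (X.restrict h)
  of_locally : ∀ U j X, (∀ p ∈ U, ∃ (V : Opens M.X) (h : V ≤ U), p ∈ V ∧ K V j (X.restrict h)) →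
    K U j X
  fg : IsFinitelyGenerated K

/-- `(T, dX)` is the shifted tangent bundle `T[1]X` of a smooth `n`-manifold `X` with its de Rham
vector field: around each point there are coordinates `x^a` of degree `0` and `θ^a` of degree `1`
with `dX x^a = θ^a` and `dX θ^a = 0`. The manifold `X` is the underlying space with the
coordinates `x^a`. -/
def IsShiftedTangentBundle (n : ℕ) {T : GradedManifold.{u}} (dX : VField T.toGradedSpace ⊤ 1) :
    Prop :=
  ∀ p : T.X, ∃ (c : Chart T.toGradedSpace) (ε : Fin n ⊕ Fin n ≃ c.ι), p ∈ c.source ∧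
    ∀ a, c.deg (ε (.inl a)) = 0 ∧ c.deg (ε (.inr a)) = 1 ∧
      dX.app c.source le_top (c.coord (ε (.inl a))) = c.coord (ε (.inr a)) ∧
      dX.app c.source le_top (c.coord (ε (.inr a))) = 0

section GaugePDE

variable {T B E : GradedManifold.{u}}

/-- A weak gauge PDE `(B, γ, K, T[1]X)`: a graded bundle over `T[1]X` with a vector field `γ` of
degree `1` over `dX`, and a vertical involutive distribution `K` with `L_γ K ⊆ K` and `γ² ∈ K`. -/
structure IsWeakGaugePDE (n : ℕ) (dX : VField T.toGradedSpace ⊤ 1) (π : Hom B T)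
    (γ : VField B.toGradedSpace ⊤ 1) (K : FieldFamily B) : Prop where
  base : IsShiftedTangentBundle n dX
  bundle : IsFibreBundle π
  projects : Projects π γ dX
  distribution : IsDistribution K
  vertical : ∀ U j X, K U j X → IsVertical π X
  involutive : ∀ U i j X Y, K U i X → K U j Y → K U (i + j) (X.bracket Y)
  invariant : ∀ U j X, K U j X → K U (1 + j) ((γ.restrict le_top).bracket X)
  square : K ⊤ (1 + 1) ((1 / 2 : ℝ) • γ.bracket γ)

/-- A presymplectic gauge PDE `(E, Q, ω)` over `T[1]X`, with its function `L`. -/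
structure IsPresymplecticGaugePDE (n : ℕ) (dX : VField T.toGradedSpace ⊤ 1) (π : Hom E T)
    (Q : VField E.toGradedSpace ⊤ 1) (ω : TwoForm E.toGradedSpace ⊤) (L : E.Fn ⊤) : Prop where
  base : IsShiftedTangentBundle n dX
  bundle : IsFibreBundle π
  projects : Projects π Q dX
  deg_form : ω.HasDegree (n - 1)
  deg_fun : L ∈ E.homog ⊤ n
  closed : ω.IsClosed
  compat : InBaseIdeal π (ω.contract le_rfl Q + OneForm.dFun L)
  master : (1 / 2 : ℝ) • ω.ev ⊤ le_rfl Q Q + Q.app ⊤ le_rfl L = 0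

/-- The 1-forms `α` with `i_k α = 0` for all `k` in `K`. -/
def Annihilates (K : FieldFamily B) (O : Opens B.X) (α : OneForm B.toGradedSpace O) : Prop :=
  ∀ (V : Opens B.X) (hV : V ≤ O) (j : ℤ) (k : VField B.toGradedSpace V j), K V j k →
    α.ev V hV k = 0

/-- A presymplectic gauge PDE over background `(E, Q, ω) → (B, γ, K, T[1]X)`, with its function `L`.
In the last condition, the vector fields `k` generate a distribution on `E`, which is required to
project onto `K`. -/
structure IsPresymplecticGaugePDEOver (n : ℕ) (dX : VField T.toGradedSpace ⊤ 1) (π : Hom B T)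
    (γ : VField B.toGradedSpace ⊤ 1) (K : FieldFamily B) (πB : Hom E B)
    (Q : VField E.toGradedSpace ⊤ 1) (ω : TwoForm E.toGradedSpace ⊤) (L : E.Fn ⊤) : Prop where
  background : IsWeakGaugePDE n dX π γ K
  bundle : IsFibreBundle πB
  projects : Projects πB Q γ
  deg_form : ω.HasDegree (n - 1)
  deg_fun : L ∈ E.homog ⊤ n
  closed : ω.IsClosed
  compat : InPullbackIdeal πB (Annihilates K) (ω.contract le_rfl Q + OneForm.dFun L)
  master : (1 / 2 : ℝ) • ω.ev ⊤ le_rfl Q Q + Q.app ⊤ le_rfl L = 0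
  lift : ∀ U j (v : VField B.toGradedSpace U j), K U j v →
    ∃ k : VField E.toGradedSpace (πB.pre U) j, Projects πB k v ∧
      InPullbackIdeal πB (Annihilates K) (ω.contract le_top k)

/-- The vertical kernel distribution of `ω`: vertical `k` with `i_k ω` in the ideal generated by
forms on the base. -/
def kernelDistribution (π : Hom E T) (ω : TwoForm E.toGradedSpace ⊤) : FieldFamily E :=
  fun _ _ k => IsVertical π k ∧ InBaseIdeal π (ω.contract le_top k)

end GaugePDE

/-! ## The vertical tangent bundle and the lifts -/

section VerticalTangent

variable {T E VE : GradedManifold.{u}}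

/-- `(VE, P, D)` is the vertical tangent bundle of `π : E → T`. Here `P : VE → E` is the projection
and `D` sends a function `f` on `E` to the fibrewise linear function `φ^A ∂_A f` on `VE` given by
the differential of `f` along the fibres of `π`. Adapted coordinates `(x, ψ^A)` on an open set of
`E` induce the coordinates `(P^* x, P^* ψ^A, φ^A = D ψ^A)` on its preimage, with `φ^A` of the same
degree as `ψ^A` and arbitrary values of the `φ^A` of degree zero; in these coordinates `P` is the
projection. These data determine `(VE, P, D)` up to a unique isomorphism. -/
structure IsVerticalTangentBundle (π : Hom E T) (P : Hom VE E)
    (D : ∀ V : Opens E.X, E.Fn V →ₗ[ℝ] VE.Fn (P.pre V)) : Prop where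
  bundle : IsFibreBundle P
  D_res : ∀ {V W : Opens E.X} (h : W ≤ V) (f : E.Fn V),
    D W (E.res h f) = VE.res (fun _ hp => h hp) (D V f)
  D_mem : ∀ {V : Opens E.X} {k : ℤ} {f : E.Fn V}, f ∈ E.homog V k → D V f ∈ VE.homog (P.pre V) k
  D_mul : ∀ {V : Opens E.X} (f g : E.Fn V), D V (f * g) = D V f * P.pull V g + P.pull V f * D V g
  D_base : ∀ {O : Opens T.X} {V : Opens E.X} (h : V ≤ π.pre O) (f : T.Fn O),
    D V (π.pullOn h f) = 0
  coords : ∀ p : E.X, ∃ (a : AdaptedChart π) (d : ∀ i, VField E.toGradedSpace a.source (-a.total.deg i))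
    (c : Chart VE.toGradedSpace) (d' : ∀ i, VField VE.toGradedSpace c.source (-c.deg i))
    (ε : a.total.ι ⊕ a.FibIdx ≃ c.ι) (hc : c.source = P.pre a.source)
    (_ : ∀ i, c.deg (ε (.inl i)) = a.total.deg i) (hF : ∀ A, c.deg (ε (.inr A)) = a.total.deg A),
    p ∈ a.source ∧ IsCoordFrame a.total d ∧ IsCoordFrame c d' ∧
    (∀ i, c.coord (ε (.inl i)) = P.pullOn hc.le (a.total.coord i)) ∧
    (∀ A, c.coord (ε (.inr A)) = VE.res hc.le (D a.source (a.total.coord A))) ∧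
    (∀ (V : Opens E.X) (hV : V ≤ a.source) (hV' : P.pre V ≤ c.source) (f : E.Fn V),
      (∀ i, (d' (ε (.inl i))).app (P.pre V) hV' (P.pull V f) = P.pull V ((d i).app V hV f)) ∧
      (∀ A, (d' (ε (.inr A))).app (P.pre V) hV' (P.pull V f) = 0) ∧
      D V f = ∑ A : a.FibIdx, D V (E.res hV (a.total.coord A)) * P.pull V ((d A).app V hV f)) ∧
    (∀ x ∈ a.source, ∀ v : {A : a.FibIdx // a.total.deg A = 0} → ℝ, ∃ y, P.body y = x ∧
      ∀ A, c.κ y ⟨ε (.inr A.1), (hF A.1).trans A.2⟩ = v A)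

/-- `Qt` is the complete lift of the projectable vector field `Q` to the vertical tangent bundle:
`Qt (P^* f) = P^* (Q f)` and `Qt (D f) = D (Q f)`. There is exactly one
such vector field. -/
def IsCompleteLift {j : ℤ} (P : Hom VE E) (D : ∀ V : Opens E.X, E.Fn V →ₗ[ℝ] VE.Fn (P.pre V))
    (Q : VField E.toGradedSpace ⊤ j) (Qt : VField VE.toGradedSpace ⊤ j) : Prop :=
  ∀ (V : Opens E.X) (f : E.Fn V),
    Qt.app (P.pre V) le_top (P.pull V f) = P.pull V (Q.app V le_top f) ∧
    Qt.app (P.pre V) le_top (D V f) = D V (Q.app V le_top f)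

/-- An affine connection (of degree zero) on a graded manifold. -/
structure AffineConnection (E : GradedManifold.{u}) where
  nabla : ∀ {U : Opens E.X} {i j : ℤ}, VField E.toGradedSpace U i → VField E.toGradedSpace U j →
    VField E.toGradedSpace U (i + j)
  nabla_restrict : ∀ {U V : Opens E.X} (h : V ≤ U) {i j : ℤ} (X : VField E.toGradedSpace U i)
    (Y : VField E.toGradedSpace U j),
    nabla (X.restrict h) (Y.restrict h) = (nabla X Y).restrict h
  add_left : ∀ {U : Opens E.X} {i j : ℤ} (X X' : VField E.toGradedSpace U i)
    (Y : VField E.toGradedSpace U j), nabla (X + X') Y = nabla X Y + nabla X' Y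
  add_right : ∀ {U : Opens E.X} {i j : ℤ} (X : VField E.toGradedSpace U i)
    (Y Y' : VField E.toGradedSpace U j), nabla X (Y + Y') = nabla X Y + nabla X Y'
  fmul_left : ∀ {U : Opens E.X} {i j k : ℤ} (f : E.Fn U) (hf : f ∈ E.homog U k)
    (X : VField E.toGradedSpace U i) (Y : VField E.toGradedSpace U j) (V : Opens E.X) (hV : V ≤ U)
    (g : E.Fn V), (nabla (X.fmul f hf) Y).app V hV g = E.res hV f * (nabla X Y).app V hV g
  leibniz : ∀ {U : Opens E.X} {i j k : ℤ} (f : E.Fn U) (hf : f ∈ E.homog U k)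
    (X : VField E.toGradedSpace U i) (Y : VField E.toGradedSpace U j) (V : Opens E.X) (hV : V ≤ U)
    (g : E.Fn V), (nabla X (Y.fmul f hf)).app V hV g =
      E.res hV (X.app U le_rfl f) * Y.app V hV g +
        sgn (i * k) • (E.res hV f * (nabla X Y).app V hV g)

/-- The connection is symmetric (torsion-free): `∇_X Y - (-1)^{|X||Y|} ∇_Y X = [X, Y]`. -/
def AffineConnection.IsSymmetric (C : AffineConnection E) : Prop :=
  ∀ (U : Opens E.X) (i j : ℤ) (X : VField E.toGradedSpace U i) (Y : VField E.toGradedSpace U j)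
    (V : Opens E.X) (hV : V ≤ U) (f : E.Fn V),
    (C.nabla X Y).app V hV f - sgn (i * j) • (C.nabla Y X).app V hV f = (X.bracket Y).app V hV f

/-- The connection is compatible with the bundle `π`: the covariant derivative of a vertical field
along a vertical field is vertical. -/
def AffineConnection.IsCompatible (C : AffineConnection E) (π : Hom E T) : Prop :=
  ∀ (U : Opens E.X) (i j : ℤ) (X : VField E.toGradedSpace U i) (Y : VField E.toGradedSpace U j),
    IsVertical π X → IsVertical π Y → IsVertical π (C.nabla X Y)

/-- `V` is the vector field `φ^A ∇_A` on `VE` defined by the connection: in adapted coordinates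
`V = φ^A ∂/∂ψ^A - φ^A φ^B Γ_{BA}^C ∂/∂φ^C`, where `∇_{∂_B} ∂_A = Γ_{BA}^C ∂_C`. -/
def IsConnectionField (π : Hom E T) (P : Hom VE E)
    (D : ∀ V : Opens E.X, E.Fn V →ₗ[ℝ] VE.Fn (P.pre V)) (C : AffineConnection E)
    (V : VField VE.toGradedSpace ⊤ 0) : Prop :=
  (∀ (U : Opens E.X) (f : E.Fn U), V.app (P.pre U) le_top (P.pull U f) = D U f) ∧
  ∀ (a : AdaptedChart π) (d : ∀ i, VField E.toGradedSpace a.source (-a.total.deg i)),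
    IsCoordFrame a.total d →
    ∀ c : a.FibIdx, V.app (P.pre a.source) le_top (D a.source (a.total.coord c)) =
      -∑ A : a.FibIdx, ∑ B : a.FibIdx,
        D a.source (a.total.coord A) * D a.source (a.total.coord B) *
          P.pull a.source ((C.nabla (d B) (d A)).app a.source le_rfl (a.total.coord c))

end VerticalTangent

end GPDE

/-!
Write `P : VE → E` for the projection, `V` for the vector field of the connection (called `Γ` in
the lemmas) and `D f = V P^* f` for the fibrewise differential of a function. A *lift* of a vector
field `v` on `E` is a vector field `k` on `VE` with `k P^* f = P^* (v f)` and `k D f = D (v f)`;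
`Q̃` is the lift of `Q`. The argument rests on two facts: `V P^* f = D f`, and `D` annihilates the
functions pulled back from the base `T = T[1]X`. They give, for a lift `k` of `v`,

* `W = [V, k]` annihilates all `P^* f` (`IsLift.isVertical_bracket`), hence `i_W P^* ω = 0`;
* `Z = [V, W]` annihilates the functions of `T` (`isVerticalOver_bracket`).

As `L_V` commutes with `d` and acts on contractions by derivations,
`i_k ω̃ = ½ (L_V L_V P^* (i_v ω) + i_Z P^* ω)` (`OneForm.extDeriv_lie_lie_ev`,
`IsPullback.contract_extDeriv`). If a form `β` is a combination of differentials of functions of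
`T`, then so is `L_V L_V P^* β`, because `V` only acts on the coefficients; and `i_Z P^* ω` is a
combination of the pullbacks of the forms `i_{∂_A} ω` with vertical coordinate fields `∂_A`. Both
the differentials of functions of `T` and the forms `i_{∂_A} ω` are annihilated by the kernel
distribution (`IsBaseForm.inPullbackIdeal`). For `v = Q`, adding `dL̃` replaces `i_Q ω` by
`β = i_Q ω + dL` and yields the compatibility condition. For `v` in the kernel distribution,
`β = i_v ω` yields the condition that the distribution upstairs projects onto the kernel
distribution. The same expansion evaluated on `Q̃` is `½ V V P^*` of the master equation of `E`
plus half of the contraction of `Z` with `P^* (i_Q ω + dL)`, which vanishes since `Z` annihilates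
the functions of `T`.

The lift of a vertical vector field is given in coordinates; it satisfies `k D f = D (v f)` on the
coordinates, and for all functions because `[V, k]` then annihilates the coordinates of `E`
(`VerticalChart.exists_isLift`). Lifts are unique, so the local ones glue (`exists_isLift`).

That the kernel distribution defines a weak gauge PDE (`IsPresymplecticGaugePDE.isWeakGaugePDE`)
follows from Cartan calculus, except that `Q²` being vertical needs `d_X² = 0`. This is known on
coordinates by definition, and the passage to all functions, which are smooth in the coordinates
of degree zero and formal power series in the even ones, is not formal: a vector field that
annihilates the coordinates kills every function to all orders at every point by Hadamard's lemma,
hence vanishes (`Chart.app_eq_zero`, `AdaptedChart.isVertical`).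
-/

set_option linter.unusedSimpArgs false
set_option linter.unusedSectionVars false

namespace GPDE

/-! ### Hadamard's lemma with parameters -/

section Hadamard

open MeasureTheory

/-- A parametric integral over `[0, 1]` of a smooth function is smooth. -/
theorem contDiff_integral_unitInterval {E : Type} [NormedAddCommGroup E] [NormedSpace ℝ E]
    {h : E × ℝ → ℝ} (hh : ContDiff ℝ ((⊤ : ℕ∞) : WithTop ℕ∞) h) :
    ContDiff ℝ ((⊤ : ℕ∞) : WithTop ℕ∞) fun x => ∫ t in (0 : ℝ)..1, h (x, t) := by
  -- The integral is the value at `0` of a convolution with the indicator function of `[0, 1]`,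
  -- after multiplying the integrand by a bump function in `t`.
  let b : ContDiffBump (0 : ℝ) := ⟨2, 3, by norm_num, by norm_num⟩
  let g : E → ℝ → ℝ := fun x t => b t * h (x, -t)
  have hg : ContDiff ℝ ((⊤ : ℕ∞) : WithTop ℕ∞) (Function.uncurry g) := by
    have h1 : ContDiff ℝ ((⊤ : ℕ∞) : WithTop ℕ∞) fun q : E × ℝ => b q.2 :=
      b.contDiff.comp contDiff_snd
    exact h1.mul (hh.comp (contDiff_fst.prodMk contDiff_snd.neg))
  have hf : LocallyIntegrable (Set.indicator (Set.Ioc (0 : ℝ) 1) fun _ => (1 : ℝ)) volume :=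
    ((integrable_indicator_iff measurableSet_Ioc).2
      (integrableOn_const (by simp))).locallyIntegrable
  have key := contDiffOn_convolution_right_with_param (μ := volume) (n := ⊤)
    (ContinuousLinearMap.mul ℝ ℝ) (s := Set.univ) (k := Metric.closedBall (0 : ℝ) 3) (g := g)
    isOpen_univ (isCompact_closedBall _ _) (fun p x _ hx => by
      have : b x = 0 := b.zero_of_le_dist (by
        rw [Metric.mem_closedBall, not_le] at hx
        exact hx.le)
      simp [g, this]) hf hg.contDiffOn
  rw [Set.univ_prod_univ, contDiffOn_univ] at key
  have key' := key.comp (contDiff_id.prodMk (contDiff_const (c := (0 : ℝ))))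
  convert key' using 1
  funext x
  simp only [Function.comp, id, convolution_def, ContinuousLinearMap.mul_apply', zero_sub]
  rw [intervalIntegral.integral_of_le zero_le_one, ← integral_indicator measurableSet_Ioc]
  congr 1
  funext t
  by_cases ht : t ∈ Set.Ioc (0 : ℝ) 1
  · have : b (-t) = 1 := b.one_of_mem_closedBall (by
      rw [Metric.mem_closedBall, dist_zero_right, norm_neg, Real.norm_eq_abs, abs_of_pos ht.1]
      exact ht.2.trans one_le_two)
    simp [ht, g, this]
  · simp [ht]

/-- Hadamard's lemma for functions defined on the whole space. -/
theorem exists_hadamard_of_contDiff {k : Type} [Fintype k] {f : (k → ℝ) → ℝ}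
    (hf : ContDiff ℝ ((⊤ : ℕ∞) : WithTop ℕ∞) f) (p : k → ℝ) :
    ∃ h : k → (k → ℝ) → ℝ, (∀ i, ContDiff ℝ ((⊤ : ℕ∞) : WithTop ℕ∞) (h i)) ∧
      ∀ x, f x = f p + ∑ i, (x i - p i) * h i x := by
  classical
  refine ⟨fun i x => ∫ t in (0 : ℝ)..1, fderiv ℝ f (p + t • (x - p)) (Pi.single i 1),
    fun i => ?_, fun x => ?_⟩
  · refine contDiff_integral_unitInterval
      (h := fun q : (k → ℝ) × ℝ => fderiv ℝ f (p + q.2 • (q.1 - p)) (Pi.single i 1)) ?_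
    have h1 : ContDiff ℝ ((⊤ : ℕ∞) : WithTop ℕ∞) (fderiv ℝ f) := hf.fderiv_right (by rfl)
    exact (h1.comp (contDiff_const.add
      (contDiff_snd.smul (contDiff_fst.sub contDiff_const)))).clm_apply contDiff_const
  · have hd : ∀ t : ℝ, HasDerivAt (fun t : ℝ => f (p + t • (x - p)))
        (fderiv ℝ f (p + t • (x - p)) (x - p)) t := fun t => by
      have h1 : HasDerivAt (fun t : ℝ => p + t • (x - p)) (x - p) t := by
        simpa using ((hasDerivAt_id t).smul_const (x - p)).const_add p
      exact ((hf.differentiable (by simp)).differentiableAt.hasFDerivAt).comp_hasDerivAt t h1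
    have hc : ∀ v, Continuous fun t : ℝ => fderiv ℝ f (p + t • (x - p)) v := fun v =>
      ((hf.continuous_fderiv (by simp)).comp (by fun_prop)).clm_apply continuous_const
    have e := intervalIntegral.integral_eq_sub_of_hasDerivAt (a := 0) (b := 1)
      (fun t _ => hd t) ((hc _).intervalIntegrable _ _)
    have hx : x - p = ∑ i, (x i - p i) • (Pi.single i (1 : ℝ) : k → ℝ) := by
      funext j
      simp [Finset.sum_apply, Pi.single_apply]
    have hA : ∀ A : (k → ℝ) →L[ℝ] ℝ, A (x - p) = ∑ i, (x i - p i) * A (Pi.single i 1) := fun A => by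
      conv_lhs => rw [hx, map_sum]
      simp
    have e2 : ∫ t in (0 : ℝ)..1, fderiv ℝ f (p + t • (x - p)) (x - p) =
        ∑ i, (x i - p i) * ∫ t in (0 : ℝ)..1, fderiv ℝ f (p + t • (x - p)) (Pi.single i 1) := by
      simp_rw [← intervalIntegral.integral_const_mul]
      rw [← intervalIntegral.integral_finsetSum
        (fun i _ => ((hc _).const_mul _).intervalIntegrable _ _)]
      congr 1
      funext t
      exact hA _
    rw [← e2, e]
    simp

variable {ι : Type} {deg : ι → ℤ} [Fintype ι]

/-- Every smooth function on an open set agrees near a given point with a function that is smooth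
on the whole space. -/
theorem SmoothFn.exists_extension {O : Opens (ZeroIdx deg → ℝ)} (f : SmoothFn deg O) (p : O) :
    ∃ g : (ZeroIdx deg → ℝ) → ℝ, ContDiff ℝ ((⊤ : ℕ∞) : WithTop ℕ∞) g ∧
      ∃ O' : Opens (ZeroIdx deg → ℝ), ∃ h : O' ≤ O, (p : ZeroIdx deg → ℝ) ∈ O' ∧
        ∀ x : O', f ⟨x, h x.2⟩ = g x := by
  classical
  obtain ⟨r, hr, hO⟩ := Metric.isOpen_iff.1 O.isOpen _ p.2
  let b : ContDiffBump (p : ZeroIdx deg → ℝ) := ⟨r / 3, r / 2, by positivity, by linarith⟩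
  let F : (ZeroIdx deg → ℝ) → ℝ := fun x => if hx : x ∈ O then f ⟨x, hx⟩ else 0
  have hF : ∀ x ∈ O, ContDiffAt ℝ ((⊤ : ℕ∞) : WithTop ℕ∞) F x := fun x hx => by
    rw [← contMDiffAt_iff_contDiffAt]
    have : ContMDiffAt (modelWithCornersSelf ℝ (ZeroIdx deg → ℝ)) (modelWithCornersSelf ℝ ℝ)
        ((⊤ : ℕ∞) : WithTop ℕ∞) (fun y : O => F y) ⟨x, hx⟩ := by
      have e : (fun y : O => F y) = f := by
        funext y
        simp [F]
      rw [e]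
      exact f.contMDiff _
    exact contMDiffAt_subtype_iff.1 this
  refine ⟨fun x => b x * F x, contDiff_iff_contDiffAt.2 fun x => ?_,
    ⟨Metric.ball p (r / 3), Metric.isOpen_ball⟩,
    fun x hx => hO (Metric.ball_subset_ball (by linarith) hx),
    Metric.mem_ball_self (by positivity), fun x => ?_⟩
  · by_cases hx : x ∈ O
    · exact b.contDiffAt.mul (hF x hx)
    · have hx' : x ∉ Metric.closedBall (p : ZeroIdx deg → ℝ) (r / 2) := fun h =>
        hx (hO (Metric.closedBall_subset_ball (by linarith) h))
      have : (fun x => b x * F x) =ᶠ[nhds x] fun _ => 0 := by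
        filter_upwards [Metric.isClosed_closedBall.isOpen_compl.mem_nhds hx'] with y hy
        have : b y = 0 := b.zero_of_le_dist (by
          simp only [Set.mem_compl_iff, Metric.mem_closedBall, not_le] at hy
          exact hy.le)
        simp [this]
      exact contDiffAt_const.congr_of_eventuallyEq this
  · have h1 : b (x : ZeroIdx deg → ℝ) = 1 :=
      b.one_of_mem_closedBall (Metric.ball_subset_closedBall x.2)
    have h2 : (x : ZeroIdx deg → ℝ) ∈ O := hO (Metric.ball_subset_ball (by linarith) x.2)
    simp [h1, F, h2]

/-- Hadamard's lemma: near `p`, a smooth function is the sum of its value at `p` and a combination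
of the coordinates centred at `p`. -/
theorem SmoothFn.exists_hadamard {O : Opens (ZeroIdx deg → ℝ)} (f : SmoothFn deg O) (p : O) :
    ∃ O' : Opens (ZeroIdx deg → ℝ), ∃ h : O' ≤ O, (p : ZeroIdx deg → ℝ) ∈ O' ∧
      ∀ (O'' : Opens (ZeroIdx deg → ℝ)) (h' : O'' ≤ O'), ∃ g : ZeroIdx deg → SmoothFn deg O'',
      smoothRes deg (h'.trans h) f = algebraMap ℝ _ (f p) +
        ∑ i, (smoothCoord deg O'' i - algebraMap ℝ _ ((p : ZeroIdx deg → ℝ) i)) * g i := by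
  obtain ⟨F, hF, O', hO', hp, hfF⟩ := f.exists_extension p
  obtain ⟨g, hg, e⟩ := exists_hadamard_of_contDiff hF (p : ZeroIdx deg → ℝ)
  refine ⟨O', hO', hp, fun O'' h' => ⟨fun i => ⟨fun x => g i x,
    (hg i).contMDiff.comp contMDiff_subtype_val⟩, ?_⟩⟩
  ext x
  have h1 : f ⟨x, hO' (h' x.2)⟩ = _ := hfF ⟨x, h' x.2⟩
  have h2 : f p = _ := hfF ⟨p, hp⟩
  have h3 : ∀ (s : Finset (ZeroIdx deg)) (φ : ZeroIdx deg → SmoothFn deg O''),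
      (∑ i ∈ s, φ i) x = ∑ i ∈ s, φ i x := fun s φ => by
    induction s using Finset.cons_induction with
    | empty => rfl
    | cons a s ha ih => rw [Finset.sum_cons, Finset.sum_cons, ← ih]; rfl
  change f ⟨x, _⟩ = f p + (∑ i, _ : SmoothFn deg O'') x
  rw [h1, h2, h3, e]
  rfl

end Hadamard

/-! ### Expansions of functions on graded domains -/

section Exterior

variable {ι : Type} (deg : ι → ℤ)

/-- Elements of the exterior algebra of order at least `N` in the odd coordinates. -/
def oddFil (N : ℕ) : Submodule ℝ (OddAlg deg) :=
  ⨆ n : ℕ, LinearMap.range (ExteriorAlgebra.ι ℝ : (OddIdx deg → ℝ) →ₗ[ℝ] OddAlg deg) ^ (N + n)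

theorem oddFil_mul (a b : ℕ) : oddFil deg a * oddFil deg b ≤ oddFil deg (a + b) := by
  simp only [oddFil, Submodule.iSup_mul, Submodule.mul_iSup, ← pow_add]
  refine iSup_le fun n => iSup_le fun m => ?_
  rw [show a + m + (b + n) = a + b + (m + n) by ring]
  exact le_iSup (fun n : ℕ => LinearMap.range
    (ExteriorAlgebra.ι ℝ : (OddIdx deg → ℝ) →ₗ[ℝ] OddAlg deg) ^ (a + b + n)) (m + n)

theorem oddFil_anti {a b : ℕ} (h : a ≤ b) : oddFil deg b ≤ oddFil deg a := by
  obtain ⟨c, rfl⟩ := Nat.exists_eq_add_of_le h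
  refine iSup_le fun n => ?_
  rw [add_assoc]
  exact le_iSup (fun n : ℕ => LinearMap.range
    (ExteriorAlgebra.ι ℝ : (OddIdx deg → ℝ) →ₗ[ℝ] OddAlg deg) ^ (a + n)) (c + n)

theorem oddFil_zero : oddFil deg 0 = ⊤ := by
  have := (DirectSum.Decomposition.isInternal
    (fun n => ⋀[ℝ]^n (OddIdx deg → ℝ))).submodule_iSup_eq_top
  simpa only [oddFil, zero_add] using this

theorem ι_mem_oddFil_one (v : OddIdx deg → ℝ) : ExteriorAlgebra.ι ℝ v ∈ oddFil deg 1 :=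
  Submodule.mem_iSup_of_mem 0 (by simp)

/-- The filtration is finite, since there are finitely many odd coordinates. -/
theorem eq_zero_of_forall_mem_oddFil [Fintype ι] {a : OddAlg deg} (h : ∀ N, a ∈ oddFil deg N) :
    a = 0 := by
  classical
  have hz : oddFil deg (Fintype.card (OddIdx deg) + 1) = ⊥ := by
    refine eq_bot_iff.2 (iSup_le fun n => ?_)
    have h1 := exteriorPower.finrank_eq ℝ (M := OddIdx deg → ℝ) (Fintype.card (OddIdx deg) + 1 + n)
    rw [Nat.choose_eq_zero_of_lt (by simp; omega)] at h1
    exact (Submodule.finrank_eq_zero.1 h1).le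
  have := h (Fintype.card (OddIdx deg) + 1)
  rwa [hz, Submodule.mem_bot] at this

/-- An element of the exterior algebra is a scalar plus a combination of the generators. -/
theorem exists_eq_add_sum_ι_mul [Fintype ι] [DecidableEq (OddIdx deg)] (a : OddAlg deg) :
    ∃ (r : ℝ) (l : OddIdx deg → OddAlg deg),
      a = algebraMap ℝ _ r + ∑ i, ExteriorAlgebra.ι ℝ (Pi.single i (1 : ℝ)) * l i := by
  induction a using ExteriorAlgebra.induction with
  | algebraMap r => exact ⟨r, 0, by simp⟩
  | ι x =>
    refine ⟨0, fun i => algebraMap ℝ _ (x i), ?_⟩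
    conv_lhs => rw [← Finset.univ_sum_single x, map_sum]
    rw [map_zero, zero_add]
    refine Finset.sum_congr rfl fun i _ => ?_
    rw [← Algebra.commutes, ← Algebra.smul_def, ← map_smul, ← Pi.single_smul, smul_eq_mul, mul_one]
  | mul a b ha hb =>
    obtain ⟨r, l, hl⟩ := ha
    obtain ⟨s, m, hm⟩ := hb
    refine ⟨r * s, fun i => r • m i + l i * b, ?_⟩
    have e1 : a * b = r • b + ∑ i, ExteriorAlgebra.ι ℝ (Pi.single i (1 : ℝ)) * (l i * b) := by
      conv_lhs => rw [hl, add_mul, Finset.sum_mul, ← Algebra.smul_def]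
      simp only [mul_assoc]
    have e2 : r • b = algebraMap ℝ _ (r * s) +
        ∑ i, ExteriorAlgebra.ι ℝ (Pi.single i (1 : ℝ)) * (r • m i) := by
      conv_lhs => rw [hm, smul_add, Finset.smul_sum, Algebra.smul_def, ← map_mul]
      simp only [mul_smul_comm]
    rw [e1, e2, add_assoc, ← Finset.sum_add_distrib]
    simp only [mul_add]
  | add a b ha hb =>
    obtain ⟨r, l, hl⟩ := ha
    obtain ⟨s, m, hm⟩ := hb
    refine ⟨r + s, l + m, ?_⟩
    rw [hl, hm, map_add, add_add_add_comm, ← Finset.sum_add_distrib]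
    simp only [Pi.add_apply, mul_add]

end Exterior

section PowerSeries

/-- A power series in finitely many variables is its constant term plus a combination of the
variables. -/
theorem exists_eq_C_add_sum_X_mul {σ R : Type*} [Fintype σ] [Ring R] (f : MvPowerSeries σ R) :
    ∃ h : σ → MvPowerSeries σ R, f = MvPowerSeries.C (MvPowerSeries.coeff 0 f) +
      ∑ i, MvPowerSeries.X i * h i := by
  classical
  have hex : ∀ m : σ →₀ ℕ, m ≠ 0 → ∃ i, m i ≠ 0 := fun m hm => by
    by_contra! h
    exact hm (Finsupp.ext h)
  -- Each nonconstant monomial is divided by one variable occurring in it.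
  let v : (σ →₀ ℕ) → Option σ := fun m => if hm : m ≠ 0 then some (hex m hm).choose else none
  have hv : ∀ m i, v m = some i → m i ≠ 0 := fun m i h => by
    by_cases hm : m ≠ 0
    · simp only [v, hm, dif_pos, not_false_eq_true, ne_eq, Option.some.injEq] at h
      exact h ▸ (hex m hm).choose_spec
    · simp [v, hm] at h
  let h : σ → MvPowerSeries σ R := fun i m =>
    if v (Finsupp.single i 1 + m) = some i then
      MvPowerSeries.coeff (Finsupp.single i 1 + m) f else 0
  have hX : ∀ i m, MvPowerSeries.coeff m (MvPowerSeries.X i * h i) =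
      if v m = some i then MvPowerSeries.coeff m f else 0 := fun i m => by
    rw [MvPowerSeries.X_def, MvPowerSeries.coeff_monomial_mul, one_mul]
    by_cases hi : Finsupp.single i 1 ≤ m
    · rw [if_pos hi]
      have e : Finsupp.single i 1 + (m - Finsupp.single i 1) = m := add_tsub_cancel_of_le hi
      change (if v (Finsupp.single i 1 + (m - Finsupp.single i 1)) = some i then
        MvPowerSeries.coeff (Finsupp.single i 1 + (m - Finsupp.single i 1)) f else 0) = _
      rw [e]
    · rw [if_neg hi, if_neg fun hm => hi ?_]
      rw [Finsupp.single_le_iff]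
      exact Nat.one_le_iff_ne_zero.2 (hv m i hm)
  refine ⟨h, MvPowerSeries.ext fun m => ?_⟩
  rw [map_add, map_sum]
  simp only [hX, MvPowerSeries.coeff_C]
  by_cases hm : m = 0
  · have : v m = none := by simp [v, hm]
    simp only [this]
    simp [hm]
  · have : v m = some (hex m hm).choose := by simp [v, hm]
    simp [hm, this]

end PowerSeries

section Model

variable {ι : Type} {deg : ι → ℤ} [Fintype ι] {O : Opens (ZeroIdx deg → ℝ)}

/-- The value of a smooth function at a point. -/
def smoothEval (p : O) : SmoothFn deg O →ₐ[ℝ] ℝ where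
  toFun s := s p
  map_one' := rfl
  map_mul' _ _ := rfl
  map_zero' := rfl
  map_add' _ _ := rfl
  commutes' _ := rfl

/-- The value of a smooth function at a point, with scalars in the exterior algebra, tensored with
the identity of the exterior algebra. -/
def tensorEval (p : O) : SmoothFn deg O ⊗[ℝ] OddAlg deg →ₐ[ℝ] OddAlg deg :=
  Algebra.TensorProduct.lift
    ((Algebra.ofId ℝ (OddAlg deg)).comp (smoothEval p)) (AlgHom.id ℝ (OddAlg deg))
    fun s y => Algebra.commutes (smoothEval p s) y

theorem tensorEval_tmul (p : O) (s : SmoothFn deg O) (l : OddAlg deg) :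
    tensorEval p (s ⊗ₜ[ℝ] l) = s p • l := by
  rw [Algebra.smul_def]
  exact Algebra.TensorProduct.lift_tmul _ _ _ _ _

/-- The Taylor series of a function on a graded domain in the coordinates of nonzero degree, at a
point of the underlying domain. -/
def modelEval (p : O) : Model deg O →+* MvPowerSeries (EvenIdx deg) (OddAlg deg) :=
  MvPowerSeries.map (tensorEval p).toRingHom

theorem modelEval_modelRes {O' : Opens (ZeroIdx deg → ℝ)} (h : O' ≤ O) (p : O') (f : Model deg O) :
    modelEval p (modelRes deg h f) = modelEval ⟨p, h p.2⟩ f := by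
  refine MvPowerSeries.ext fun m => ?_
  simp only [modelEval, modelRes, MvPowerSeries.coeff_map]
  generalize MvPowerSeries.coeff m f = a
  induction a using TensorProduct.induction_on with
  | zero => simp
  | tmul s l =>
    change tensorEval p (smoothRes deg h s ⊗ₜ[ℝ] l) = tensorEval _ (s ⊗ₜ[ℝ] l)
    rw [tensorEval_tmul, tensorEval_tmul]
    rfl
  | add a b ha hb => simp only [map_add, ha, hb]

/-- The tensor product with the exterior algebra consists of families of smooth functions, by means
of a basis of the exterior algebra. -/
theorem tensor_eq_zero_of_forall_eval {a : SmoothFn deg O ⊗[ℝ] OddAlg deg}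
    (h : ∀ p : O, tensorEval p a = 0) : a = 0 := by
  let b := Module.Basis.ofVectorSpace ℝ (OddAlg deg)
  let B := Algebra.TensorProduct.basis (SmoothFn deg O) b
  have key : ∀ (p : O) (a : SmoothFn deg O ⊗[ℝ] OddAlg deg) k,
      (B.repr a k) p = b.repr (tensorEval p a) k := fun p a k => by
    induction a using TensorProduct.induction_on with
    | zero => simp
    | tmul s l =>
      rw [tensorEval_tmul, Algebra.TensorProduct.basis_repr_tmul]
      simp only [Finsupp.smul_apply, Finsupp.mapRange_apply, map_smul]
      rfl
    | add a b ha hb =>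
      rw [map_add, map_add, map_add, Finsupp.add_apply, Finsupp.add_apply, ← ha, ← hb]
      rfl
  refine B.repr.map_eq_zero_iff.1 (Finsupp.ext fun k => ?_)
  ext p
  rw [key, h]
  simp

/-- A function on a graded domain is determined by its Taylor series at all points. -/
theorem model_eq_zero_of_forall_modelEval {f : Model deg O} (h : ∀ p : O, modelEval p f = 0) :
    f = 0 := by
  refine MvPowerSeries.ext fun m => ?_
  rw [map_zero]
  refine tensor_eq_zero_of_forall_eval fun p => ?_
  have := congrArg (MvPowerSeries.coeff m) (h p)
  rwa [modelEval, MvPowerSeries.coeff_map, map_zero] at this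

/-- Power series of total order at least `N` in the even and odd variables. -/
def serFil (deg : ι → ℤ) (N : ℕ) : Submodule ℝ (MvPowerSeries (EvenIdx deg) (OddAlg deg)) where
  carrier := {f | ∀ m, MvPowerSeries.coeff m f ∈ oddFil deg (N - m.degree)}
  add_mem' ha hb m := by
    rw [map_add]
    exact add_mem (ha m) (hb m)
  zero_mem' m := by
    rw [map_zero]
    exact zero_mem _
  smul_mem' r f hf m := Submodule.smul_mem _ r (hf m)

theorem serFil_mul {a b : ℕ} {f g : MvPowerSeries (EvenIdx deg) (OddAlg deg)}
    (hf : f ∈ serFil deg a) (hg : g ∈ serFil deg b) : f * g ∈ serFil deg (a + b) := fun m => by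
  classical
  rw [MvPowerSeries.coeff_mul]
  refine Submodule.sum_mem _ fun q hq => ?_
  have h1 := oddFil_mul deg _ _ (Submodule.mul_mem_mul (hf q.1) (hg q.2))
  refine oddFil_anti deg ?_ h1
  have h2 : q.1.degree + q.2.degree = m.degree := by
    rw [← map_add, Finset.HasAntidiagonal.mem_antidiagonal.1 hq]
  omega

theorem mem_serFil_zero (f : MvPowerSeries (EvenIdx deg) (OddAlg deg)) : f ∈ serFil deg 0 :=
  fun m => by rw [zero_tsub, oddFil_zero]; trivial

theorem eq_zero_of_forall_mem_serFil {f : MvPowerSeries (EvenIdx deg) (OddAlg deg)}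
    (h : ∀ N, f ∈ serFil deg N) : f = 0 := by
  refine MvPowerSeries.ext fun m => ?_
  rw [map_zero]
  refine eq_zero_of_forall_mem_oddFil deg fun N => ?_
  simpa using h (N + m.degree) m

theorem C_mem_serFil_one {a : OddAlg deg} (ha : a ∈ oddFil deg 1) :
    MvPowerSeries.C a ∈ serFil deg 1 := fun m => by
  classical
  rw [MvPowerSeries.coeff_C]
  split_ifs with h
  · simpa [h] using ha
  · exact zero_mem _

theorem X_mem_serFil_one (i : EvenIdx deg) : MvPowerSeries.X i ∈ serFil deg 1 := fun m => by
  classical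
  rw [MvPowerSeries.coeff_X]
  split_ifs with h
  · rw [h]
    simp [oddFil_zero]
  · exact zero_mem _

theorem modelEval_C (p : O) (a : SmoothFn deg O ⊗[ℝ] OddAlg deg) :
    modelEval p (MvPowerSeries.C a) = MvPowerSeries.C (tensorEval p a) :=
  MvPowerSeries.map_C _ _

theorem modelEval_algebraMap (p : O) (r : ℝ) :
    modelEval p (algebraMap ℝ (Model deg O) r) = algebraMap ℝ _ r := by
  rw [MvPowerSeries.algebraMap_apply, modelEval_C, AlgHom.commutes, MvPowerSeries.algebraMap_apply]

open Classical in
/-- The coordinates of the base point, extended by zero to the coordinates of nonzero degree. -/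
def pointCoord (p : ZeroIdx deg → ℝ) (i : ι) : ℝ := if h : deg i = 0 then p ⟨i, h⟩ else 0

theorem modelCoord_of_deg_eq_zero {i : ι} (h : deg i = 0) :
    modelCoord deg O i = MvPowerSeries.C (smoothCoord deg O ⟨i, h⟩ ⊗ₜ[ℝ] 1) := by
  simp [modelCoord, h]

theorem modelCoord_of_even {i : ι} (h : Even (deg i)) (h0 : deg i ≠ 0) :
    modelCoord deg O i = MvPowerSeries.X ⟨i, h, h0⟩ := by
  simp [modelCoord, h, h0]

open Classical in
theorem modelCoord_of_odd {i : ι} (h : Odd (deg i)) :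
    modelCoord deg O i = MvPowerSeries.C (1 ⊗ₜ[ℝ] ExteriorAlgebra.ι ℝ (Pi.single ⟨i, h⟩ (1 : ℝ))) := by
  have h0 : deg i ≠ 0 := fun e => by simp [e] at h
  rw [modelCoord, dif_neg h0, dif_neg (Int.not_even_iff_odd.2 h)]

/-- The coordinates centred at a point generate functions vanishing there. -/
theorem modelEval_coord_sub_mem (p : O) (i : ι) :
    modelEval p (modelCoord deg O i - algebraMap ℝ _ (pointCoord p.1 i)) ∈ serFil deg 1 := by
  classical
  rw [map_sub, modelEval_algebraMap]
  by_cases h0 : deg i = 0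
  · rw [modelCoord_of_deg_eq_zero h0, modelEval_C, tensorEval_tmul, MvPowerSeries.algebraMap_apply,
      ← Algebra.algebraMap_eq_smul_one]
    have : smoothCoord deg O ⟨i, h0⟩ p = pointCoord p.1 i := by
      simp only [pointCoord, h0, dif_pos]
      rfl
    rw [this, sub_self]
    exact zero_mem _
  have hp : pointCoord (p : ZeroIdx deg → ℝ) i = 0 := by simp [pointCoord, h0]
  rw [hp, map_zero, sub_zero]
  by_cases h1 : Even (deg i)
  · rw [modelCoord_of_even h1 h0]
    have : modelEval p (MvPowerSeries.X ⟨i, h1, h0⟩) = MvPowerSeries.X ⟨i, h1, h0⟩ :=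
      MvPowerSeries.map_X _ _
    rw [this]
    exact X_mem_serFil_one _
  · rw [modelCoord_of_odd (Int.not_even_iff_odd.1 h1), modelEval_C, tensorEval_tmul]
    refine C_mem_serFil_one (Submodule.smul_mem _ _ (ι_mem_oddFil_one deg _))

/-- On all sufficiently small neighbourhoods of `p`, the function `f` is a constant plus a
combination of the coordinates centred at `p`. -/
def HasDecomp (p : ZeroIdx deg → ℝ) (f : Model deg O) : Prop :=
  ∃ (O' : Opens (ZeroIdx deg → ℝ)) (h : O' ≤ O), p ∈ O' ∧
    ∀ (O'' : Opens (ZeroIdx deg → ℝ)) (h' : O'' ≤ O'), ∃ (r : ℝ) (g : ι → Model deg O''),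
      modelRes deg (h'.trans h) f = algebraMap ℝ _ r +
        ∑ i, (modelCoord deg O'' i - algebraMap ℝ _ (pointCoord p i)) * g i

theorem HasDecomp.add {p : ZeroIdx deg → ℝ} {f g : Model deg O} (hf : HasDecomp p f)
    (hg : HasDecomp p g) : HasDecomp p (f + g) := by
  obtain ⟨O₁, h₁, hp₁, H₁⟩ := hf
  obtain ⟨O₂, h₂, hp₂, H₂⟩ := hg
  refine ⟨O₁ ⊓ O₂, inf_le_left.trans h₁, ⟨hp₁, hp₂⟩, fun O'' h' => ?_⟩
  obtain ⟨r, a, ha⟩ := H₁ O'' (h'.trans inf_le_left)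
  obtain ⟨s, b, hb⟩ := H₂ O'' (h'.trans inf_le_right)
  refine ⟨r + s, a + b, ?_⟩
  rw [map_add, ha, hb]
  simp only [map_add, Pi.add_apply, mul_add, Finset.sum_add_distrib]
  abel

theorem HasDecomp.sum {p : ZeroIdx deg → ℝ} (hp : p ∈ O) {α : Type*} (s : Finset α)
    {f : α → Model deg O} (hf : ∀ a ∈ s, HasDecomp p (f a)) : HasDecomp p (∑ a ∈ s, f a) := by
  induction s using Finset.cons_induction with
  | empty =>
    refine ⟨O, le_rfl, hp, fun O'' h' => ⟨0, 0, ?_⟩⟩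
    simp
  | cons a s ha ih =>
    rw [Finset.sum_cons]
    exact (hf a (Finset.mem_cons_self a s)).add
      (ih fun b hb => hf b (Finset.mem_cons_of_mem hb))

theorem modelRes_modelCoord {O' : Opens (ZeroIdx deg → ℝ)} (h : O' ≤ O) (i : ι) :
    modelRes deg h (modelCoord deg O i) = modelCoord deg O' i := by
  classical
  by_cases h0 : deg i = 0
  · rw [modelCoord_of_deg_eq_zero h0, modelCoord_of_deg_eq_zero h0]
    exact MvPowerSeries.map_C _ _
  by_cases h1 : Even (deg i)
  · rw [modelCoord_of_even h1 h0, modelCoord_of_even h1 h0]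
    exact MvPowerSeries.map_X _ _
  · rw [modelCoord_of_odd (Int.not_even_iff_odd.1 h1), modelCoord_of_odd (Int.not_even_iff_odd.1 h1)]
    refine (MvPowerSeries.map_C _ _).trans ?_
    change MvPowerSeries.C ((smoothRes deg h 1) ⊗ₜ[ℝ] _) = _
    rw [map_one]
    rfl

theorem modelRes_algebraMap {O' : Opens (ZeroIdx deg → ℝ)} (h : O' ≤ O) (r : ℝ) :
    modelRes deg h (algebraMap ℝ _ r) = algebraMap ℝ _ r := by
  rw [MvPowerSeries.algebraMap_apply, MvPowerSeries.algebraMap_apply]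
  refine (MvPowerSeries.map_C _ _).trans ?_
  exact congrArg MvPowerSeries.C
    (AlgHom.commutes (Algebra.TensorProduct.map (smoothRes deg h) (AlgHom.id ℝ (OddAlg deg))) r)

theorem modelRes_modelRes {O' O'' : Opens (ZeroIdx deg → ℝ)} (h : O' ≤ O) (h' : O'' ≤ O')
    (f : Model deg O) : modelRes deg h' (modelRes deg h f) = modelRes deg (h'.trans h) f := by
  refine MvPowerSeries.ext fun m => ?_
  simp only [modelRes, MvPowerSeries.coeff_map]
  generalize MvPowerSeries.coeff m f = a
  induction a using TensorProduct.induction_on with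
  | zero => simp
  | tmul s l => rfl
  | add a b ha hb => simp only [map_add, ha, hb]

theorem HasDecomp.of_modelRes {O' : Opens (ZeroIdx deg → ℝ)} (h : O' ≤ O) {p : ZeroIdx deg → ℝ}
    {f : Model deg O} (hf : HasDecomp p (modelRes deg h f)) : HasDecomp p f := by
  obtain ⟨O₁, h₁, hp, H⟩ := hf
  refine ⟨O₁, h₁.trans h, hp, fun O'' h' => ?_⟩
  obtain ⟨r, g, hg⟩ := H O'' h'
  exact ⟨r, g, by rw [← hg, modelRes_modelRes]⟩

theorem HasDecomp.const {p : ZeroIdx deg → ℝ} (hp : p ∈ O) (r : ℝ) :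
    HasDecomp p (algebraMap ℝ (Model deg O) r) :=
  ⟨O, le_rfl, hp, fun O'' h' => ⟨r, 0, by simp [modelRes_algebraMap]⟩⟩

theorem HasDecomp.coord_sub_mul {p : ZeroIdx deg → ℝ} (hp : p ∈ O) (i : ι) (g : Model deg O) :
    HasDecomp p ((modelCoord deg O i - algebraMap ℝ _ (pointCoord p i)) * g) := by
  classical
  refine ⟨O, le_rfl, hp, fun O'' h' => ⟨0, Pi.single i (modelRes deg h' g), ?_⟩⟩
  rw [map_zero, zero_add, Finset.sum_eq_single i]
  · rw [map_mul, map_sub, modelRes_modelCoord, modelRes_algebraMap, Pi.single_eq_same]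
  · intro j _ hj
    rw [Pi.single_eq_of_ne hj, mul_zero]
  · simp

theorem HasDecomp.coord_mul {p : ZeroIdx deg → ℝ} (hp : p ∈ O) {i : ι} (hi : deg i ≠ 0)
    (g : Model deg O) : HasDecomp p (modelCoord deg O i * g) := by
  have := HasDecomp.coord_sub_mul hp i g
  rwa [show pointCoord p i = 0 by simp [pointCoord, hi], map_zero, sub_zero] at this

/-- Hadamard's lemma on a graded domain: the power series is expanded in the even coordinates, its
constant term in the odd coordinates, and the remaining smooth coefficient by the classical lemma. -/
theorem hasDecomp (p : O) (f : Model deg O) : HasDecomp (p : ZeroIdx deg → ℝ) f := by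
  classical
  obtain ⟨h, hf⟩ := exists_eq_C_add_sum_X_mul f
  rw [hf]
  refine HasDecomp.add ?_ (HasDecomp.sum p.2 _ fun i _ => ?_)
  · generalize MvPowerSeries.coeff 0 f = a
    induction a using TensorProduct.induction_on with
    | zero =>
      refine ⟨O, le_rfl, p.2, fun O'' h' => ⟨0, 0, ?_⟩⟩
      simp
    | tmul s l =>
      obtain ⟨r, l', rfl⟩ := exists_eq_add_sum_ι_mul deg l
      rw [TensorProduct.tmul_add, TensorProduct.tmul_sum, map_add, map_sum]
      refine HasDecomp.add ?_ (HasDecomp.sum p.2 _ fun i _ => ?_)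
      · obtain ⟨O', h, hp, H⟩ := s.exists_hadamard p
        obtain ⟨g, hg⟩ := H O' le_rfl
        refine HasDecomp.of_modelRes h ?_
        have e1 : modelRes deg h (MvPowerSeries.C (s ⊗ₜ[ℝ] algebraMap ℝ (OddAlg deg) r)) =
            MvPowerSeries.C (smoothRes deg h s ⊗ₜ[ℝ] algebraMap ℝ _ r) :=
          MvPowerSeries.map_C _ _
        have e2 : MvPowerSeries.C (algebraMap ℝ (SmoothFn deg O') (s p) ⊗ₜ[ℝ]
            algebraMap ℝ (OddAlg deg) r) = algebraMap ℝ (Model deg O') (s p * r) := by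
          rw [MvPowerSeries.algebraMap_apply]
          congr 1
          rw [Algebra.algebraMap_eq_smul_one, Algebra.algebraMap_eq_smul_one,
            TensorProduct.smul_tmul_smul, Algebra.algebraMap_eq_smul_one]
          rfl
        rw [e1, hg, TensorProduct.add_tmul, TensorProduct.sum_tmul, map_add, map_sum, e2]
        refine HasDecomp.add (HasDecomp.const hp _) (HasDecomp.sum hp _ fun i _ => ?_)
        convert HasDecomp.coord_sub_mul hp i.1 (MvPowerSeries.C (g i ⊗ₜ[ℝ] algebraMap ℝ _ r))
          using 1
        rw [modelCoord_of_deg_eq_zero i.2, MvPowerSeries.algebraMap_apply, ← map_sub, ← map_mul,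
          show pointCoord p.1 i.1 = p.1 i by simp [pointCoord, i.2]]
        congr 1
        rw [Algebra.TensorProduct.algebraMap_apply, ← TensorProduct.sub_tmul,
          Algebra.TensorProduct.tmul_mul_tmul, one_mul]
      · rw [show s ⊗ₜ[ℝ] (ExteriorAlgebra.ι ℝ (Pi.single i (1 : ℝ)) * l' i) =
          (1 ⊗ₜ[ℝ] ExteriorAlgebra.ι ℝ (Pi.single i (1 : ℝ))) * (s ⊗ₜ[ℝ] l' i) by
            rw [Algebra.TensorProduct.tmul_mul_tmul, one_mul], map_mul,
          ← modelCoord_of_odd i.2]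
        exact HasDecomp.coord_mul p.2 (fun e => by simpa [e] using i.2) _
    | add a b ha hb =>
      rw [map_add]
      exact ha.add hb
  · rw [← modelCoord_of_even i.2.1 i.2.2]
    exact HasDecomp.coord_mul p.2 i.2.2 _

theorem one_mem_oddHomog : (1 : OddAlg deg) ∈ oddHomog deg 0 :=
  Submodule.subset_span ⟨[], by simp, by simp⟩

theorem modelCoord_mem (i : ι) : modelCoord deg O i ∈ modelHomog deg O (deg i) := by
  classical
  intro m
  by_cases h0 : deg i = 0
  · rw [modelCoord_of_deg_eq_zero h0, MvPowerSeries.coeff_C]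
    split_ifs with hm
    · refine Submodule.subset_span ⟨_, 1, ?_, rfl⟩
      simpa [hm, h0] using one_mem_oddHomog
    · exact zero_mem _
  by_cases h1 : Even (deg i)
  · rw [modelCoord_of_even h1 h0, MvPowerSeries.coeff_X]
    split_ifs with hm
    · refine Submodule.subset_span ⟨1, 1, ?_, rfl⟩
      simpa [hm] using one_mem_oddHomog
    · exact zero_mem _
  · rw [modelCoord_of_odd (Int.not_even_iff_odd.1 h1), MvPowerSeries.coeff_C]
    split_ifs with hm
    · refine Submodule.subset_span ⟨1, _, ?_, rfl⟩
      refine Submodule.subset_span ⟨[⟨i, Int.not_even_iff_odd.1 h1⟩], by simp [hm], ?_⟩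
      simp only [List.map_cons, List.map_nil, List.prod_cons, List.prod_nil, mul_one]
    · exact zero_mem _

/-- A coordinate of degree zero minus a constant is invertible near the points where it does not
vanish. -/
theorem exists_mul_eq_one_of_coord_ne {p : ZeroIdx deg → ℝ} {i : ι}
    (hi : deg i = 0) {c : ℝ} (hc : p ⟨i, hi⟩ ≠ c) :
    ∃ O' : Opens (ZeroIdx deg → ℝ), p ∈ O' ∧ ∀ (O'' : Opens (ZeroIdx deg → ℝ)) (_ : O'' ≤ O'),
      ∃ g : Model deg O'',
      (modelCoord deg O'' i - algebraMap ℝ _ c) * g = 1 := by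
  refine ⟨⟨{x | x ⟨i, hi⟩ ≠ c}, isOpen_ne_fun (continuous_apply _) continuous_const⟩, hc,
    fun O'' h' => ?_⟩
  have hne : ∀ x : O'', (x : ZeroIdx deg → ℝ) ⟨i, hi⟩ - c ≠ 0 := fun x => sub_ne_zero.2 (h' x.2)
  let g : SmoothFn deg O'' := ⟨fun x => ((x : ZeroIdx deg → ℝ) ⟨i, hi⟩ - c)⁻¹,
    ((smoothCoord deg O'' ⟨i, hi⟩ - algebraMap ℝ _ c).contMDiff).inv₀ hne⟩
  have hg : (smoothCoord deg O'' ⟨i, hi⟩ - algebraMap ℝ _ c) * g = 1 := by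
    ext x
    exact mul_inv_cancel₀ (hne x)
  refine ⟨MvPowerSeries.C (g ⊗ₜ[ℝ] 1), ?_⟩
  rw [modelCoord_of_deg_eq_zero hi, MvPowerSeries.algebraMap_apply, ← map_sub, ← map_mul,
    Algebra.TensorProduct.algebraMap_apply, ← TensorProduct.sub_tmul,
    Algebra.TensorProduct.tmul_mul_tmul, hg, one_mul, ← Algebra.TensorProduct.one_def, map_one]

end Model

/-! ### Functions in charts and vertical vector fields -/

section Basic

variable {M : GradedSpace.{u}} {U : Opens M.X} {j : ℤ}

theorem VField.app_one (X : VField M U j) {V : Opens M.X} (hV : V ≤ U) : X.app V hV 1 = 0 := by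
  have h := X.leibniz hV (M.one_mem V) 1
  rw [mul_one, mul_one, one_mul, mul_zero] at h
  simpa [sgn] using h

theorem VField.app_algebraMap (X : VField M U j) {V : Opens M.X} (hV : V ≤ U) (r : ℝ) :
    X.app V hV (algebraMap ℝ _ r) = 0 := by
  rw [Algebra.algebraMap_eq_smul_one, map_smul, X.app_one, smul_zero]

theorem GradedSpace.algebraMap_mem (V : Opens M.X) (r : ℝ) : algebraMap ℝ _ r ∈ M.homog V 0 := by
  rw [Algebra.algebraMap_eq_smul_one]
  exact Submodule.smul_mem _ _ (M.one_mem V)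

variable {N T : GradedManifold.{u}} (π : Hom N T)

theorem Hom.res_pullOn {V : Opens T.X} {W W' : Opens N.X} (h : W ≤ π.pre V) (h' : W' ≤ W)
    (f : T.Fn V) : N.res h' (π.pullOn h f) = π.pullOn (h'.trans h) f :=
  GradedSpace.res_res _ _ _

theorem Hom.pullOn_res {V V' : Opens T.X} {W : Opens N.X} (hV : V' ≤ V) (h : W ≤ π.pre V')
    (f : T.Fn V) : π.pullOn h (T.res hV f) = π.pullOn (h.trans fun _ hp => hV hp) f := by
  exact (congrArg (N.res h) (π.pull_res hV f)).trans (GradedSpace.res_res _ _ _)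

theorem Hom.pullOn_mem {V : Opens T.X} {W : Opens N.X} (h : W ≤ π.pre V) {k : ℤ} {f : T.Fn V}
    (hf : f ∈ T.homog V k) : π.pullOn h f ∈ N.homog W k :=
  N.res_mem _ (π.pull_mem hf)

end Basic

section Chart

variable {M : GradedSpace.{u}} (c : Chart M)

/-- The image of an open set under a chart. -/
def Chart.image {V : Opens M.X} (hV : V ≤ c.source) : Opens (ZeroIdx c.deg → ℝ) :=
  ⟨c.κ '' V, c.κ.isOpen_image_of_subset_source V.isOpen hV⟩

/-- The isomorphism of a chart between functions on an open set and on its image. -/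
def Chart.isoOn {V : Opens M.X} (hV : V ≤ c.source) : M.Fn V ≃ₐ[ℝ] Model c.deg (c.image hV) :=
  c.iso V hV

theorem Chart.coord_mem (i : c.ι) : c.coord i ∈ M.homog c.source (c.deg i) := by
  rw [c.iso_homog c.source subset_rfl, Chart.coord, AlgEquiv.apply_symm_apply]
  exact modelCoord_mem i

theorem Chart.isoOn_coord {V : Opens M.X} (hV : V ≤ c.source) (i : c.ι) :
    c.isoOn hV (M.res hV (c.coord i)) = modelCoord c.deg _ i := by
  refine (c.iso_res c.source V subset_rfl hV (c.coord i)).trans ?_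
  rw [Chart.coord, AlgEquiv.apply_symm_apply]
  exact modelRes_modelCoord _ _

/-- The coordinates of a point of a chart, extended by zero to the coordinates of nonzero degree. -/
def Chart.point (p : M.X) (i : c.ι) : ℝ := pointCoord (c.κ p) i

/-- The Taylor series of a function at a point, in the coordinates of nonzero degree of a chart. -/
def Chart.eval {V : Opens M.X} (hV : V ≤ c.source) {p : M.X} (hp : p ∈ V) :
    M.Fn V →+* MvPowerSeries (EvenIdx c.deg) (OddAlg c.deg) :=
  (modelEval (O := c.image hV) ⟨c.κ p, p, hp, rfl⟩).comp (c.isoOn hV).toRingEquiv.toRingHom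

theorem Chart.eval_res {V W : Opens M.X} (hV : V ≤ c.source) (hW : W ≤ V) {p : M.X} (hp : p ∈ W)
    (f : M.Fn V) : c.eval (hW.trans hV) hp (M.res hW f) = c.eval hV (hW hp) f := by
  change modelEval _ (c.iso W (hW.trans hV) (M.res hW f)) = _
  rw [c.iso_res V W hV hW]
  exact modelEval_modelRes _ _ _

/-- A function is determined by its Taylor series at all points. -/
theorem Chart.eq_zero_of_forall_eval {V : Opens M.X} (hV : V ≤ c.source) {f : M.Fn V}
    (h : ∀ p (hp : p ∈ V), c.eval hV hp f = 0) : f = 0 := by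
  refine (c.isoOn hV).map_eq_zero_iff.1 (model_eq_zero_of_forall_modelEval ?_)
  rintro ⟨_, p, hp, rfl⟩
  exact h p hp

theorem Chart.eval_coord_sub_mem {V : Opens M.X} (hV : V ≤ c.source) {p : M.X} (hp : p ∈ V)
    (i : c.ι) : c.eval hV hp (M.res hV (c.coord i) - algebraMap ℝ _ (c.point p i)) ∈
      serFil c.deg 1 := by
  change modelEval _ (c.isoOn hV _) ∈ _
  rw [map_sub, c.isoOn_coord, AlgEquiv.commutes]
  exact modelEval_coord_sub_mem _ _

theorem Chart.eval_smul {V : Opens M.X} (hV : V ≤ c.source) {p : M.X} (hp : p ∈ V) (r : ℝ)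
    (f : M.Fn V) : c.eval hV hp (r • f) = r • c.eval hV hp f := by
  rw [Algebra.smul_def, map_mul, Algebra.smul_def]
  congr 1
  change modelEval _ (c.isoOn hV _) = _
  rw [AlgEquiv.commutes]
  exact modelEval_algebraMap _ _

/-- A neighbourhood of the coordinates of `p` contains the image of a neighbourhood of `p`. -/
theorem Chart.exists_image_le {V : Opens M.X} (hV : V ≤ c.source) {p : M.X} (hp : p ∈ V)
    {O : Opens (ZeroIdx c.deg → ℝ)} (hO : c.κ p ∈ O) :
    ∃ (V' : Opens M.X) (h : V' ≤ V), p ∈ V' ∧ c.image (h.trans hV) ≤ O := by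
  refine ⟨V ⊓ ⟨_, c.κ.isOpen_inter_preimage O.isOpen⟩, inf_le_left, ⟨hp, hV hp, hO⟩, ?_⟩
  rintro _ ⟨q, hq, rfl⟩
  exact hq.2.2

/-- Hadamard's lemma on a graded manifold: locally, a function is a constant plus a combination of
the coordinates centred at a given point. -/
theorem Chart.exists_decomp {V : Opens M.X} (hV : V ≤ c.source) {p : M.X} (hp : p ∈ V)
    (f : M.Fn V) : ∃ (V' : Opens M.X) (h : V' ≤ V) (r : ℝ) (g : c.ι → M.Fn V'), p ∈ V' ∧
      M.res h f = algebraMap ℝ _ r + ∑ i, (M.res (h.trans hV) (c.coord i) -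
        algebraMap ℝ _ (c.point p i)) * g i := by
  obtain ⟨O', hO', hpO, H⟩ := hasDecomp (O := c.image hV) ⟨c.κ p, p, hp, rfl⟩ (c.isoOn hV f)
  obtain ⟨V', h, hp', hV'⟩ := c.exists_image_le hV hp hpO
  obtain ⟨r, g, hg⟩ := H _ hV'
  refine ⟨V', h, r, fun i => (c.isoOn (h.trans hV)).symm (g i), hp',
    (c.isoOn (h.trans hV)).injective ?_⟩
  refine (c.iso_res V V' hV h f).trans (hg.trans ?_)
  rw [map_add, map_sum, AlgEquiv.commutes]
  congr 1
  refine Finset.sum_congr rfl fun i _ => ?_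
  rw [map_mul, map_sub, AlgEquiv.commutes, c.isoOn_coord, AlgEquiv.apply_symm_apply]
  rfl

end Chart

section Vertical

variable {E T : GradedManifold.{u}} {π : Hom E T} (a : AdaptedChart π)

theorem one_notMem_serFil_one {ι : Type} [Fintype ι] {deg : ι → ℤ} :
    (1 : MvPowerSeries (EvenIdx deg) (OddAlg deg)) ∉ serFil deg 1 := fun h => by
  have h1 : ∀ N, (1 : MvPowerSeries (EvenIdx deg) (OddAlg deg)) ∈ serFil deg N := fun N => by
    induction N with
    | zero => exact mem_serFil_zero _
    | succ N ih => simpa using serFil_mul ih h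
  exact one_ne_zero (eq_zero_of_forall_mem_serFil h1)

/-- The map of the underlying spaces is given by the base coordinates: otherwise some `x - c` would
be invertible on the base near the image of the point while its pullback vanishes at the point. -/
theorem AdaptedChart.point_emb {y : E.X} (hy : y ∈ a.source) (i : a.base.ι) :
    a.total.point y (a.emb i) = a.base.point (π.body y) i := by
  by_cases h0 : a.base.deg i = 0
  swap
  · simp [Chart.point, pointCoord, a.deg_emb, h0]
  by_contra hne
  have hb : a.base.point (π.body y) i = a.base.κ (π.body y) ⟨i, h0⟩ := by
    simp [Chart.point, pointCoord, h0]
  obtain ⟨O', hpO, H⟩ := exists_mul_eq_one_of_coord_ne h0 (hb ▸ Ne.symm hne)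
  obtain ⟨V', h, hp', hV'⟩ := a.base.exists_image_le le_rfl (a.le_pre hy) hpO
  obtain ⟨g, hg⟩ := H (a.base.image h) hV'
  have e1 : (T.res h (a.base.coord i) - algebraMap ℝ _ (a.total.point y (a.emb i))) *
      (a.base.isoOn h).symm g = 1 := (a.base.isoOn h).injective (by
    rw [map_mul, map_sub, AlgEquiv.commutes, a.base.isoOn_coord, AlgEquiv.apply_symm_apply,
      map_one]
    exact hg)
  have hW : a.source ⊓ π.pre V' ≤ π.pre V' := inf_le_right
  have e2 := congrArg (π.pullOn hW) e1
  rw [map_mul, map_sub, AlgHom.commutes, map_one, π.pullOn_res,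
    ← π.res_pullOn a.le_pre inf_le_left, ← a.coord_emb] at e2
  have e3 := congrArg (a.total.eval inf_le_left (show y ∈ a.source ⊓ π.pre V' from ⟨hy, hp'⟩)) e2
  rw [map_mul, map_one] at e3
  have h1 := serFil_mul (a.total.eval_coord_sub_mem inf_le_left
    (show y ∈ a.source ⊓ π.pre V' from ⟨hy, hp'⟩) (a.emb i)) (mem_serFil_zero
      (a.total.eval inf_le_left (show y ∈ a.source ⊓ π.pre V' from ⟨hy, hp'⟩)
        (π.pullOn hW ((a.base.isoOn h).symm g))))
  rw [e3] at h1
  exact one_notMem_serFil_one h1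

/-- A vector field that annihilates the base coordinates is vertical: by Hadamard's lemma its
values on functions of the base vanish to all orders at all points. -/
theorem AdaptedChart.isVertical {W : Opens E.X} (hW : W ≤ a.source) {j : ℤ}
    (X : VField E.toGradedSpace W j)
    (hX : ∀ i, X.app W le_rfl (E.res hW (a.total.coord (a.emb i))) = 0) : IsVertical π X := by
  have key : ∀ (N : ℕ) (V : Opens T.X), V ≤ a.base.source → ∀ (W' : Opens E.X) (hW' : W' ≤ W)
      (h : W' ≤ π.pre V) (f : T.Fn V) (y : E.X) (hy : y ∈ W'),
      a.total.eval (hW'.trans hW) hy (X.app W' hW' (π.pullOn h f)) ∈ serFil a.total.deg N := by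
    intro N
    induction N with
    | zero => exact fun _ _ _ _ _ _ _ _ => mem_serFil_zero _
    | succ N ih =>
      intro V hV W' hW' h f y hy
      obtain ⟨V', hV', r, g, hp, hf⟩ := a.base.exists_decomp hV (h hy) f
      have hW₁ : W' ⊓ π.pre V' ≤ W' := inf_le_left
      have hW₂ : W' ⊓ π.pre V' ≤ π.pre V' := inf_le_right
      have hy' : y ∈ W' ⊓ π.pre V' := ⟨hy, hp⟩
      rw [← a.total.eval_res (hW'.trans hW) hW₁ hy', ← X.app_res, π.res_pullOn,
        ← π.pullOn_res hV' hW₂, hf, map_add, AlgHom.commutes, map_add, X.app_algebraMap, zero_add,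
        map_sum, map_sum, map_sum]
      refine Submodule.sum_mem _ fun i _ => ?_
      set z := E.res (hW₁.trans (hW'.trans hW)) (a.total.coord (a.emb i)) -
        algebraMap ℝ _ (a.total.point y (a.emb i)) with hz
      have e : π.pullOn hW₂ (T.res (hV'.trans hV) (a.base.coord i) -
          algebraMap ℝ _ (a.base.point (π.body y) i)) = z := by
        rw [map_sub, AlgHom.commutes, π.pullOn_res, ← π.res_pullOn a.le_pre
          (hW₁.trans (hW'.trans hW)), ← a.coord_emb, ← a.point_emb ((hW'.trans hW) hy)]
      have hzm : z ∈ E.homog _ (a.total.deg (a.emb i)) := by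
        refine sub_mem (E.res_mem _ (a.total.coord_mem _)) ?_
        by_cases h0 : a.total.deg (a.emb i) = 0
        · rw [h0]
          exact GradedSpace.algebraMap_mem _ _
        · simp [Chart.point, pointCoord, h0]
      have hz0 : X.app _ (hW₁.trans hW') z = 0 := by
        rw [map_sub, X.app_algebraMap, sub_zero, ← GradedSpace.res_res hW (hW₁.trans hW'),
          X.app_res le_rfl, hX, map_zero]
      rw [map_mul, e, X.leibniz _ hzm, hz0, zero_mul, zero_add, Chart.eval_smul, map_mul, add_comm]
      exact Submodule.smul_mem _ _ (serFil_mul (a.total.eval_coord_sub_mem _ _ _)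
        (ih V' (hV'.trans hV) _ _ _ _ _ _))
  intro V W' hW' h f
  have h' : W' ≤ π.pre (V ⊓ a.base.source) := fun y hy => ⟨h hy, a.le_pre (hW (hW' hy))⟩
  rw [← π.pullOn_res (V' := V ⊓ a.base.source) inf_le_left h']
  exact a.total.eq_zero_of_forall_eval (hW'.trans hW) fun p hp =>
    eq_zero_of_forall_mem_serFil fun N => key N _ inf_le_right _ _ _ _ _ _

/-- The identity morphism. -/
def Hom.identity (M : GradedManifold.{u}) : Hom M M where
  body := ContinuousMap.id M.X
  pull V := AlgHom.id ℝ (M.Fn V)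
  pull_res _ _ := rfl
  pull_mem hf := hf

/-- A vector field annihilating the coordinates of a chart vanishes there: it is vertical over the
identity. -/
theorem Chart.app_eq_zero (c : Chart E.toGradedSpace) {W : Opens E.X} (hW : W ≤ c.source) {j : ℤ}
    (X : VField E.toGradedSpace W j) (hX : ∀ i, X.app W le_rfl (E.res hW (c.coord i)) = 0)
    (V : Opens E.X) (hV : V ≤ W) (f : E.Fn V) : X.app V hV f = 0 := by
  let a : AdaptedChart (Hom.identity E) :=
    { total := c
      base := c
      le_pre := le_rfl
      emb := Function.Embedding.refl _
      deg_emb := fun _ => rfl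
      coord_emb := fun i => (GradedSpace.res_self _ _).symm }
  have h := a.isVertical hW X hX V V hV le_rfl f
  have e : (Hom.identity E).pullOn (V := V) (W := V) le_rfl f = f := GradedSpace.res_self _ _
  rwa [e] at h

end Vertical

/-! ### Gluing of functions and Cartan calculus -/

section Calculus

variable {M : GradedSpace.{u}} {U : Opens M.X}

/-- Sections that agree locally are equal. -/
theorem GradedSpace.eq_of_locally {f g : M.Fn U}
    (h : ∀ p ∈ U, ∃ (V : Opens M.X) (hV : V ≤ U), p ∈ V ∧ M.res hV f = M.res hV g) : f = g := by
  choose V hV hp e using h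
  refine M.sheaf.eq_of_locally_eq' (fun p : U => V p p.2) U (fun p => homOfLE (hV p p.2))
    (fun p hpU => Opens.mem_iSup.2 ⟨⟨p, hpU⟩, hp p hpU⟩) f g fun p => e p p.2

/-- Sections over a cover that agree on a basis of the overlaps glue. -/
theorem GradedSpace.exists_glue {κ : Type u} (V : κ → Opens M.X) (hV : ∀ a, V a ≤ U)
    (hcover : ∀ p ∈ U, ∃ a, p ∈ V a) (f : ∀ a, M.Fn (V a))
    (hf : ∀ a b, M.res (inf_le_left : V a ⊓ V b ≤ V a) (f a) = M.res inf_le_right (f b)) :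
    ∃ g : M.Fn U, ∀ a, M.res (hV a) g = f a := by
  obtain ⟨g, hg, -⟩ := M.sheaf.existsUnique_gluing' V U (fun a => homOfLE (hV a))
    (fun p hp => Opens.mem_iSup.2 (hcover p hp)) f fun a b => hf a b
  exact ⟨g, hg⟩

namespace OneForm

variable {i j k : ℤ} {V : Opens M.X}

/-- The graded Jacobi identity. -/
theorem ev_bracket_bracket (α : OneForm M U) (hV : V ≤ U) (X : VField M V i) (Y : VField M V j)
    (Z : VField M V k) :
    α.ev V hV (X.bracket (Y.bracket Z)) =
      α.ev V hV ((X.bracket Y).bracket Z) + sgn (i * j) • α.ev V hV (Y.bracket (X.bracket Z)) := by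
  rw [← ev_smul, ← ev_cast α hV (by ring : j + (i + k) = i + (j + k)),
    ← ev_cast α hV (by ring : i + j + k = i + (j + k)), ← ev_add]
  apply ev_congr _ _ rfl
  funext W hW
  ext f
  change X.app W hW (Y.app W hW (Z.app W hW f) - sgn (j * k) • Z.app W hW (Y.app W hW f)) -
    sgn (i * (j + k)) • (Y.app W hW (Z.app W hW (X.app W hW f)) -
      sgn (j * k) • Z.app W hW (Y.app W hW (X.app W hW f))) =
    (X.app W hW (Y.app W hW (Z.app W hW f)) - sgn (i * j) • Y.app W hW (X.app W hW (Z.app W hW f)) -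
      sgn ((i + j) * k) • Z.app W hW (X.app W hW (Y.app W hW f) -
        sgn (i * j) • Y.app W hW (X.app W hW f))) +
    sgn (i * j) • (Y.app W hW (X.app W hW (Z.app W hW f) - sgn (i * k) •
      Z.app W hW (X.app W hW f)) - sgn (j * (i + k)) • (X.app W hW (Z.app W hW (Y.app W hW f)) -
        sgn (i * k) • Z.app W hW (X.app W hW (Y.app W hW f))))
  simp only [map_sub, map_smul]
  by_cases h1 : Even i <;> by_cases h2 : Even j <;> by_cases h3 : Even k <;>
    simp only [sgn, Int.even_add, Int.even_mul, h1, h2, h3, or_true, true_or,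
      or_false, false_or, if_true, if_false, one_smul, neg_smul, iff_true, iff_false, not_true, not_false_eq_true] <;>
    abel

theorem extDeriv_ev (α : OneForm M U) (hV : V ≤ U) (X : VField M V i) (Y : VField M V j) :
    α.extDeriv.ev V hV X Y = sgn (j * (i + 1)) •
      (Y.app V le_rfl (α.ev V hV X) - α.ev V hV (Y.bracket X)) -
        sgn j • X.app V le_rfl (α.ev V hV Y) := rfl

theorem bracket_app (X : VField M V i) (Y : VField M V j) {W : Opens M.X} (hW : W ≤ V)
    (f : M.Fn W) : (X.bracket Y).app W hW f = X.app W hW (Y.app W hW f) -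
      sgn (i * j) • Y.app W hW (X.app W hW f) := rfl

/-- `d² = 0` on 1-forms. -/
theorem isClosed_extDeriv (α : OneForm M U) : α.extDeriv.IsClosed := by
  intro V hV k i j Z X Y
  have e : (α.extDeriv.contract hV Z).extDeriv.ev V le_rfl X Y = sgn (j * (i + 1)) •
      (Y.app V le_rfl (α.extDeriv.ev V hV X Z) - α.extDeriv.ev V hV (Y.bracket X) Z) -
        sgn j • X.app V le_rfl (α.extDeriv.ev V hV Y Z) := rfl
  have hJ := ev_bracket_bracket α hV Z Y X
  rw [e, TwoForm.lieEv]
  simp only [extDeriv_ev, hJ, map_sub, map_smul, bracket_app]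
  by_cases h1 : Even i <;> by_cases h2 : Even j <;> by_cases h3 : Even k <;>
    simp only [sgn, Int.even_add, Int.even_mul, Int.not_even_one, h1, h2, h3, or_true, true_or,
      or_false, false_or, if_true, if_false, one_smul, neg_smul, iff_true, iff_false, not_true, not_false_eq_true] <;>
    abel

/-- For a vector field `Z` of degree zero, `L_Z` commutes with `d` and acts on contractions by
derivations. -/
theorem extDeriv_lie_ev (α : OneForm M U) (Z : VField M U 0) (hV : V ≤ U) (X : VField M V i)
    (Y : VField M V j) :
    (lie Z α).extDeriv.ev V hV X Y = Z.app V hV (α.extDeriv.ev V hV X Y) -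
      α.extDeriv.ev V hV ((Z.restrict hV).bracket X) Y -
      α.extDeriv.ev V hV X ((Z.restrict hV).bracket Y) := by
  have e : ∀ {l : ℤ} (X : VField M V l), (lie Z α).ev V hV X =
      Z.app V hV (α.ev V hV X) - α.ev V hV ((Z.restrict hV).bracket X) := fun X => by
    change sgn (0 * _) • _ = _
    simp [sgn]
  have hJ := ev_bracket_bracket α hV (Z.restrict hV) Y X
  have hZ : ∀ f : M.Fn V, (Z.restrict hV).app V le_rfl f = Z.app V hV f := fun _ => rfl
  simp only [extDeriv_ev, e, hJ, map_sub, map_smul, bracket_app, hZ]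
  by_cases h1 : Even i <;> by_cases h2 : Even j <;>
    simp only [sgn, Int.even_add, Int.even_mul, Int.not_even_one, h1, h2, or_true, true_or,
      or_false, false_or, Even.zero, zero_mul, if_true, if_false, one_smul, neg_smul, iff_true,
      iff_false, true_iff, false_iff, not_true, not_false_eq_true] <;>
    abel

/-- Cartan's formula `i_Y d = L_Y - (-1)^{|Y|} d i_Y`. -/
theorem extDeriv_ev_eq_lie (α : OneForm M U) (Y : VField M U j) (hV : V ≤ U) (X : VField M V i) :
    α.extDeriv.ev V hV X (Y.restrict hV) = (lie Y α).ev V hV X -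
      sgn j • X.app V le_rfl (M.res hV (α.ev U le_rfl Y)) := by
  rw [← α.ev_res]
  rfl

end OneForm

/-- For a closed 2-form, `i_{[Z,Y]} ω = L_Z i_Y ω - (-1)^{|Z||Y|} i_Y d i_Z ω`. -/
theorem TwoForm.IsClosed.ev_bracket {ω : TwoForm M U} (hω : ω.IsClosed) {V : Opens M.X} (hV : V ≤ U)
    {W : Opens M.X} (hW : W ≤ V) {i j k : ℤ} (Z : VField M V k) (X : VField M W i)
    (Y : VField M V j) :
    ω.ev W (hW.trans hV) X ((Z.bracket Y).restrict hW) =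
      (OneForm.lie Z (ω.contract hV Y)).ev W hW X -
        sgn (k * j) • (ω.contract hV Z).extDeriv.ev W hW X (Y.restrict hW) := by
  have h := hω W (hW.trans hV) k i j (Z.restrict hW) X (Y.restrict hW)
  have e1 : (ω.contract (hW.trans hV) (Z.restrict hW)).extDeriv.ev W le_rfl X (Y.restrict hW) =
    (ω.contract hV Z).extDeriv.ev W hW X (Y.restrict hW) := rfl
  have e2 : (OneForm.lie Z (ω.contract hV Y)).ev W hW X = sgn (k * (i + 1)) •
    (Z.app W hW (ω.ev W (hW.trans hV) X (Y.restrict hW)) -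
      ω.ev W (hW.trans hV) ((Z.restrict hW).bracket X) (Y.restrict hW)) := rfl
  have e3 : (Z.bracket Y).restrict hW = (Z.restrict hW).bracket (Y.restrict hW) := rfl
  rw [e1, TwoForm.lieEv] at h
  rw [e2, e3]
  change _ - _ = (0 : M.Fn W) at h
  have hZ : ∀ f : M.Fn W, (Z.restrict hW).app W le_rfl f = Z.app W hW f := fun _ => rfl
  rw [hZ] at h
  generalize ω.ev W (hW.trans hV) X ((Z.restrict hW).bracket (Y.restrict hW)) = a at *
  generalize sgn (k * (i + 1)) • (Z.app W hW (ω.ev W (hW.trans hV) X (Y.restrict hW)) -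
      ω.ev W (hW.trans hV) ((Z.restrict hW).bracket X) (Y.restrict hW)) = b at *
  generalize (ω.contract hV Z).extDeriv.ev W hW X (Y.restrict hW) = c at *
  have hs : sgn (k * (j + 1)) * sgn k = sgn (k * j) := by
    unfold sgn
    by_cases h2 : Even j <;> by_cases h3 : Even k <;>
      simp only [Int.even_add, Int.even_mul, Int.not_even_one, h2, h3] <;> norm_num
  have h' := congrArg (sgn (k * (j + 1)) • ·) h
  simp only [smul_sub, smul_smul, sgn_sq, one_smul, smul_zero, hs] at h'
  rw [← sub_eq_zero, ← neg_eq_zero, ← h']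
  abel

end Calculus

/-! ### One-forms generated by differentials of functions -/

section Rep

variable {M : GradedSpace.{u}} {U : Opens M.X}

/-- The 1-form `α` is `∑ dg_a s_a` with homogeneous functions `g_a` of degrees `e_a` and arbitrary
functions `s_a`. -/
def OneForm.IsRep (α : OneForm M U) {κ : Type} [Fintype κ] (e : κ → ℤ) (g s : κ → M.Fn U) : Prop :=
  (∀ a, g a ∈ M.homog U (e a)) ∧ ∀ (V : Opens M.X) (hV : V ≤ U) (j : ℤ) (X : VField M V j),
    α.ev V hV X = ∑ a, X.app V le_rfl (M.res hV (g a)) * M.res hV (s a)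

namespace OneForm.IsRep

variable {α β : OneForm M U} {κ κ' : Type} [Fintype κ] [Fintype κ'] {e : κ → ℤ} {g s : κ → M.Fn U}
  {e' : κ' → ℤ} {g' s' : κ' → M.Fn U} {i j k : ℤ} {V : Opens M.X}

theorem restrict (h : α.IsRep e g s) (hV : V ≤ U) :
    (α.restrict hV).IsRep e (fun a => M.res hV (g a)) fun a => M.res hV (s a) := by
  refine ⟨fun a => GradedSpace.res_homog hV (h.1 a), fun W hW j X => ?_⟩
  refine (h.2 W (hW.trans hV) j X).trans ?_
  simp only [GradedSpace.res_res]

theorem add (h : α.IsRep e g s) (h' : β.IsRep e' g' s') :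
    (α + β).IsRep (Sum.elim e e') (Sum.elim g g') (Sum.elim s s') := by
  refine ⟨fun a => by cases a; exacts [h.1 _, h'.1 _], fun W hW j X => ?_⟩
  rw [Fintype.sum_sum_type]
  exact congrArg₂ _ (h.2 W hW j X) (h'.2 W hW j X)

theorem smul (h : α.IsRep e g s) (r : ℝ) : (r • α).IsRep e g fun a => r • s a := by
  refine ⟨h.1, fun W hW j X => ?_⟩
  refine (congrArg (r • ·) (h.2 W hW j X)).trans ?_
  simp only [Finset.smul_sum, map_smul, mul_smul_comm]

theorem dFun {f : M.Fn U} (hf : f ∈ M.homog U k) :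
    (OneForm.dFun f).IsRep (fun _ : Unit => k) (fun _ => f) fun _ => 1 := by
  refine ⟨fun _ => hf, fun W hW j X => ?_⟩
  simp only [Finset.univ_unique, Finset.sum_const, Finset.card_singleton, one_smul, map_one, mul_one]
  rfl

/-- The Lie derivative of `∑ dg_a s_a`. -/
theorem lie (h : α.IsRep e g s) (Z : VField M U k) :
    (OneForm.lie Z α).IsRep (Sum.elim e fun a => k + e a)
      (Sum.elim g fun a => Z.app U le_rfl (g a))
      (Sum.elim (fun a => sgn (k * (1 + e a)) • Z.app U le_rfl (s a)) fun a => sgn k • s a) := by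
  refine ⟨fun a => by cases a; exacts [h.1 _, Z.app_mem _ (h.1 _)], fun W hW j X => ?_⟩
  change sgn (k * (j + 1)) • (Z.app W hW (α.ev W hW X) -
    α.ev W hW ((Z.restrict hW).bracket X)) = _
  rw [Fintype.sum_sum_type, h.2, h.2, map_sum, ← Finset.sum_sub_distrib, Finset.smul_sum,
    ← Finset.sum_add_distrib]
  refine Finset.sum_congr rfl fun a _ => ?_
  rw [Z.leibniz hW (X.app_mem le_rfl (GradedSpace.res_homog hW (h.1 a))), bracket_app]
  simp only [Sum.elim_inl, Sum.elim_inr, map_smul, ← Z.app_res le_rfl hW]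
  change _ • (_ - (Z.app W hW _ - _) * _) = _
  have hZ : ∀ f : M.Fn W, (Z.restrict hW).app W le_rfl f = Z.app W hW f := fun _ => rfl
  simp only [hZ, sub_mul, smul_mul_assoc, mul_smul_comm]
  by_cases h1 : Even k <;> by_cases h2 : Even j <;> by_cases h3 : Even (e a) <;>
    simp only [sgn, Int.even_add, Int.even_mul, Int.not_even_one, h1, h2, h3, or_true, true_or,
      or_false, false_or, if_true, if_false, one_smul, neg_smul, iff_true, iff_false, not_true,
      not_false_eq_true] <;>
    abel

/-- The exterior differential of `∑ dg_a s_a`. -/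
theorem extDeriv_ev (h : α.IsRep e g s) (hV : V ≤ U) (X : VField M V i) (Y : VField M V j) :
    α.extDeriv.ev V hV X Y =
      ∑ a, (sgn (j * (1 + e a)) • (X.app V le_rfl (M.res hV (g a)) * Y.app V le_rfl (M.res hV (s a))) -
        sgn (j + i * (j + e a)) •
          (Y.app V le_rfl (M.res hV (g a)) * X.app V le_rfl (M.res hV (s a)))) := by
  rw [OneForm.extDeriv_ev, h.2, h.2, h.2, map_sum, map_sum, ← Finset.sum_sub_distrib,
    Finset.smul_sum, Finset.smul_sum, ← Finset.sum_sub_distrib]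
  refine Finset.sum_congr rfl fun a _ => ?_
  have hg := GradedSpace.res_homog hV (h.1 a)
  rw [Y.leibniz le_rfl (X.app_mem le_rfl hg), X.leibniz le_rfl (Y.app_mem le_rfl hg), bracket_app]
  simp only [sub_mul, smul_mul_assoc]
  by_cases h1 : Even i <;> by_cases h2 : Even j <;> by_cases h3 : Even (e a) <;>
    simp only [sgn, Int.even_add, Int.even_mul, Int.not_even_one, h1, h2, h3, or_true, true_or,
      or_false, false_or, if_true, if_false, one_smul, neg_smul, iff_true, iff_false, not_true,
      not_false_eq_true] <;>
    abel

/-- The contraction of `d(∑ dg_a s_a)` with a vector field annihilating the functions `g_a`. -/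
theorem contract_of_app_eq_zero (h : α.IsRep e g s) (Y : VField M U j)
    (hY : ∀ a, Y.app U le_rfl (g a) = 0) :
    (α.extDeriv.contract le_rfl Y).IsRep e g fun a => sgn (j * (1 + e a)) • Y.app U le_rfl (s a) := by
  refine ⟨h.1, fun W hW i X => (h.extDeriv_ev hW X (Y.restrict hW)).trans ?_⟩
  refine Finset.sum_congr rfl fun a _ => ?_
  have hY' : ∀ f : M.Fn U, (Y.restrict hW).app W le_rfl (M.res hW f) =
    M.res hW (Y.app U le_rfl f) := fun f => Y.app_res le_rfl hW f
  rw [hY', hY', hY, map_zero, zero_mul, smul_zero, sub_zero, map_smul, mul_smul_comm]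

/-- The contraction of `d(∑ dg_a s_a)` with a vector field. The functions `s_a` are homogeneous, so
that they can take the place of the `g_a` in the second half of the terms. -/
theorem contract {f : κ → ℤ} (h : α.IsRep e g s) (hs : ∀ a, s a ∈ M.homog U (f a))
    (Y : VField M U j) :
    (α.extDeriv.contract le_rfl Y).IsRep (Sum.elim e f) (Sum.elim g s)
      (Sum.elim (fun a => sgn (j * (1 + e a)) • Y.app U le_rfl (s a))
        fun a => -(sgn (j + (j + e a) * f a) • Y.app U le_rfl (g a))) := by
  refine ⟨fun a => by cases a; exacts [h.1 _, hs _], fun W hW i X =>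
    (h.extDeriv_ev hW X (Y.restrict hW)).trans ?_⟩
  rw [Fintype.sum_sum_type, ← Finset.sum_add_distrib]
  refine Finset.sum_congr rfl fun a _ => ?_
  have hY' : ∀ f : M.Fn U, (Y.restrict hW).app W le_rfl (M.res hW f) =
    M.res hW (Y.app U le_rfl f) := fun f => Y.app_res le_rfl hW f
  have hc := M.comm (GradedSpace.res_homog hW (Y.app_mem le_rfl (h.1 a)))
    (X.app_mem le_rfl (GradedSpace.res_homog hW (hs a)))
  simp only [hY', hc, Sum.elim_inl, Sum.elim_inr, map_smul, map_neg, mul_smul_comm, mul_neg]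
  by_cases h1 : Even i <;> by_cases h2 : Even j <;> by_cases h3 : Even (e a) <;>
    by_cases h4 : Even (f a) <;>
    simp only [sgn, Int.even_add, Int.even_mul, Int.not_even_one, h1, h2, h3, h4, or_true, true_or,
      or_false, false_or, if_true, if_false, one_smul, neg_smul, iff_true, iff_false, not_true,
      not_false_eq_true, smul_neg] <;>
    abel

end OneForm.IsRep

end Rep

/-! ### Ideals of forms pulled back from the base -/

section TwoForm

variable {M : GradedSpace.{u}} {U V : Opens M.X} {i j k : ℤ} (ω : TwoForm M U)

theorem TwoForm.ev_add_right (hV : V ≤ U) (X : VField M V i) (Y Y' : VField M V j) :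
    ω.ev V hV X (Y + Y') = ω.ev V hV X Y + ω.ev V hV X Y' := by
  rw [ω.ev_symm, ω.ev_add, smul_add, ← ω.ev_symm, ← ω.ev_symm]

theorem TwoForm.ev_fmul_right (hV : V ≤ U) (f : M.Fn V) (hf : f ∈ M.homog V k) (X : VField M V i)
    (Y : VField M V j) :
    ω.ev V hV X (Y.fmul f hf) = sgn ((i + 1) * k) • (f * ω.ev V hV X Y) := by
  rw [ω.ev_symm, ω.ev_fmul, ω.ev_symm hV Y X, mul_smul_comm, smul_smul]
  congr 1
  by_cases h1 : Even i <;> by_cases h2 : Even j <;> by_cases h3 : Even k <;>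
    simp only [sgn, Int.even_add, Int.even_mul, Int.not_even_one, h1, h2, h3] <;> norm_num

theorem TwoForm.contract_add (hV : V ≤ U) (Y Y' : VField M V j) :
    ω.contract hV (Y + Y') = ω.contract hV Y + ω.contract hV Y' := by
  ext W hW i X
  exact ω.ev_add_right (hW.trans hV) X (Y.restrict hW) (Y'.restrict hW)

theorem TwoForm.contract_zero (hV : V ≤ U) {W : Opens M.X} (hW : W ≤ V) (X : VField M W i) :
    (ω.contract hV (0 : VField M V j)).ev W hW X = 0 := by
  have h := congrArg (fun α : OneForm M V => α.ev W hW X) (ω.contract_add hV (0 : VField M V j) 0)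
  have e : (0 : VField M V j) + 0 = 0 := by
    ext W hW f
    exact add_zero (0 : M.Fn W)
  rw [e] at h
  change _ = (ω.contract hV (0 : VField M V j)).ev W hW X +
    (ω.contract hV (0 : VField M V j)).ev W hW X at h
  simpa using h

theorem TwoForm.contract_smul (hV : V ≤ U) (r : ℝ) (Y : VField M V j) :
    ω.contract hV (r • Y) = r • ω.contract hV Y := by
  ext W hW i X
  have hr : r • (1 : M.Fn W) ∈ M.homog W 0 := Submodule.smul_mem _ _ (M.one_mem W)
  have e : ∀ {l : ℤ} (_ : l = j) (Y' : VField M W l), (r • Y.restrict hW).app = Y'.app →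
      ω.ev W (hW.trans hV) X (r • Y.restrict hW) = ω.ev W (hW.trans hV) X Y' := by
    rintro l rfl Y' h
    rw [VField.ext h]
  change ω.ev W _ X (r • Y.restrict hW) = r • ω.ev W _ X (Y.restrict hW)
  rw [e (zero_add j) ((Y.restrict hW).fmul _ hr), ev_fmul_right]
  · simp [sgn]
  · funext W' hW'
    ext f
    change r • _ = M.res hW' (r • 1) * _
    rw [map_smul, map_one, smul_mul_assoc, one_mul]

end TwoForm

section Ideals

variable {E T : GradedManifold.{u}} {π : Hom E T}

/-- A finite family of open sets has an open intersection. -/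
theorem exists_open_le_of_finite {X : Type*} [TopologicalSpace X] {κ : Type*} [Finite κ] {p : X}
    (O : κ → Opens X) (hp : ∀ a, p ∈ O a) : ∃ V : Opens X, p ∈ V ∧ (∀ a, V ≤ O a) ∧
      ∀ q, (∀ a, q ∈ O a) → q ∈ V :=
  ⟨⟨⋂ a, O a, isOpen_iInter_of_finite fun a => (O a).isOpen⟩, Set.mem_iInter.2 hp,
    fun a => Set.iInter_subset (fun a => (O a : Set X)) a, fun _ => Set.mem_iInter.2⟩

/-- A pullback of a 1-form is given by common local representations. -/
theorem isPullback_iff {U : Opens T.X} {W : Opens E.X} {β : OneForm T.toGradedSpace U}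
    {η : OneForm E.toGradedSpace W} : IsPullback π β η ↔ ∀ p ∈ W, ∃ (O : Opens T.X) (W' : Opens E.X)
      (hO : O ≤ U) (hW' : W' ≤ W) (h : W' ≤ π.pre O) (κ : Type) (_ : Fintype κ) (e : κ → ℤ)
      (g s : κ → T.Fn O), p ∈ W' ∧ (β.restrict hO).IsRep e g s ∧
      (η.restrict hW').IsRep e (fun a => π.pullOn h (g a)) fun a => π.pullOn h (s a) := by
  constructor
  · intro H p hp
    obtain ⟨O, W', hO, hW', h, m, e, g, s, hpW, hg, h1, h2⟩ := H p hp
    refine ⟨O, W', hO, hW', h, Fin m, inferInstance, e, g, s, hpW, ⟨hg, h1⟩,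
      fun a => π.pullOn_mem h (hg a), fun V hV j X => ?_⟩
    simp only [π.res_pullOn]
    exact h2 V hV j X
  · intro H p hp
    obtain ⟨O, W', hO, hW', h, κ, _, e, g, s, hpW, h1, h2⟩ := H p hp
    let t := Fintype.equivFin κ
    refine ⟨O, W', hO, hW', h, Fintype.card κ, fun a => e (t.symm a), fun a => g (t.symm a),
      fun a => s (t.symm a), hpW, fun a => h1.1 _, fun V hV j X => ?_, fun V hV j X => ?_⟩
    · rw [t.symm.sum_comp fun a => X.app V le_rfl (T.res hV (g a)) * T.res hV (s a)]
      exact h1.2 V hV j X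
    · rw [t.symm.sum_comp fun a => X.app V le_rfl (π.pullOn (hV.trans h) (g a)) *
        π.pullOn (hV.trans h) (s a)]
      have := h2.2 V hV j X
      simp only [π.res_pullOn] at this
      exact this

theorem IsPullback.restrict_base {U U' : Opens T.X} {W : Opens E.X} {β : OneForm T.toGradedSpace U}
    {η : OneForm E.toGradedSpace W} (H : IsPullback π β η) (hU : U' ≤ U) (hW : W ≤ π.pre U') :
    IsPullback π (β.restrict hU) η := by
  rw [isPullback_iff] at H ⊢
  intro p hp
  obtain ⟨O, W', hO, hW', h, κ, _, e, g, s, hpW, h1, h2⟩ := H p hp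
  refine ⟨O ⊓ U', W', inf_le_right, hW', fun q hq => ⟨h hq, hW (hW' hq)⟩, κ, inferInstance, e,
    _, _, hpW, h1.restrict inf_le_left, ?_⟩
  convert h2 using 2 <;> exact π.pullOn_res _ _ _

theorem IsPullback.restrict {U : Opens T.X} {W W' : Opens E.X} {β : OneForm T.toGradedSpace U}
    {η : OneForm E.toGradedSpace W} (H : IsPullback π β η) (hW : W' ≤ W) :
    IsPullback π β (η.restrict hW) := by
  rw [isPullback_iff] at H ⊢
  intro p hp
  obtain ⟨O, W₁, hO, hW₁, h, κ, _, e, g, s, hpW, h1, h2⟩ := H p (hW hp)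
  refine ⟨O, W₁ ⊓ W', hO, inf_le_right, inf_le_left.trans h, κ, inferInstance, e, g, s, ⟨hpW, hp⟩,
    h1, ?_⟩
  have := h2.restrict (V := W₁ ⊓ W') inf_le_left
  simp only [π.res_pullOn] at this
  exact this

theorem IsPullback.dFun {O : Opens T.X} {W : Opens E.X} (h : W ≤ π.pre O) {e : ℤ} {f : T.Fn O}
    (hf : f ∈ T.homog O e) : IsPullback π (OneForm.dFun f) (OneForm.dFun (π.pullOn h f)) := by
  rw [isPullback_iff]
  intro p hp
  refine ⟨O, W, le_rfl, le_rfl, h, Unit, inferInstance, fun _ => e, fun _ => f, fun _ => 1, hp,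
    OneForm.IsRep.dFun hf, ?_⟩
  have := OneForm.IsRep.dFun (M := E.toGradedSpace) (π.pullOn_mem h hf)
  simp only [map_one]
  exact this

/-- Membership in the ideal generated by pullbacks, with local sums over arbitrary finite index
types and generators defined on individual open sets. -/
theorem InPullbackIdeal.of_fintype {S : ∀ O : Opens T.X, OneForm T.toGradedSpace O → Prop}
    (hS : ∀ (O O' : Opens T.X) (h : O' ≤ O) β, S O β → S O' (β.restrict h)) {U : Opens E.X}
    {α : OneForm E.toGradedSpace U}
    (H : ∀ p ∈ U, ∃ (W : Opens E.X) (hW : W ≤ U) (κ : Type) (_ : Fintype κ) (O : κ → Opens T.X)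
      (β : ∀ a, OneForm T.toGradedSpace (O a)) (η : κ → OneForm E.toGradedSpace W)
      (f : κ → E.Fn W), p ∈ W ∧ (∀ a, W ≤ π.pre (O a) ∧ S (O a) (β a) ∧
        IsPullback π (β a) (η a)) ∧
      ∀ (V : Opens E.X) (hV : V ≤ W) (j : ℤ) (X : VField E.toGradedSpace V j),
        α.ev V (hV.trans hW) X = ∑ a, (η a).ev V hV X * E.res hV (f a)) :
    InPullbackIdeal π S α := by
  intro p hp
  obtain ⟨W, hW, κ, _, O, β, η, f, hpW, h1, h2⟩ := H p hp
  obtain ⟨O', hpO, hO', hO''⟩ := exists_open_le_of_finite O fun a => (h1 a).1 hpW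
  have hWO : W ≤ π.pre O' := fun q hq => hO'' _ fun a => (h1 a).1 hq
  let t := Fintype.equivFin κ
  refine ⟨W, hW, O', Fintype.card κ, fun a => (β (t.symm a)).restrict (hO' _),
    fun a => η (t.symm a), fun a => f (t.symm a), hpW, hWO,
    fun a => ⟨hS _ _ _ _ (h1 _).2.1, (h1 _).2.2.restrict_base _ hWO⟩, fun V hV j X => ?_⟩
  rw [t.symm.sum_comp fun a => (η a).ev V hV X * E.res hV (f a)]
  exact h2 V hV j X

/-- `g` is a homogeneous function pulled back from (an open set of) the base. -/
def IsBasic (π : Hom E T) (W : Opens E.X) (e : ℤ) (g : E.Fn W) : Prop :=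
  ∃ (O : Opens T.X) (h : W ≤ π.pre O) (g' : T.Fn O), g' ∈ T.homog O e ∧ g = π.pullOn h g'

theorem IsBasic.res {W W' : Opens E.X} {e : ℤ} {g : E.Fn W} (hg : IsBasic π W e g) (h : W' ≤ W) :
    IsBasic π W' e (E.res h g) := by
  obtain ⟨O, hO, g', hg', rfl⟩ := hg
  exact ⟨O, h.trans hO, g', hg', π.res_pullOn _ _ _⟩

theorem IsBasic.mem {W : Opens E.X} {e : ℤ} {g : E.Fn W} (hg : IsBasic π W e g) :
    g ∈ E.homog W e := by
  obtain ⟨O, hO, g', hg', rfl⟩ := hg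
  exact π.pullOn_mem hO hg'

theorem IsBasic.app_eq_zero {W U : Opens E.X} {e j : ℤ} {g : E.Fn W} (hg : IsBasic π W e g)
    {X : VField E.toGradedSpace U j} (hX : IsVertical π X) (hW : W ≤ U) : X.app W hW g = 0 := by
  obtain ⟨O, hO, g', hg', rfl⟩ := hg
  exact hX O W hW hO g'

/-- A vector field preserves functions pulled back from the base. -/
def PreservesBasic (π : Hom E T) {U : Opens E.X} {k : ℤ} (Z : VField E.toGradedSpace U k) : Prop :=
  ∀ (W : Opens E.X) (hW : W ≤ U) (e : ℤ) (g : E.Fn W), IsBasic π W e g →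
    IsBasic π W (k + e) (Z.app W hW g)

theorem Projects.preservesBasic {U : Opens E.X} {k : ℤ} {Z : VField E.toGradedSpace U k}
    {z : VField T.toGradedSpace ⊤ k} (h : Projects π Z z) : PreservesBasic π Z := by
  rintro W hW e g ⟨O, hO, g', hg', rfl⟩
  exact ⟨O, hO, _, z.app_mem le_top hg', h O le_top W hW hO g'⟩

theorem IsVertical.preservesBasic {U : Opens E.X} {k : ℤ} {Z : VField E.toGradedSpace U k}
    (h : IsVertical π Z) : PreservesBasic π Z := by
  rintro W hW e g ⟨O, hO, g', hg', rfl⟩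
  exact ⟨O, hO, 0, zero_mem _, by rw [h O W hW hO, map_zero]⟩

/-- Locally, `α = ∑ dg_a s_a` with homogeneous functions `g_a` pulled back from the base and
arbitrary functions `s_a`. -/
def IsBaseForm (π : Hom E T) {U : Opens E.X} (α : OneForm E.toGradedSpace U) : Prop :=
  ∀ p ∈ U, ∃ (V : Opens E.X) (hV : V ≤ U) (κ : Type) (_ : Fintype κ) (e : κ → ℤ) (g s : κ → E.Fn V),
    p ∈ V ∧ (∀ a, IsBasic π V (e a) (g a)) ∧ (α.restrict hV).IsRep e g s

/-- Representations by pulled back functions describe the ideal generated by the forms of positive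
degree on the base. -/
theorem inBaseIdeal_iff {U : Opens E.X} {α : OneForm E.toGradedSpace U} :
    InBaseIdeal π α ↔ IsBaseForm π α := by
  constructor
  · intro H p hp
    obtain ⟨W, hW, O, m, β, η, f, hpW, hWO, hβ, hα⟩ := H p hp
    have hP := fun a => isPullback_iff.1 (hβ a).2 p hpW
    choose O₁ W₁ hO₁ hW₁ h₁ κ inst e g s hp₁ hb₁ hη₁ using hP
    obtain ⟨V, hpV, hV, -⟩ := exists_open_le_of_finite (fun a : Option (Fin m) => a.elim W W₁)
      (p := p) (by rintro (_ | a); exacts [hpW, hp₁ a])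
    have hVW : V ≤ W := hV none
    have hVW₁ : ∀ a, V ≤ W₁ a := fun a => hV (some a)
    refine ⟨V, hVW.trans hW, Σ a, κ a, inferInstance, fun a => e a.1 a.2,
      fun a => π.pullOn ((hVW₁ a.1).trans (h₁ a.1)) (g a.1 a.2),
      fun a => π.pullOn ((hVW₁ a.1).trans (h₁ a.1)) (s a.1 a.2) * E.res hVW (f a.1), hpV,
      fun a => ⟨_, _, _, (hb₁ a.1).1 a.2, rfl⟩, fun a => π.pullOn_mem _ ((hb₁ a.1).1 a.2),
      fun V' hV' j X => ?_⟩
    refine (hα V' (hV'.trans hVW) j X).trans ?_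
    rw [Fintype.sum_sigma]
    refine Finset.sum_congr rfl fun a _ => ?_
    have := (hη₁ a).2 V' (hV'.trans (hVW₁ a)) j X
    simp only [π.res_pullOn] at this
    change (η a).ev V' _ X = _ at this
    rw [this, Finset.sum_mul]
    refine Finset.sum_congr rfl fun b _ => ?_
    rw [π.res_pullOn, map_mul, π.res_pullOn, GradedSpace.res_res, mul_assoc]
  · intro H
    refine InPullbackIdeal.of_fintype (fun _ _ _ _ h => h) fun p hp => ?_
    obtain ⟨V, hV, κ, inst, e, g, s, hpV, hg, hα⟩ := H p hp
    choose O hO g' hg' hgg using hg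
    refine ⟨V, hV, κ, inst, O, fun a => OneForm.dFun (g' a),
      fun a => OneForm.dFun (π.pullOn (hO a) (g' a)), s, hpV,
      fun a => ⟨hO a, trivial, IsPullback.dFun (hO a) (hg' a)⟩, fun V' hV' j X => ?_⟩
    refine (hα.2 V' hV' j X).trans ?_
    simp only [hgg]
    rfl

namespace IsBaseForm

variable {U : Opens E.X} {α β : OneForm E.toGradedSpace U} {j k : ℤ}

theorem add (hα : IsBaseForm π α) (hβ : IsBaseForm π β) : IsBaseForm π (α + β) := by
  intro p hp
  obtain ⟨V₁, h₁, κ₁, _, e₁, g₁, s₁, hp₁, hb₁, hr₁⟩ := hα p hp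
  obtain ⟨V₂, h₂, κ₂, _, e₂, g₂, s₂, hp₂, hb₂, hr₂⟩ := hβ p hp
  refine ⟨V₁ ⊓ V₂, inf_le_left.trans h₁, κ₁ ⊕ κ₂, inferInstance, _, _, _, ⟨hp₁, hp₂⟩, ?_,
    (hr₁.restrict inf_le_left).add (hr₂.restrict inf_le_right)⟩
  rintro (a | a)
  exacts [(hb₁ a).res inf_le_left, (hb₂ a).res inf_le_right]

theorem smul (hα : IsBaseForm π α) (r : ℝ) : IsBaseForm π (r • α) := by
  intro p hp
  obtain ⟨V, hV, κ, _, e, g, s, hpV, hb, hr⟩ := hα p hp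
  exact ⟨V, hV, κ, inferInstance, _, _, _, hpV, hb, hr.smul r⟩

theorem zero (h : ∀ (V : Opens E.X) (hV : V ≤ U) (j : ℤ) (X : VField E.toGradedSpace V j),
    α.ev V hV X = 0) : IsBaseForm π α := fun p hp =>
  ⟨U, le_rfl, Empty, inferInstance, Empty.elim, fun a => a.elim, fun a => a.elim, hp,
    fun a => a.elim, fun a => a.elim, fun V hV j X => (h V hV j X).trans (by simp)⟩

theorem restrict (hα : IsBaseForm π α) {V : Opens E.X} (hV : V ≤ U) :
    IsBaseForm π (α.restrict hV) := by
  intro p hp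
  obtain ⟨W, hW, κ, _, e, g, s, hpW, hb, hr⟩ := hα p (hV hp)
  exact ⟨W ⊓ V, inf_le_right, κ, inferInstance, _, _, _, ⟨hpW, hp⟩,
    fun a => (hb a).res inf_le_left, hr.restrict inf_le_left⟩

theorem of_locally (h : ∀ p ∈ U, ∃ (V : Opens E.X) (hV : V ≤ U), p ∈ V ∧
    IsBaseForm π (α.restrict hV)) : IsBaseForm π α := by
  intro p hp
  obtain ⟨V, hV, hpV, H⟩ := h p hp
  obtain ⟨W, hW, κ, _, e, g, s, hpW, hb, hr⟩ := H p hpV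
  exact ⟨W, hW.trans hV, κ, inferInstance, e, g, s, hpW, hb, hr⟩

/-- The Lie derivative along a vector field preserving functions of the base. -/
theorem lie (hα : IsBaseForm π α) {Z : VField E.toGradedSpace U k} (hZ : PreservesBasic π Z) :
    IsBaseForm π (OneForm.lie Z α) := by
  intro p hp
  obtain ⟨V, hV, κ, _, e, g, s, hpV, hb, hr⟩ := hα p hp
  refine ⟨V, hV, κ ⊕ κ, inferInstance, _, _, _, hpV, ?_, hr.lie (Z.restrict hV)⟩
  rintro (a | a)
  exacts [hb a, hZ V hV _ _ (hb a)]

/-- The contraction of the differential with a vertical vector field. -/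
theorem contract_extDeriv (hα : IsBaseForm π α) {Y : VField E.toGradedSpace U j}
    (hY : IsVertical π Y) : IsBaseForm π (α.extDeriv.contract le_rfl Y) := by
  intro p hp
  obtain ⟨V, hV, κ, _, e, g, s, hpV, hb, hr⟩ := hα p hp
  exact ⟨V, hV, κ, inferInstance, _, _, _, hpV, hb,
    hr.contract_of_app_eq_zero (Y.restrict hV) fun a => (hb a).app_eq_zero hY hV⟩

theorem contract_fmul {ω : TwoForm E.toGradedSpace ⊤} {X : VField E.toGradedSpace U j}
    (h : IsBaseForm π (ω.contract le_top X)) (f : E.Fn U) (hf : f ∈ E.homog U k) :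
    IsBaseForm π (ω.contract le_top (X.fmul f hf)) := by
  intro p hp
  obtain ⟨V, hV, κ, _, e, g, s, hpV, hb, hr⟩ := h p hp
  refine ⟨V, hV, κ, inferInstance, e, g,
    fun a => sgn (k * (1 + e a)) • (E.res hV f * s a), hpV, hb, hr.1, fun W hW i Y => ?_⟩
  have e1 : ((X.fmul f hf).restrict (hW.trans hV)) =
      (X.restrict (hW.trans hV)).fmul (E.res (hW.trans hV) f) (GradedSpace.res_homog _ hf) := by
    ext W' hW' t
    change E.res _ f * _ = E.res _ (E.res _ f) * _
    rw [GradedSpace.res_res]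
    rfl
  change ω.ev W le_top Y ((X.fmul f hf).restrict (hW.trans hV)) = _
  have e2 : ω.ev W le_top Y (X.restrict (hW.trans hV)) = _ := hr.2 W hW i Y
  rw [e1, ω.ev_fmul_right, e2, Finset.mul_sum, Finset.smul_sum]
  refine Finset.sum_congr rfl fun a _ => ?_
  have hc := E.comm (GradedSpace.res_homog (hW.trans hV) hf)
    (Y.app_mem le_rfl (GradedSpace.res_homog hW (hr.1 a)))
  rw [← mul_assoc, hc, map_smul, map_mul, GradedSpace.res_res, mul_smul_comm, smul_mul_assoc,
    smul_smul, mul_assoc]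
  congr 1
  by_cases h1 : Even i <;> by_cases h2 : Even (e a) <;> by_cases h3 : Even k <;>
    simp only [sgn, Int.even_add, Int.even_mul, Int.not_even_one, h1, h2, h3] <;> norm_num

end IsBaseForm

end Ideals

/-! ### The kernel distribution and the weak gauge PDE -/

section WeakGaugePDE

variable {E T : GradedManifold.{u}} {π : Hom E T} {n : ℕ} {dX : VField T.toGradedSpace ⊤ 1}
  {Q : VField E.toGradedSpace ⊤ 1} {ω : TwoForm E.toGradedSpace ⊤} {L : E.Fn ⊤}

theorem kernelDistribution_iff {U : Opens E.X} {j : ℤ} {X : VField E.toGradedSpace U j} :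
    kernelDistribution π ω U j X ↔ IsVertical π X ∧ IsBaseForm π (ω.contract le_top X) := by
  rw [kernelDistribution, inBaseIdeal_iff]

theorem IsVertical.of_locally {U : Opens E.X} {j : ℤ} {X : VField E.toGradedSpace U j}
    (h : ∀ p ∈ U, ∃ (V : Opens E.X) (h : V ≤ U), p ∈ V ∧ IsVertical π (X.restrict h)) :
    IsVertical π X := by
  intro V W hW hWV f
  refine GradedSpace.eq_of_locally fun p hp => ?_
  obtain ⟨V', hV', hpV, H⟩ := h p (hW hp)
  refine ⟨W ⊓ V', inf_le_left, ⟨hp, hpV⟩, ?_⟩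
  rw [← X.app_res, π.res_pullOn, map_zero]
  exact H V (W ⊓ V') inf_le_right _ f

theorem isDistribution_kernelDistribution (hK : IsFinitelyGenerated (kernelDistribution π ω)) :
    IsDistribution (kernelDistribution π ω) where
  zero U j := kernelDistribution_iff.2 ⟨fun _ _ _ _ _ => rfl, IsBaseForm.zero fun _ hV _ X =>
    ω.contract_zero le_top hV X⟩
  add U j X Y hX hY := by
    rw [kernelDistribution_iff] at hX hY ⊢
    refine ⟨fun V W hW h f => ?_, ?_⟩
    · change X.app W hW _ + Y.app W hW _ = 0
      rw [hX.1 V W hW h, hY.1 V W hW h, add_zero]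
    · rw [ω.contract_add]
      exact hX.2.add hY.2
  fmul U i j f hf X hX := by
    rw [kernelDistribution_iff] at hX ⊢
    refine ⟨fun V W hW h g => ?_, hX.2.contract_fmul f hf⟩
    change _ * X.app W hW _ = 0
    rw [hX.1 V W hW h, mul_zero]
  restrict U V j X h hX := by
    rw [kernelDistribution_iff] at hX ⊢
    exact ⟨fun V' W hW h' g => hX.1 V' W (hW.trans h) h' g, hX.2.restrict h⟩
  of_locally U j X H := by
    simp only [kernelDistribution_iff] at H ⊢
    refine ⟨IsVertical.of_locally fun p hp => ?_, IsBaseForm.of_locally fun p hp => ?_⟩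
    · obtain ⟨V, h, hpV, h1, -⟩ := H p hp
      exact ⟨V, h, hpV, h1⟩
    · obtain ⟨V, h, hpV, -, h2⟩ := H p hp
      exact ⟨V, h, hpV, h2⟩
  fg := hK

theorem TwoForm.IsClosed.contract_bracket (hω : ω.IsClosed) {U : Opens E.X} {j k : ℤ}
    (Z : VField E.toGradedSpace U k) (Y : VField E.toGradedSpace U j) :
    ω.contract le_top (Z.bracket Y) = OneForm.lie Z (ω.contract le_top Y) +
      (-sgn (k * j)) • (ω.contract le_top Z).extDeriv.contract le_rfl Y := by
  ext W hW i X
  refine (hω.ev_bracket le_top hW Z X Y).trans ?_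
  change _ = _ + (-sgn (k * j)) • _
  rw [neg_smul, ← sub_eq_add_neg]
  rfl

/-- The de Rham vector field squares to zero. -/
theorem IsShiftedTangentBundle.bracket_self (h : IsShiftedTangentBundle n dX) (V : Opens T.X)
    (f : T.Fn V) : (dX.bracket dX).app V le_top f = 0 := by
  refine GradedSpace.eq_of_locally fun p hp => ?_
  obtain ⟨c, ε, hpc, hc⟩ := h p
  refine ⟨V ⊓ c.source, inf_le_left, ⟨hp, hpc⟩, ?_⟩
  rw [← (dX.bracket dX).app_res, map_zero]
  refine c.app_eq_zero le_rfl ((dX.bracket dX).restrict (le_top : c.source ≤ ⊤)) (fun i => ?_)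
    (V ⊓ c.source) inf_le_right _
  rw [GradedSpace.res_self]
  change dX.app c.source le_top (dX.app c.source le_top (c.coord i)) -
    sgn (1 * 1) • dX.app c.source le_top (dX.app c.source le_top (c.coord i)) = 0
  have h2 : dX.app c.source le_top (dX.app c.source le_top (c.coord i)) = 0 := by
    obtain ⟨a | a, rfl⟩ := ε.surjective i
    · rw [(hc a).2.2.1, (hc a).2.2.2]
    · rw [(hc a).2.2.2, map_zero]
  rw [h2, smul_zero, sub_zero]

theorem OneForm.lie_add {M : GradedSpace.{u}} {U : Opens M.X} {k : ℤ} (Z : VField M U k)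
    (α β : OneForm M U) : OneForm.lie Z (α + β) = OneForm.lie Z α + OneForm.lie Z β := by
  ext V hV j X
  change sgn (k * (j + 1)) • (Z.app V hV (α.ev V hV X + β.ev V hV X) -
    (α.ev V hV _ + β.ev V hV _)) = sgn (k * (j + 1)) • _ + sgn (k * (j + 1)) • _
  rw [map_add, ← smul_add, add_sub_add_comm]

theorem OneForm.lie_dFun {M : GradedSpace.{u}} {U V : Opens M.X} {j k : ℤ} (Z : VField M U k)
    (f : M.Fn U) (hV : V ≤ U) (X : VField M V j) :
    (OneForm.lie Z (OneForm.dFun f)).ev V hV X =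
      sgn k • X.app V le_rfl (M.res hV (Z.app U le_rfl f)) := by
  rw [← Z.app_res le_rfl hV]
  change sgn (k * (j + 1)) • (Z.app V hV (X.app V le_rfl (M.res hV f)) -
    (Z.app V hV (X.app V le_rfl (M.res hV f)) -
      sgn (k * j) • X.app V le_rfl (Z.app V hV (M.res hV f)))) = _
  rw [sub_sub_cancel, smul_smul]
  congr 1
  by_cases h1 : Even j <;> by_cases h3 : Even k <;>
    simp only [sgn, Int.even_add, Int.even_mul, Int.not_even_one, h1, h3] <;> norm_num

/-- `d i_Q ω` is the differential of the form `i_Q ω + dL` in the ideal of the base, hence so is its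
contraction with a vertical vector field. -/
theorem IsPresymplecticGaugePDE.contract_extDeriv
    (hE : IsPresymplecticGaugePDE n dX π Q ω L) {U : Opens E.X} {j : ℤ}
    {X : VField E.toGradedSpace U j} (hX : IsVertical π X) :
    IsBaseForm π ((ω.contract le_top (Q.restrict (le_top : U ≤ ⊤))).extDeriv.contract le_rfl X) := by
  have hα := (inBaseIdeal_iff.1 hE.compat).restrict (le_top : U ≤ ⊤)
  have h := hα.contract_extDeriv hX
  convert h using 1
  ext W hW i Y
  change (ω.contract le_top Q).extDeriv.ev W le_top Y _ =
    (ω.contract le_rfl Q + OneForm.dFun L).extDeriv.ev W le_top Y (X.restrict hW)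
  have h1 : (ω.contract le_rfl Q + OneForm.dFun L).extDeriv.ev W le_top Y (X.restrict hW) =
      (ω.contract le_top Q).extDeriv.ev W le_top Y (X.restrict hW) +
        (OneForm.dFun L).extDeriv.ev W le_top Y (X.restrict hW) := by
    have e : ∀ {l : ℤ} (Z : VField E.toGradedSpace W l),
        (ω.contract le_rfl Q + OneForm.dFun L).ev W le_top Z =
          (ω.contract le_top Q).ev W le_top Z + (OneForm.dFun L).ev W le_top Z := fun _ => rfl
    simp only [OneForm.extDeriv_ev, e, map_add, smul_add, smul_sub]
    abel
  rw [h1, (OneForm.IsRep.dFun hE.deg_fun).extDeriv_ev]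
  simp [VField.app_one]

/-- By the master equation, `i_{[Q, Q]} ω = 2 L_Q (i_Q ω + dL)`. -/
theorem IsPresymplecticGaugePDE.contract_bracket_self
    (hE : IsPresymplecticGaugePDE n dX π Q ω L) :
    IsBaseForm π (ω.contract le_top (Q.bracket Q)) := by
  have hα := inBaseIdeal_iff.1 hE.compat
  have hL := (hα.lie hE.projects.preservesBasic).smul 2
  convert hL using 1
  rw [hE.closed.contract_bracket]
  ext W hW i X
  have e1 : (ω.contract le_top Q).extDeriv.ev W hW X (Q.restrict hW) =
      (OneForm.lie Q (ω.contract le_top Q)).ev W hW X +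
        X.app W le_rfl (E.res hW (ω.ev ⊤ le_rfl Q Q)) := by
    rw [OneForm.extDeriv_ev_eq_lie]
    simp only [sgn, Int.not_even_one, if_false, neg_smul, one_smul, sub_neg_eq_add]
    rfl
  have e2 : (OneForm.lie Q (ω.contract le_top Q + OneForm.dFun L)).ev W hW X =
      (OneForm.lie Q (ω.contract le_top Q)).ev W hW X +
        (OneForm.lie Q (OneForm.dFun L)).ev W hW X := by
    rw [OneForm.lie_add]
    rfl
  have e3 := OneForm.lie_dFun Q L hW X
  have e4 : ω.ev ⊤ le_rfl Q Q = -((2 : ℝ) • Q.app ⊤ le_rfl L) := by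
    rw [← smul_neg, ← eq_neg_of_add_eq_zero_left hE.master, smul_smul]
    norm_num
  change (OneForm.lie Q (ω.contract le_top Q)).ev W hW X + (-sgn (1 * 1)) •
    (ω.contract le_top Q).extDeriv.ev W hW X (Q.restrict hW) = (2 : ℝ) •
      (OneForm.lie Q (ω.contract le_top Q + OneForm.dFun L)).ev W hW X
  rw [e1, e2, e3, e4]
  simp only [sgn, Int.not_even_one, if_false, mul_one, neg_neg, neg_smul, one_smul, map_neg,
    map_add, two_smul]
  abel

/-- The kernel distribution defines a weak gauge PDE: each condition on a bracket `[Z, Y]` is read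
off from `i_{[Z, Y]} ω = L_Z i_Y ω ± i_Y d i_Z ω`. -/
theorem IsPresymplecticGaugePDE.isWeakGaugePDE
    (hE : IsPresymplecticGaugePDE n dX π Q ω L)
    (hK : IsFinitelyGenerated (kernelDistribution π ω)) :
    IsWeakGaugePDE n dX π Q (kernelDistribution π ω) where
  base := hE.base
  bundle := hE.bundle
  projects := hE.projects
  distribution := isDistribution_kernelDistribution hK
  vertical U j X hX := hX.1
  involutive U i j X Y hX hY := by
    rw [kernelDistribution_iff] at hX hY ⊢
    refine ⟨fun V W hW h f => ?_, ?_⟩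
    · rw [OneForm.bracket_app, hX.1 V W hW h, hY.1 V W hW h, map_zero, map_zero, smul_zero,
        sub_zero]
    · rw [hE.closed.contract_bracket]
      exact (hY.2.lie hX.1.preservesBasic).add ((hX.2.contract_extDeriv hY.1).smul _)
  invariant U j X hX := by
    rw [kernelDistribution_iff] at hX ⊢
    have hQ : PreservesBasic π (Q.restrict (le_top : U ≤ ⊤)) := fun W hW e g hg =>
      hE.projects.preservesBasic W le_top e g hg
    refine ⟨fun V W hW h f => ?_, ?_⟩
    · rw [OneForm.bracket_app, hX.1 V W hW h, map_zero]
      have e : (Q.restrict (le_top : U ≤ ⊤)).app W hW (π.pullOn h f) =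
        π.pullOn h (dX.app V le_top f) := hE.projects V le_top W le_top h f
      rw [e, hX.1 V W hW h, smul_zero, sub_zero]
    · rw [hE.closed.contract_bracket]
      exact (hX.2.lie hQ).add ((hE.contract_extDeriv hX.1).smul _)
  square := by
    rw [kernelDistribution_iff, ω.contract_smul]
    refine ⟨fun V W hW h f => ?_, hE.contract_bracket_self.smul _⟩
    change (1 / 2 : ℝ) • (Q.bracket Q).app W hW _ = 0
    have e : ∀ f : T.Fn V, Q.app W hW (π.pullOn h f) = π.pullOn h (dX.app V le_top f) :=
      hE.projects V le_top W hW h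
    have hd := congrArg (π.pullOn h) (hE.base.bracket_self V f)
    rw [OneForm.bracket_app, map_sub, map_smul, map_zero] at hd
    rw [OneForm.bracket_app, e, e, hd, smul_zero]

end WeakGaugePDE

/-! ### Coordinates on the vertical tangent bundle -/

section Frame

variable {M : GradedSpace.{u}} {U V : Opens M.X} {j : ℤ}

/-- Vector fields of a fixed degree form a commutative monoid, so that finite sums make sense. -/
instance : AddCommMonoid (VField M U j) where
  add_assoc X Y Z := by ext V hV f; exact add_assoc (X.app V hV f) _ _
  zero_add X := by ext V hV f; exact zero_add (X.app V hV f)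
  add_zero X := by ext V hV f; exact add_zero (X.app V hV f)
  add_comm X Y := by ext V hV f; exact add_comm (X.app V hV f) _
  nsmul := nsmulRec

theorem VField.sum_app {κ : Type*} (s : Finset κ) (X : κ → VField M U j) (hV : V ≤ U)
    (f : M.Fn V) : (∑ a ∈ s, X a).app V hV f = ∑ a ∈ s, (X a).app V hV f :=
  map_sum (⟨⟨fun X : VField M U j => X.app V hV f, rfl⟩, fun _ _ => rfl⟩ : VField M U j →+ M.Fn V) X s

theorem OneForm.ev_sum (α : OneForm M U) {κ : Type*} (s : Finset κ) (X : κ → VField M V j)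
    (hV : V ≤ U) : α.ev V hV (∑ a ∈ s, X a) = ∑ a ∈ s, α.ev V hV (X a) :=
  map_sum (AddMonoidHom.mk' (M := VField M V j) (α.ev V hV) (α.ev_add hV)) X s

/-- A 1-form is determined by its values on a coordinate frame. -/
theorem OneForm.ev_eq_sum_frame (α : OneForm M U) {c : Chart M}
    {d : ∀ i, VField M c.source (-c.deg i)} (hd : IsCoordFrame c d) (hV : V ≤ U)
    (hc : V ≤ c.source) (X : VField M V j) :
    α.ev V hV X = ∑ i, X.app V le_rfl (M.res hc (c.coord i)) * α.ev V hV ((d i).restrict hc) := by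
  have hm : ∀ i, X.app V le_rfl (M.res hc (c.coord i)) ∈ M.homog V (j + c.deg i) := fun i =>
    X.app_mem le_rfl (GradedSpace.res_homog hc (c.coord_mem i))
  have e : X = ∑ i, (((d i).restrict hc).fmul _ (hm i)).cast (by ring) := by
    ext W hW f
    rw [VField.sum_app, hd.2.2 V hc j X W hW f]
    refine Finset.sum_congr rfl fun i _ => ?_
    rw [← GradedSpace.res_res hc hW, X.app_res le_rfl hW]
    rfl
  conv_lhs => rw [e]
  rw [OneForm.ev_sum]
  refine Finset.sum_congr rfl fun i _ => ?_
  rw [OneForm.ev_cast, OneForm.ev_fmul]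

/-- The representation `α = ∑ dz^i α(∂_i)` in coordinates. -/
theorem OneForm.isRep_frame (α : OneForm M U) {c : Chart M}
    {d : ∀ i, VField M c.source (-c.deg i)} (hd : IsCoordFrame c d) (hV : V ≤ U)
    (hc : V ≤ c.source) : (α.restrict hV).IsRep c.deg (fun i => M.res hc (c.coord i))
      fun i => α.ev V hV ((d i).restrict hc) := by
  refine ⟨fun i => GradedSpace.res_homog hc (c.coord_mem i), fun W hW j X => ?_⟩
  refine (α.ev_eq_sum_frame hd (hW.trans hV) (hW.trans hc) X).trans ?_
  refine Finset.sum_congr rfl fun i _ => ?_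
  rw [GradedSpace.res_res, ← α.ev_res hV hW]
  rfl

/-- The contraction of a 2-form with a vector field in terms of the contractions with a frame. -/
theorem TwoForm.ev_eq_sum_frame (ω : TwoForm M U) {m : ℤ} (hω : ω.HasDegree m) {c : Chart M}
    {d : ∀ i, VField M c.source (-c.deg i)} (hd : IsCoordFrame c d) (hV : V ≤ U)
    (hc : V ≤ c.source) {i : ℤ} (X : VField M V i) (Z : VField M V j) :
    ω.ev V hV X Z = ∑ a, ω.ev V hV X ((d a).restrict hc) *
      (sgn ((j + c.deg a) * (1 + m + c.deg a)) • Z.app V le_rfl (M.res hc (c.coord a))) := by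
  have h := (ω.contract hV X).ev_eq_sum_frame hd le_rfl hc Z
  change ω.ev V hV Z X = ∑ a, _ * ω.ev V hV _ X at h
  rw [ω.ev_symm, h, Finset.smul_sum]
  refine Finset.sum_congr rfl fun a _ => ?_
  have hm : Z.app V le_rfl (M.res hc (c.coord a)) ∈ M.homog V (j + c.deg a) :=
    Z.app_mem le_rfl (GradedSpace.res_homog hc (c.coord_mem a))
  rw [ω.ev_symm hV _ X, mul_smul_comm, M.comm hm (hω V hV _ _ X ((d a).restrict hc)), smul_smul,
    smul_smul, mul_smul_comm]
  congr 1
  generalize c.deg a = l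
  by_cases h1 : Even i <;> by_cases h2 : Even j <;> by_cases h3 : Even l <;>
    by_cases h4 : Even m <;>
    simp only [sgn, Int.even_add, Int.even_mul, Int.not_even_one, even_neg, h1, h2, h3, h4] <;>
    norm_num

end Frame

section VerticalBundle

variable {T E VE : GradedManifold.{u}} {π : Hom E T} {P : Hom VE E}
  {D : ∀ V : Opens E.X, E.Fn V →ₗ[ℝ] VE.Fn (P.pre V)}

/-- Adapted coordinates `a` of `π : E → T` with their frame `d`, together with the induced
coordinates `c` of the vertical tangent bundle and their frame `d'`. The indices of `c` are matched
by `ε` with those of the coordinates of `E` and of the fibre coordinates `φ^A`. -/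
structure VerticalChart (π : Hom E T) (P : Hom VE E)
    (D : ∀ V : Opens E.X, E.Fn V →ₗ[ℝ] VE.Fn (P.pre V)) where
  a : AdaptedChart π
  d : ∀ i, VField E.toGradedSpace a.source (-a.total.deg i)
  c : Chart VE.toGradedSpace
  d' : ∀ i, VField VE.toGradedSpace c.source (-c.deg i)
  ε : a.total.ι ⊕ a.FibIdx ≃ c.ι
  source_eq : c.source = P.pre a.source
  deg_inl : ∀ i, c.deg (ε (.inl i)) = a.total.deg i
  deg_inr : ∀ A, c.deg (ε (.inr A)) = a.total.deg A
  frame : IsCoordFrame a.total d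
  frame' : IsCoordFrame c d'
  coord_inl : ∀ i, c.coord (ε (.inl i)) = P.pullOn source_eq.le (a.total.coord i)
  coord_inr : ∀ A, c.coord (ε (.inr A)) = VE.res source_eq.le (D a.source (a.total.coord A))
  app_inl : ∀ (V : Opens E.X) (hV : V ≤ a.source) (hV' : P.pre V ≤ c.source) (f : E.Fn V) (i),
    (d' (ε (.inl i))).app (P.pre V) hV' (P.pull V f) = P.pull V ((d i).app V hV f)
  app_inr : ∀ (V : Opens E.X) (_ : V ≤ a.source) (hV' : P.pre V ≤ c.source) (f : E.Fn V) (A),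
    (d' (ε (.inr A))).app (P.pre V) hV' (P.pull V f) = 0

/-- The vertical tangent bundle has such coordinates around each point of `E`. -/
theorem IsVerticalTangentBundle.exists_chart (h : IsVerticalTangentBundle π P D) (p : E.X) :
    ∃ c : VerticalChart π P D, p ∈ c.a.source := by
  obtain ⟨a, d, c, d', ε, hc, h1, h2, hp, h3, h4, h5, h6, h7, -⟩ := h.coords p
  exact ⟨⟨a, d, c, d', ε, hc, h1, h2, h3, h4, h5, h6, fun V hV hV' f i => (h7 V hV hV' f).1 i,
    fun V hV hV' f A => (h7 V hV hV' f).2.1 A⟩, hp⟩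

namespace VerticalChart

variable (c : VerticalChart π P D)

theorem pre_le {V : Opens E.X} (hV : V ≤ c.a.source) : P.pre V ≤ c.c.source :=
  le_trans (fun _ hp => hV hp) c.source_eq.ge

/-- The coordinate vector field on the vertical tangent bundle along a coordinate of `E`. -/
def dBase (i : c.a.total.ι) : VField VE.toGradedSpace c.c.source (-c.a.total.deg i) :=
  (c.d' (c.ε (.inl i))).cast (by rw [c.deg_inl])

theorem projects_dBase (i : c.a.total.ι) : Projects P (c.dBase i) (c.d i) := by
  intro V hV W hW h f
  have e : P.pullOn h f = VE.res h (P.pull V f) := rfl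
  have e' : P.pullOn h ((c.d i).app V hV f) = VE.res h (P.pull V ((c.d i).app V hV f)) := rfl
  rw [e, e', ← c.app_inl V hV (c.pre_le hV)]
  exact (c.d' (c.ε (.inl i))).app_res (c.pre_le hV) h _

theorem app_d'_inr (A : c.a.FibIdx) {V : Opens E.X} (hV : V ≤ c.a.source) {W : Opens VE.X}
    (hW : W ≤ c.c.source) (h : W ≤ P.pre V) (f : E.Fn V) :
    (c.d' (c.ε (.inr A))).app W hW (P.pullOn h f) = 0 := by
  have e : P.pullOn h f = VE.res h (P.pull V f) := rfl
  rw [e, (c.d' (c.ε (.inr A))).app_res (c.pre_le hV) h, c.app_inr V hV, map_zero]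

theorem isVertical_d'_inr (A : c.a.FibIdx) : IsVertical P (c.d' (c.ε (.inr A))) := by
  intro V W hW h f
  have h' : W ≤ P.pre (V ⊓ c.a.source) := fun q hq => ⟨h hq, c.source_eq.le (hW hq)⟩
  rw [← P.pullOn_res (V' := V ⊓ c.a.source) inf_le_left h']
  exact c.app_d'_inr A inf_le_right hW h' _

/-- The vector fields along the fibre coordinates are vertical. -/
theorem isVertical_d (A : c.a.FibIdx) : IsVertical π (c.d A) := by
  refine c.a.isVertical le_rfl (c.d A) fun i => ?_
  rw [GradedSpace.res_self]
  exact c.frame.2.1 _ _ fun e => A.2 ⟨i, e.symm⟩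

/-- The chain rule for functions pulled back to the vertical tangent bundle. -/
theorem app_pullOn {V : Opens E.X} (hV : V ≤ c.a.source) {W : Opens VE.X} (h : W ≤ P.pre V) {j : ℤ}
    (X : VField VE.toGradedSpace W j) (f : E.Fn V) :
    X.app W le_rfl (P.pullOn h f) = ∑ i,
      X.app W le_rfl (P.pullOn (h.trans fun _ hp => hV hp) (c.a.total.coord i)) *
        P.pullOn h ((c.d i).app V hV f) := by
  have hW : W ≤ c.c.source := h.trans (c.pre_le hV)
  rw [c.frame'.2.2 W hW j X W le_rfl, ← c.ε.sum_comp, Fintype.sum_sum_type]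
  simp only [c.app_d'_inr _ hV, mul_zero, Finset.sum_const_zero, add_zero]
  refine Finset.sum_congr rfl fun i _ => ?_
  rw [← c.projects_dBase i V hV W hW h, c.coord_inl, P.res_pullOn]
  rfl

/-- The pullback of a 1-form to the vertical tangent bundle in coordinates,
`P^* β = ∑ d(P^* z^i) P^* β(∂_i)`. -/
theorem isRep_of_isPullback {U V : Opens E.X} {W W' : Opens VE.X} {β : OneForm E.toGradedSpace U}
    {η : OneForm VE.toGradedSpace W} (H : IsPullback P β η) (hV : V ≤ c.a.source) (hVU : V ≤ U)
    (hW : W' ≤ W) (h : W' ≤ P.pre V) :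
    (η.restrict hW).IsRep c.a.total.deg (fun i => P.pullOn h (E.res hV (c.a.total.coord i)))
      fun i => P.pullOn h (β.ev V hVU ((c.d i).restrict hV)) := by
  rw [isPullback_iff] at H
  refine ⟨fun i => P.pullOn_mem h (GradedSpace.res_homog hV (c.a.total.coord_mem i)),
    fun W₁ hW₁ j X => GradedSpace.eq_of_locally fun p hp => ?_⟩
  obtain ⟨O, W₂, hO, hW₂, h₂, κ, _, e, g, s, hpW, hβ, hη⟩ := H p (hW (hW₁ hp))
  have hV' : O ⊓ V ≤ V := inf_le_right
  have hW₃ : W₁ ⊓ W₂ ≤ P.pre (O ⊓ V) := fun q hq => ⟨h₂ hq.2, h (hW₁ hq.1)⟩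
  refine ⟨W₁ ⊓ W₂, inf_le_left, ⟨hp, hpW⟩, ?_⟩
  have e1 : VE.res (inf_le_left : W₁ ⊓ W₂ ≤ W₁) ((η.restrict hW).ev W₁ hW₁ X) =
      (η.restrict hW₂).ev (W₁ ⊓ W₂) inf_le_right (X.restrict inf_le_left) :=
    (η.ev_res (hW₁.trans hW) inf_le_left X).symm
  have hβ' : ∀ i, E.res hV' (β.ev V hVU ((c.d i).restrict hV)) = ∑ a,
      (c.d i).app (O ⊓ V) (hV'.trans hV) (E.res inf_le_left (g a)) * E.res inf_le_left (s a) :=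
    fun i => by
      rw [← β.ev_res hVU hV']
      exact hβ.2 (O ⊓ V) inf_le_left _ (((c.d i).restrict hV).restrict hV')
  have e2 : ∀ i, P.pullOn hW₃ (E.res hV' (β.ev V hVU ((c.d i).restrict hV))) =
      P.pullOn (hW₃.trans fun _ hp => hV' hp) (β.ev V hVU ((c.d i).restrict hV)) :=
    fun i => P.pullOn_res _ _ _
  have e3 : ∀ a, P.pullOn hW₃ (E.res inf_le_left (g a)) =
      P.pullOn (hW₃.trans fun _ hp => hp.1) (g a) := fun a => P.pullOn_res _ _ _
  have e4 : ∀ a, P.pullOn hW₃ (E.res inf_le_left (s a)) =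
      P.pullOn (hW₃.trans fun _ hp => hp.1) (s a) := fun a => P.pullOn_res _ _ _
  rw [e1, hη.2 (W₁ ⊓ W₂) inf_le_right, map_sum]
  simp only [P.res_pullOn]
  simp only [map_mul, ← X.app_res, P.res_pullOn]
  simp only [← e2, hβ', map_sum, map_mul, e4, Finset.mul_sum]
  rw [Finset.sum_comm]
  refine Finset.sum_congr rfl fun a _ => ?_
  rw [← e3, c.app_pullOn (hV'.trans hV) hW₃, Finset.sum_mul]
  refine Finset.sum_congr rfl fun i _ => ?_
  rw [mul_assoc, P.pullOn_res]
  rfl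

end VerticalChart

end VerticalBundle

/-! ### Pullbacks to the vertical tangent bundle -/

section Forms

variable {M : GradedSpace.{u}} {U V : Opens M.X}

theorem TwoForm.ev_congr_right (ω : TwoForm M U) (hV : V ≤ U) {k i j : ℤ} (hij : i = j)
    (X : VField M V k) (Y : VField M V i) (Y' : VField M V j) (h : Y.app = Y'.app) :
    ω.ev V hV X Y = ω.ev V hV X Y' := by
  subst hij
  rw [VField.ext h]

theorem OneForm.HasDegree.extDeriv {α : OneForm M U} {m : ℤ} (h : α.HasDegree m) :
    α.extDeriv.HasDegree m := by
  intro V hV i j X Y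
  have h1 := Y.app_mem le_rfl (h V hV i X)
  have h2 := h V hV _ (Y.bracket X)
  have h3 := X.app_mem le_rfl (h V hV j Y)
  rw [show j + (m + i) = m + i + j by ring] at h1
  rw [show m + (j + i) = m + i + j by ring] at h2
  rw [show i + (m + j) = m + i + j by ring] at h3
  exact sub_mem (Submodule.smul_mem _ _ (sub_mem h1 h2)) (Submodule.smul_mem _ _ h3)

end Forms

section Pullback

variable {T E VE : GradedManifold.{u}} {π : Hom E T} {P : Hom VE E}
  {D : ∀ V : Opens E.X, E.Fn V →ₗ[ℝ] VE.Fn (P.pre V)}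

/-- Forms in the ideal of the base vanish on vertical vector fields. -/
theorem IsBaseForm.ev_eq_zero {U V : Opens E.X} {α : OneForm E.toGradedSpace U}
    (hα : IsBaseForm π α) {j : ℤ} {X : VField E.toGradedSpace V j} (hX : IsVertical π X)
    (hV : V ≤ U) : α.ev V hV X = 0 := by
  refine GradedSpace.eq_of_locally fun p hp => ?_
  obtain ⟨W, hW, κ, _, e, g, s, hpW, hb, hr⟩ := hα p (hV hp)
  refine ⟨V ⊓ W, inf_le_left, ⟨hp, hpW⟩, ?_⟩
  rw [← α.ev_res hV inf_le_left, map_zero]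
  refine (hr.2 (V ⊓ W) inf_le_right _ _).trans (Finset.sum_eq_zero fun a _ => ?_)
  have : (X.restrict (inf_le_left : V ⊓ W ≤ V)).app (V ⊓ W) le_rfl
    (E.res (inf_le_right : V ⊓ W ≤ W) (g a)) = 0 :=
    ((hb a).res inf_le_right).app_eq_zero hX inf_le_left
  rw [this, zero_mul]

/-- A representation of a 1-form on `E` pulls back to the vertical tangent bundle. -/
theorem VerticalChart.isRep_pullOn (c : VerticalChart π P D) {U V : Opens E.X} {W W' : Opens VE.X}
    {β : OneForm E.toGradedSpace U} {η : OneForm VE.toGradedSpace W} (H : IsPullback P β η)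
    (hV : V ≤ c.a.source) (hVU : V ≤ U) (hW : W' ≤ W) (h : W' ≤ P.pre V) {κ : Type} [Fintype κ]
    {e : κ → ℤ} {g s : κ → E.Fn V} (hβ : (β.restrict hVU).IsRep e g s) :
    (η.restrict hW).IsRep e (fun a => P.pullOn h (g a)) fun a => P.pullOn h (s a) := by
  have hη := c.isRep_of_isPullback H hV hVU hW h
  refine ⟨fun a => P.pullOn_mem h (hβ.1 a), fun W₁ hW₁ j X => ?_⟩
  rw [hη.2 W₁ hW₁ j X]
  have hβ' : ∀ i, β.ev V hVU ((c.d i).restrict hV) = ∑ a, (c.d i).app V hV (g a) * s a := fun i => by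
    have := hβ.2 V le_rfl _ ((c.d i).restrict hV)
    simp only [GradedSpace.res_self] at this
    exact this
  simp only [P.res_pullOn, P.pullOn_res, hβ', map_sum, map_mul, Finset.mul_sum]
  rw [Finset.sum_comm]
  refine Finset.sum_congr rfl fun a _ => ?_
  rw [c.app_pullOn hV (hW₁.trans h), Finset.sum_mul]
  refine Finset.sum_congr rfl fun i _ => ?_
  rw [mul_assoc]

/-- The pullback of a homogeneous 1-form is homogeneous. -/
theorem IsPullback.hasDegree (hVE : IsVerticalTangentBundle π P D) {U : Opens E.X}
    {W : Opens VE.X} {β : OneForm E.toGradedSpace U} {η : OneForm VE.toGradedSpace W}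
    (H : IsPullback P β η) (hW : W ≤ P.pre U) {m : ℤ}
    (hβ : β.HasDegree m) : η.HasDegree m := by
  intro V hV j X
  refine VE.mem_of_locally _ fun p hp => ?_
  obtain ⟨c, hc⟩ := hVE.exists_chart (P.body p)
  have hVc : c.a.source ⊓ U ≤ c.a.source := inf_le_left
  have hη := c.isRep_of_isPullback H hVc inf_le_right
    (W' := V ⊓ P.pre (c.a.source ⊓ U)) (inf_le_left.trans hV) inf_le_right
  refine ⟨V ⊓ P.pre (c.a.source ⊓ U), inf_le_left, ⟨hp, hc, hW (hV hp)⟩, ?_⟩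
  change VE.res _ _ ∈ _
  rw [← η.ev_res hV inf_le_left]
  have e := hη.2 _ le_rfl j (X.restrict inf_le_left)
  change η.ev _ _ _ = _ at e
  rw [e]
  refine Submodule.sum_mem _ fun i _ => ?_
  have h1 := (X.restrict inf_le_left).app_mem le_rfl (GradedSpace.res_homog le_rfl (hη.1 i))
  have h2 := GradedSpace.res_homog (le_refl (V ⊓ P.pre (c.a.source ⊓ U)))
    (P.pullOn_mem inf_le_right (hβ (c.a.source ⊓ U) inf_le_right _ ((c.d i).restrict hVc)))
  have h3 := VE.mul_mem h1 h2
  rwa [show j + c.a.total.deg i + (m + -c.a.total.deg i) = m + j by ring] at h3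

/-- `i_k P^* dχ` is the pullback of `i_v dχ` for vector fields `k` over `v`. -/
theorem IsPullback.contract_extDeriv (hVE : IsVerticalTangentBundle π P D)
    {χ : OneForm E.toGradedSpace ⊤}
    {Pχ : OneForm VE.toGradedSpace ⊤} (H : IsPullback P χ Pχ) {m : ℤ} (hχ : χ.HasDegree m)
    {U : Opens E.X} {W : Opens VE.X} (hWU : W ≤ P.pre U) {j : ℤ} {v : VField E.toGradedSpace U j}
    {k : VField VE.toGradedSpace W j} (hk : Projects P k v) :
    IsPullback P (χ.extDeriv.contract le_top v) (Pχ.extDeriv.contract le_top k) := by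
  rw [isPullback_iff]
  intro p hp
  obtain ⟨c, hc⟩ := hVE.exists_chart (P.body p)
  have hVc : c.a.source ⊓ U ≤ c.a.source := inf_le_left
  have hVU : c.a.source ⊓ U ≤ U := inf_le_right
  have hW' : W ⊓ P.pre (c.a.source ⊓ U) ≤ P.pre (c.a.source ⊓ U) := inf_le_right
  have hW'' : W ⊓ P.pre (c.a.source ⊓ U) ≤ W := inf_le_left
  have h1 := χ.isRep_frame c.frame (le_top : c.a.source ⊓ U ≤ ⊤) hVc
  have h2 := c.isRep_of_isPullback H hVc le_top (le_top : W ⊓ P.pre (c.a.source ⊓ U) ≤ ⊤) hW'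
  have hs := fun i => hχ (c.a.source ⊓ U) le_top _ ((c.d i).restrict hVc)
  have h3 := h1.contract hs (v.restrict hVU)
  have h4 := h2.contract (fun i => P.pullOn_mem hW' (hs i)) (k.restrict hW'')
  have e : ∀ f : E.Fn (c.a.source ⊓ U), (k.restrict hW'').app _ le_rfl (P.pullOn hW' f) =
    P.pullOn hW' ((v.restrict hVU).app _ le_rfl f) := fun f => hk _ hVU _ hW'' hW' f
  refine ⟨c.a.source ⊓ U, W ⊓ P.pre (c.a.source ⊓ U), hVU, hW'', hW',
    c.a.total.ι ⊕ c.a.total.ι, inferInstance, _, _, _, ⟨hp, hc, hWU hp⟩, h3, ?_⟩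
  simp only [e] at h4
  have e2 : ∀ A B : c.a.total.ι → E.Fn (c.a.source ⊓ U), (fun a => P.pullOn hW' (Sum.elim A B a)) =
      Sum.elim (fun i => P.pullOn hW' (A i)) (fun i => P.pullOn hW' (B i)) := by
    intro A B
    funext x
    cases x <;> rfl
  rw [e2, e2]
  simp only [map_neg, map_smul]
  exact h4

/-- A pullback of a vanishing 1-form vanishes. -/
theorem IsPullback.eq_zero (hVE : IsVerticalTangentBundle π P D) {U : Opens E.X}
    {W : Opens VE.X} {β : OneForm E.toGradedSpace U} {η : OneForm VE.toGradedSpace W}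
    (H : IsPullback P β η) (hW : W ≤ P.pre U)
    (hβ : ∀ (V : Opens E.X) (hV : V ≤ U) (j : ℤ) (X : VField E.toGradedSpace V j), β.ev V hV X = 0)
    {V : Opens VE.X} (hV : V ≤ W) {j : ℤ} (X : VField VE.toGradedSpace V j) : η.ev V hV X = 0 := by
  refine GradedSpace.eq_of_locally fun p hp => ?_
  obtain ⟨c, hc⟩ := hVE.exists_chart (P.body p)
  have hη := c.isRep_of_isPullback H (V := c.a.source ⊓ U) inf_le_left inf_le_right
    (W' := V ⊓ P.pre (c.a.source ⊓ U)) (inf_le_left.trans hV) inf_le_right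
  refine ⟨V ⊓ P.pre (c.a.source ⊓ U), inf_le_left, ⟨hp, hc, hW (hV hp)⟩, ?_⟩
  rw [← η.ev_res hV inf_le_left, map_zero]
  refine (hη.2 _ le_rfl j (X.restrict inf_le_left)).trans (Finset.sum_eq_zero fun i _ => ?_)
  simp only [hβ, map_zero, mul_zero]

theorem Projects.zero_of_isVertical {U : Opens E.X} {N : Opens VE.X} {j : ℤ}
    {W : VField VE.toGradedSpace N j} (hW : IsVertical P W) :
    Projects P W (0 : VField E.toGradedSpace U j) :=
  fun V _ W' hW' h f => (hW V W' hW' h f).trans (map_zero _).symm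

/-- `i_W P^* dχ = 0` for vector fields `W` along the fibres of `VE → E`. -/
theorem IsPullback.extDeriv_ev_eq_zero (hVE : IsVerticalTangentBundle π P D)
    {χ : OneForm E.toGradedSpace ⊤} {η : OneForm VE.toGradedSpace ⊤} (H : IsPullback P χ η) {m : ℤ}
    (hχ : χ.HasDegree m) {N : Opens VE.X} {i j : ℤ} (X : VField VE.toGradedSpace N i)
    {W : VField VE.toGradedSpace N j} (hW : IsVertical P W) :
    η.extDeriv.ev N le_top X W = 0 :=
  IsPullback.eq_zero hVE (H.contract_extDeriv hVE hχ (U := ⊤) (fun _ _ => trivial)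
    (Projects.zero_of_isVertical hW)) (fun _ _ => trivial)
    (fun _ hV _ X => χ.extDeriv.contract_zero le_top hV X) le_rfl X

/-- The contraction of `P^* dχ` with a vector field on the vertical tangent bundle along which the
functions of the base `T` are constant, in terms of the contractions of `dχ` with the vector fields
along the fibres of `E`. -/
theorem VerticalChart.ev_extDeriv_eq_sum (hVE : IsVerticalTangentBundle π P D)
    (c : VerticalChart π P D) {χ : OneForm E.toGradedSpace ⊤}
    {Pχ : OneForm VE.toGradedSpace ⊤} (H : IsPullback P χ Pχ) {m : ℤ} (hχ : χ.HasDegree m)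
    {W : Opens VE.X} (hW : W ≤ c.c.source) {i j : ℤ} (X : VField VE.toGradedSpace W i)
    (Z : VField VE.toGradedSpace W j)
    (hZ : ∀ i, Z.app W le_rfl (VE.res hW (c.c.coord (c.ε (.inl (c.a.emb i))))) = 0) :
    Pχ.extDeriv.ev W le_top X Z = ∑ A : c.a.FibIdx,
      (Pχ.extDeriv.contract le_top (c.dBase A)).ev W hW X *
      (sgn ((j + c.a.total.deg A) * (1 + m + c.a.total.deg A)) •
        Z.app W le_rfl (VE.res hW (c.c.coord (c.ε (.inl A))))) := by
  have hdeg : Pχ.extDeriv.HasDegree m :=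
    (IsPullback.hasDegree hVE H le_top hχ).extDeriv
  have hinr : ∀ A, Pχ.extDeriv.ev W le_top X ((c.d' (c.ε (.inr A))).restrict hW) = 0 := fun A =>
    H.extDeriv_ev_eq_zero hVE hχ X fun V W' hW' h f =>
      c.isVertical_d'_inr A V W' (hW'.trans hW) h f
  rw [Pχ.extDeriv.ev_eq_sum_frame hdeg c.frame' le_top hW, ← c.ε.sum_comp, Fintype.sum_sum_type]
  simp only [hinr, zero_mul, Finset.sum_const_zero, add_zero, c.deg_inl]
  rw [← Finset.sum_subset (Finset.subset_univ
    ((Finset.univ : Finset c.a.FibIdx).map (Function.Embedding.subtype _))), Finset.sum_map]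
  · refine Finset.sum_congr rfl fun A _ => ?_
    congr 1
    exact Pχ.extDeriv.ev_congr_right le_top (congrArg Neg.neg (c.deg_inl _)) X _ _ rfl
  · intro i _ hi
    have : i ∈ Set.range c.a.emb := by
      by_contra h
      exact hi (Finset.mem_map.2 ⟨⟨i, h⟩, Finset.mem_univ _, rfl⟩)
    obtain ⟨i, rfl⟩ := this
    rw [hZ, smul_zero, mul_zero]

end Pullback

/-! ### Lifts to the vertical tangent bundle -/

section Glue

variable {M : GradedSpace.{u}} {N : Opens M.X} {j : ℤ}

/-- Vector fields on a cover that agree on the overlaps glue. -/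
theorem VField.exists_glue {κ : Type u} (N' : κ → Opens M.X) (hN : ∀ a, N' a ≤ N)
    (hcover : ∀ p ∈ N, ∃ a, p ∈ N' a) (X : ∀ a, VField M (N' a) j)
    (hX : ∀ a b (V : Opens M.X) (ha : V ≤ N' a) (hb : V ≤ N' b) (f : M.Fn V),
      (X a).app V ha f = (X b).app V hb f) :
    ∃ Y : VField M N j, ∀ a (V : Opens M.X) (ha : V ≤ N' a) (f : M.Fn V),
      Y.app V (ha.trans (hN a)) f = (X a).app V ha f := by
  have key : ∀ (V : Opens M.X) (_ : V ≤ N) (f : M.Fn V), ∃ g : M.Fn V, ∀ a (V' : Opens M.X)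
      (h : V' ≤ V) (ha : V' ≤ N' a), M.res h g = (X a).app V' ha (M.res h f) := by
    intro V hV f
    obtain ⟨g, hg⟩ := M.exists_glue (U := V) (fun a => V ⊓ N' a) (fun a => inf_le_left)
      (fun p hp => (hcover p (hV hp)).imp fun a ha => ⟨hp, ha⟩)
      (fun a => (X a).app _ inf_le_right (M.res inf_le_left f)) fun a b => by
        rw [← (X a).app_res inf_le_right inf_le_left, ← (X b).app_res inf_le_right inf_le_right,
          GradedSpace.res_res, GradedSpace.res_res]
        exact hX a b _ _ _ _
    refine ⟨g, fun a V' h ha => ?_⟩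
    have h' : V' ≤ V ⊓ N' a := le_inf h ha
    rw [← GradedSpace.res_res inf_le_left h' g, hg a, ← (X a).app_res inf_le_right h',
      GradedSpace.res_res]
  choose g hg using key
  have hloc : ∀ {V : Opens M.X} (hV : V ≤ N) {f f' : M.Fn V}, (∀ a (V' : Opens M.X) (h : V' ≤ V)
      (_ : V' ≤ N' a), M.res h f = M.res h f') → f = f' := by
    intro V hV f f' h
    refine GradedSpace.eq_of_locally fun p hp => ?_
    obtain ⟨a, ha⟩ := hcover p (hV hp)
    exact ⟨V ⊓ N' a, inf_le_left, ⟨hp, ha⟩, h a _ _ inf_le_right⟩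
  refine ⟨⟨fun V hV => ⟨⟨g V hV, fun f f' => hloc hV fun a V' h ha => ?_⟩,
    fun r f => hloc hV fun a V' h ha => ?_⟩, fun {V W} hV hW f => hloc (hW.trans hV)
    fun a V' h ha => ?_, fun {V} hV k f hf => M.mem_of_locally _ fun p hp => ?_,
    fun {V} hV k f hf f' => hloc hV fun a V' h ha => ?_⟩, fun a V ha f => ?_⟩
  · simp only [map_add, hg V hV _ a V' h ha]
  · simp only [map_smul, hg V hV _ a V' h ha, RingHom.id_apply]
  · change M.res h (g W _ _) = M.res h (M.res hW (g V hV f))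
    rw [hg W _ _ a V' h ha, GradedSpace.res_res, GradedSpace.res_res, hg V hV f a V' _ ha]
  · obtain ⟨a, ha⟩ := hcover p (hV hp)
    refine ⟨V ⊓ N' a, inf_le_left, ⟨hp, ha⟩, ?_⟩
    change M.res _ (g V hV f) ∈ _
    rw [hg V hV f a _ _ inf_le_right]
    exact (X a).app_mem _ (GradedSpace.res_homog _ hf)
  · change M.res h (g V hV _) = M.res h (g V hV f * f' + sgn (j * k) • (f * g V hV f'))
    simp only [map_add, map_mul, map_smul, hg V hV _ a V' h ha]
    exact (X a).leibniz ha (GradedSpace.res_homog h hf) _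
  · change g V _ f = _
    have := hg V (ha.trans (hN a)) f a V le_rfl ha
    rwa [GradedSpace.res_self, GradedSpace.res_self] at this

end Glue

section Lift

variable {T E VE : GradedManifold.{u}} {π : Hom E T} {P : Hom VE E}
  {D : ∀ V : Opens E.X, E.Fn V →ₗ[ℝ] VE.Fn (P.pre V)}

/-- `k` is a lift of `v` to the vertical tangent bundle: `k (P^* f) = P^* (v f)` and
`k (D f) = D (v f)`. -/
structure IsLift (P : Hom VE E) (D : ∀ V : Opens E.X, E.Fn V →ₗ[ℝ] VE.Fn (P.pre V))
    {U : Opens E.X} {N : Opens VE.X} {j : ℤ} (v : VField E.toGradedSpace U j)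
    (k : VField VE.toGradedSpace N j) : Prop where
  projects : Projects P k v
  app_D : ∀ (V : Opens E.X) (hV : V ≤ U) (W : Opens VE.X) (hW : W ≤ N) (h : W ≤ P.pre V)
    (f : E.Fn V), k.app W hW (VE.res h (D V f)) = VE.res h (D V (v.app V hV f))

theorem IsCompleteLift.isLift {j : ℤ} {Q : VField E.toGradedSpace ⊤ j}
    {Qt : VField VE.toGradedSpace ⊤ j} (h : IsCompleteLift P D Q Qt) : IsLift P D Q Qt where
  projects V _ W _ hW f := by
    exact (Qt.app_res le_top hW _).trans (congrArg (VE.res hW) (h V f).1)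
  app_D V _ W _ hW f := by
    exact (Qt.app_res le_top hW _).trans (congrArg (VE.res hW) (h V f).2)

theorem IsConnectionField.app_pullOn {C : AffineConnection E} {V : VField VE.toGradedSpace ⊤ 0}
    (hV : IsConnectionField π P D C V) {U : Opens E.X} {W : Opens VE.X} (h : W ≤ P.pre U)
    (f : E.Fn U) : V.app W le_top (P.pullOn h f) = VE.res h (D U f) := by
  rw [← hV.1]
  exact V.app_res le_top h _

/-- A vector field that annihilates the coordinates of `E` is vertical. -/
theorem VerticalChart.isVertical_of_coord (c : VerticalChart π P D) {W : Opens VE.X}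
    (hW : W ≤ P.pre c.a.source) {j : ℤ} {X : VField VE.toGradedSpace W j}
    (hX : ∀ i, X.app W le_rfl (P.pullOn hW (c.a.total.coord i)) = 0) : IsVertical P X := by
  intro V W' hW' h f
  have h' : W' ≤ P.pre (V ⊓ c.a.source) := fun q hq => ⟨h hq, hW (hW' hq)⟩
  rw [← P.pullOn_res (V' := V ⊓ c.a.source) inf_le_left h']
  refine (c.app_pullOn inf_le_right h' (X.restrict hW') _).trans
    (Finset.sum_eq_zero fun i _ => ?_)
  have e : (X.restrict hW').app W' le_rfl (P.pullOn (hW'.trans hW) (c.a.total.coord i)) = 0 := by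
    rw [← P.res_pullOn hW hW']
    refine (X.app_res le_rfl hW' _).trans ?_
    rw [hX, map_zero]
  rw [e, zero_mul]

theorem IsVerticalTangentBundle.res_D (hVE : IsVerticalTangentBundle π P D) {U V : Opens E.X}
    {W : Opens VE.X} (hV : V ≤ U) (h : W ≤ P.pre V) (f : E.Fn U) :
    VE.res h (D V (E.res hV f)) = VE.res (h.trans fun _ hp => hV hp) (D U f) := by
  exact (congrArg (VE.res h) (hVE.D_res hV f)).trans (GradedSpace.res_res _ _ _)

/-- Lifts are unique. -/
theorem VerticalChart.isLift_unique (hVE : IsVerticalTangentBundle π P D)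
    (c : VerticalChart π P D) {U : Opens E.X} {N N' : Opens VE.X}
    {j : ℤ} {v : VField E.toGradedSpace U j} {k : VField VE.toGradedSpace N j}
    {k' : VField VE.toGradedSpace N' j} (hk : IsLift P D v k) (hk' : IsLift P D v k')
    {W : Opens VE.X} (hW : W ≤ N) (hW' : W ≤ N') (hU : W ≤ P.pre U) (hc : W ≤ P.pre c.a.source)
    (f : VE.Fn W) : k.app W hW f = k'.app W hW' f := by
  have hWc : W ≤ c.c.source := hc.trans c.source_eq.ge
  have hUc : W ≤ P.pre (c.a.source ⊓ U) := fun q hq => ⟨hc hq, hU hq⟩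
  have e := c.frame'.2.2 W hWc j (k.restrict hW) W le_rfl f
  have e' := c.frame'.2.2 W hWc j (k'.restrict hW') W le_rfl f
  refine e.trans (Eq.trans ?_ e'.symm)
  refine Finset.sum_congr rfl fun i _ => congrArg (· * _) ?_
  obtain ⟨i, rfl⟩ := c.ε.surjective i
  change k.app W hW _ = k'.app W hW' _
  rcases i with i | A
  · rw [c.coord_inl, P.res_pullOn, ← P.pullOn_res inf_le_left hUc]
    rw [hk.projects _ inf_le_right W hW hUc, hk'.projects _ inf_le_right W hW' hUc]
  · rw [c.coord_inr, GradedSpace.res_res, ← hVE.res_D inf_le_left hUc]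
    rw [hk.app_D _ inf_le_right W hW hUc, hk'.app_D _ inf_le_right W hW' hUc]

/-- The lift of a vertical vector field in coordinates. -/
theorem VerticalChart.exists_isLift (hVE : IsVerticalTangentBundle π P D) (c : VerticalChart π P D)
    {C : AffineConnection E} {Γ : VField VE.toGradedSpace ⊤ 0} (hΓ : IsConnectionField π P D C Γ)
    {U : Opens E.X} (hU : U ≤ c.a.source) {j : ℤ} (v : VField E.toGradedSpace U j)
    (hv : IsVertical π v) : ∃ k : VField VE.toGradedSpace (P.pre U) j, IsLift P D v k := by
  have hN := c.pre_le hU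
  have hm : ∀ i, v.app U le_rfl (E.res hU (c.a.total.coord i)) ∈ E.homog U (j + c.a.total.deg i) :=
    fun i => v.app_mem le_rfl (GradedSpace.res_homog hU (c.a.total.coord_mem i))
  let k : VField VE.toGradedSpace (P.pre U) j :=
    ∑ i, (((c.dBase i).restrict hN).fmul _ (P.pull_mem (hm i))).cast (by ring) +
    ∑ A : c.a.FibIdx, (((c.d' (c.ε (.inr A))).restrict hN).fmul _ (hVE.D_mem (hm A))).cast
      (by rw [c.deg_inr]; ring)
  have hk : ∀ (W : Opens VE.X) (hW : W ≤ P.pre U) (f : VE.Fn W), k.app W hW f =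
      ∑ i, P.pullOn hW (v.app U le_rfl (E.res hU (c.a.total.coord i))) *
        (c.dBase i).app W (hW.trans hN) f +
      ∑ A : c.a.FibIdx, VE.res hW (D U (v.app U le_rfl (E.res hU (c.a.total.coord A)))) *
        (c.d' (c.ε (.inr A))).app W (hW.trans hN) f := by
    intro W hW f
    change (∑ i, _ : VField _ _ _).app W hW f + (∑ A, _ : VField _ _ _).app W hW f = _
    rw [VField.sum_app, VField.sum_app]
    rfl
  have h1 : Projects P k v := by
    intro V hV W hW h f
    rw [hk]
    simp only [c.app_d'_inr _ (hV.trans hU), mul_zero, Finset.sum_const_zero, add_zero]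
    rw [c.frame.2.2 U hU j v V hV f, map_sum]
    refine Finset.sum_congr rfl fun i _ => ?_
    rw [map_mul, c.projects_dBase i V (hV.trans hU) W _ h, ← GradedSpace.res_res hU hV,
      v.app_res le_rfl hV, P.pullOn_res]
  refine ⟨k, h1, ?_⟩
  -- `[Γ, k]` is vertical over `E`: this compares the two sides for all functions
  have hcoord : ∀ i, k.app _ le_rfl (D U (E.res hU (c.a.total.coord i))) =
      D U (v.app U le_rfl (E.res hU (c.a.total.coord i))) := by
    intro i
    by_cases hi : i ∈ Set.range c.a.emb
    · obtain ⟨i, rfl⟩ := hi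
      have h : U ≤ π.pre c.a.base.source := hU.trans c.a.le_pre
      rw [c.a.coord_emb, π.res_pullOn, hVE.D_base, hv _ _ _ h, map_zero, map_zero]
    · have e : D U (E.res hU (c.a.total.coord i)) =
          VE.res hN (c.c.coord (c.ε (.inr ⟨i, hi⟩))) := by
        rw [c.coord_inr, GradedSpace.res_res, hVE.D_res]
      have e' : ∀ a, (c.d' a).app (P.pre U) hN (VE.res hN (c.c.coord (c.ε (.inr ⟨i, hi⟩)))) =
          VE.res hN ((c.d' a).app _ le_rfl (c.c.coord (c.ε (.inr ⟨i, hi⟩)))) := fun a =>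
        (c.d' a).app_res le_rfl hN _
      rw [e, hk, Finset.sum_eq_zero, zero_add, Finset.sum_eq_single ⟨i, hi⟩]
      · rw [e', c.frame'.1, map_one, mul_one, GradedSpace.res_self]
      · intro A _ hA
        rw [e', c.frame'.2.1 _ _ fun e => hA (Sum.inr_injective (c.ε.injective e)), map_zero,
          mul_zero]
      · simp
      · intro a _
        have : (c.dBase a).app (P.pre U) hN (VE.res hN (c.c.coord (c.ε (.inr ⟨i, hi⟩)))) = 0 := by
          refine (e' (c.ε (.inl a))).trans ?_
          rw [c.frame'.2.1 _ _ fun e => Sum.inl_ne_inr (c.ε.injective e), map_zero]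
        rw [this, mul_zero]
  have hb : ∀ (V : Opens E.X) (hV : V ≤ U) (W : Opens VE.X) (hW : W ≤ P.pre U) (h : W ≤ P.pre V)
      (f : E.Fn V), ((Γ.restrict le_top).bracket k).app W hW (P.pullOn h f) =
        VE.res h (D V (v.app V hV f)) - k.app W hW (VE.res h (D V f)) := by
    intro V hV W hW h f
    change Γ.app W _ (k.app W hW _) - sgn (0 * j) • k.app W hW (Γ.app W _ _) = _
    rw [h1 V hV W hW h, hΓ.app_pullOn, hΓ.app_pullOn, zero_mul]
    simp [sgn]
  have hvert : IsVertical P ((Γ.restrict le_top).bracket k) := by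
    refine c.isVertical_of_coord (fun _ hp => hU hp) fun i => ?_
    have := hb U le_rfl (P.pre U) le_rfl le_rfl (E.res hU (c.a.total.coord i))
    rw [P.pullOn_res] at this
    rw [this, GradedSpace.res_self, GradedSpace.res_self, hcoord, sub_self]
  intro V hV W hW h f
  have := hb V hV W hW h f
  rw [hvert V W hW h f] at this
  exact (sub_eq_zero.1 this.symm).symm

theorem IsLift.restrict {U U' : Opens E.X} {N N' : Opens VE.X} {j : ℤ}
    {v : VField E.toGradedSpace U j} {k : VField VE.toGradedSpace N j} (h : IsLift P D v k)
    (hU : U' ≤ U) (hN : N' ≤ N) : IsLift P D (v.restrict hU) (k.restrict hN) where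
  projects V hV W hW := h.projects V (hV.trans hU) W (hW.trans hN)
  app_D V hV W hW := h.app_D V (hV.trans hU) W (hW.trans hN)

/-- Vertical vector fields lift to the vertical tangent bundle. -/
theorem exists_isLift (hVE : IsVerticalTangentBundle π P D) {C : AffineConnection E}
    {Γ : VField VE.toGradedSpace ⊤ 0} (hΓ : IsConnectionField π P D C Γ)
    {U : Opens E.X} {j : ℤ} (v : VField E.toGradedSpace U j)
    (hv : IsVertical π v) : ∃ k : VField VE.toGradedSpace (P.pre U) j, IsLift P D v k := by
  choose c hc using hVE.exists_chart
  have hvr : ∀ y, IsVertical π (v.restrict (inf_le_right : (c y).a.source ⊓ U ≤ U)) :=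
    fun y V W hW => hv V W _
  choose k hk using fun y => (c y).exists_isLift hVE hΓ inf_le_left _ (hvr y)
  have hk' : ∀ y z (W : Opens VE.X) (hy : W ≤ P.pre ((c y).a.source ⊓ U))
      (hz : W ≤ P.pre ((c z).a.source ⊓ U)) (f : VE.Fn W),
      (k y).app W hy f = (k z).app W hz f := by
    intro y z W hy hz f
    have hle : (c y).a.source ⊓ U ⊓ ((c z).a.source ⊓ U) ≤ (c y).a.source ⊓ U := inf_le_left
    have hle' : (c y).a.source ⊓ U ⊓ ((c z).a.source ⊓ U) ≤ (c z).a.source ⊓ U := inf_le_right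
    exact (c y).isLift_unique hVE ((hk y).restrict hle le_rfl) ((hk z).restrict hle' le_rfl) hy hz
      (fun q hq => ⟨hy hq, hz hq⟩) (fun q hq => (hy hq).1) f
  obtain ⟨k₀, hk₀⟩ := VField.exists_glue (N := P.pre U) (fun y => P.pre ((c y).a.source ⊓ U))
    (fun y q hq => hq.2) (fun q hq => ⟨P.body q, hc _, hq⟩) k hk'
  refine ⟨k₀, fun V hV W hW h f => ?_, fun V hV W hW h f => ?_⟩
  · refine GradedSpace.eq_of_locally fun q hq => ?_
    have hle : W ⊓ P.pre ((c (P.body q)).a.source ⊓ U) ≤ W := inf_le_left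
    have hV' : V ⊓ (c (P.body q)).a.source ≤ (c (P.body q)).a.source ⊓ U :=
      fun x hx => ⟨hx.2, hV hx.1⟩
    have h' : W ⊓ P.pre ((c (P.body q)).a.source ⊓ U) ≤ P.pre (V ⊓ (c (P.body q)).a.source) :=
      fun x hx => ⟨h hx.1, hx.2.1⟩
    refine ⟨_, hle, ⟨hq, hc _, hV (h hq)⟩, ?_⟩
    have := (hk (P.body q)).projects _ hV' _ inf_le_right h' (E.res inf_le_left f)
    rw [← hk₀ _ _ inf_le_right, P.pullOn_res] at this
    rw [← k₀.app_res hW hle, P.res_pullOn, this, P.res_pullOn, ← P.pullOn_res inf_le_left h']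
    exact congrArg (P.pullOn h') (v.app_res hV inf_le_left f)
  · refine GradedSpace.eq_of_locally fun q hq => ?_
    have hle : W ⊓ P.pre ((c (P.body q)).a.source ⊓ U) ≤ W := inf_le_left
    have hV' : V ⊓ (c (P.body q)).a.source ≤ (c (P.body q)).a.source ⊓ U :=
      fun x hx => ⟨hx.2, hV hx.1⟩
    have h' : W ⊓ P.pre ((c (P.body q)).a.source ⊓ U) ≤ P.pre (V ⊓ (c (P.body q)).a.source) :=
      fun x hx => ⟨h hx.1, hx.2.1⟩
    refine ⟨_, hle, ⟨hq, hc _, hV (h hq)⟩, ?_⟩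
    have := (hk (P.body q)).app_D _ hV' _ inf_le_right h' (E.res inf_le_left f)
    rw [← hk₀ _ _ inf_le_right, hVE.res_D] at this
    rw [← k₀.app_res hW hle, GradedSpace.res_res, this, GradedSpace.res_res,
      ← hVE.res_D inf_le_left h']
    exact congrArg (fun g => VE.res h' (D _ g)) (v.app_res hV inf_le_left f)

end Lift

/-! ### Second Lie derivatives and lifts -/

section SecondVariation

variable {M : GradedSpace.{u}} {U V : Opens M.X} {i j : ℤ}

namespace OneForm

theorem lie_ev_of_degree_zero (Z : VField M U 0) (α : OneForm M U) (hV : V ≤ U) (X : VField M V j) :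
    (lie Z α).ev V hV X = Z.app V hV (α.ev V hV X) - α.ev V hV ((Z.restrict hV).bracket X) := by
  change sgn (0 * _) • _ = _
  simp [sgn]

theorem lie_dFun_of_degree_zero (Z : VField M U 0) (f : M.Fn U) :
    lie Z (dFun f) = dFun (Z.app U le_rfl f) := by
  ext V hV j X
  rw [lie_dFun]
  simp [sgn, dFun]

theorem HasDegree.lie {α : OneForm M U} {m : ℤ} (h : α.HasDegree m) (Z : VField M U 0) :
    (OneForm.lie Z α).HasDegree m := by
  intro V hV j X
  rw [lie_ev_of_degree_zero]
  have h1 := Z.app_mem hV (h V hV j X)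
  have h2 := h V hV _ ((Z.restrict hV).bracket X)
  rw [zero_add] at h1
  rw [show m + (0 + j) = m + j by ring] at h2
  exact sub_mem h1 h2

theorem HasDegree.smul {α : OneForm M U} {m : ℤ} (h : α.HasDegree m) (r : ℝ) :
    (r • α).HasDegree m :=
  fun V hV j X => Submodule.smul_mem _ r (h V hV j X)

theorem smul_extDeriv_ev (α : OneForm M U) (r : ℝ) (hV : V ≤ U) (X : VField M V i)
    (Y : VField M V j) : (r • α).extDeriv.ev V hV X Y = r • α.extDeriv.ev V hV X Y := by
  have e : ∀ {l : ℤ} (X : VField M V l), (r • α).ev V hV X = r • α.ev V hV X := fun _ => rfl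
  simp only [extDeriv_ev, e, map_smul, ← smul_sub, smul_comm _ r]

/-- The Lie derivative of `∑ dg_a s_a` along a vector field of degree zero that annihilates all the
`g_a`. -/
theorem IsRep.lie_of_app_eq_zero {κ : Type} [Fintype κ] {α : OneForm M U} {e : κ → ℤ}
    {g s : κ → M.Fn U} (h : α.IsRep e g s) (Z : VField M U 0)
    (hg : ∀ a, Z.app U le_rfl (g a) = 0) :
    (OneForm.lie Z α).IsRep e g fun a => Z.app U le_rfl (s a) := by
  refine ⟨h.1, fun V hV j X => ?_⟩
  refine ((h.lie Z).2 V hV j X).trans ?_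
  rw [Fintype.sum_sum_type]
  simp [hg, sgn]

/-- For `Z` of degree zero, `i_k L_Z L_Z dη = L_Z L_Z i_k dη + i_{[Z, [Z, k]]} dη` as soon as
`i_{[Z, k]} dη = 0`. -/
theorem extDeriv_lie_lie_ev (η : OneForm M U) (Z : VField M U 0) (hV : V ≤ U) (X : VField M V i)
    (k : VField M V j) (hk : ∀ {l : ℤ} (Y : VField M V l),
      η.extDeriv.ev V hV Y ((Z.restrict hV).bracket k) = 0) :
    (lie Z (lie Z η)).extDeriv.ev V hV X k =
      (lie (Z.restrict hV) (lie (Z.restrict hV) (η.extDeriv.contract hV k))).ev V le_rfl X +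
        η.extDeriv.ev V hV X ((Z.restrict hV).bracket ((Z.restrict hV).bracket k)) := by
  have e : ∀ {l : ℤ} (Y : VField M V l),
      (η.extDeriv.contract hV k).ev V le_rfl Y = η.extDeriv.ev V hV Y k := fun _ => rfl
  have hr : ((Z.restrict hV).restrict (le_refl V)) = Z.restrict hV := rfl
  have ha : (Z.restrict hV).app V le_rfl = Z.app V hV := rfl
  simp only [extDeriv_lie_ev, lie_ev_of_degree_zero, e, hr, ha, hk, map_sub, map_zero]
  abel

theorem lie_lie_ev (α : OneForm M U) (Z : VField M U 0) (hV : V ≤ U) (X : VField M V i) :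
    (lie Z (lie Z α)).ev V hV X = Z.app V hV (Z.app V hV (α.ev V hV X)) -
      (2 : ℝ) • Z.app V hV (α.ev V hV ((Z.restrict hV).bracket X)) +
      α.ev V hV ((Z.restrict hV).bracket ((Z.restrict hV).bracket X)) := by
  simp only [lie_ev_of_degree_zero, map_sub, two_smul]
  abel

end OneForm

end SecondVariation

section Pullback

variable {T E VE : GradedManifold.{u}} {π : Hom E T} {P : Hom VE E}
  {D : ∀ V : Opens E.X, E.Fn V →ₗ[ℝ] VE.Fn (P.pre V)}

theorem IsPullback.add {U : Opens E.X} {W : Opens VE.X} {β β' : OneForm E.toGradedSpace U}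
    {η η' : OneForm VE.toGradedSpace W} (H : IsPullback P β η) (H' : IsPullback P β' η') :
    IsPullback P (β + β') (η + η') := by
  rw [isPullback_iff] at *
  intro p hp
  obtain ⟨O, W₁, hO, hW₁, h, κ, _, e, g, s, hpW, h1, h2⟩ := H p hp
  obtain ⟨O', W₁', hO', hW₁', h', κ', _, e', g', s', hpW', h1', h2'⟩ := H' p hp
  have hW : W₁ ⊓ W₁' ≤ P.pre (O ⊓ O') := fun q hq => ⟨h hq.1, h' hq.2⟩
  refine ⟨O ⊓ O', W₁ ⊓ W₁', inf_le_left.trans hO, inf_le_left.trans hW₁, hW, κ ⊕ κ', inferInstance,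
    _, _, _, ⟨hpW, hpW'⟩, (h1.restrict inf_le_left).add (h1'.restrict inf_le_right), ?_⟩
  have := (h2.restrict (V := W₁ ⊓ W₁') inf_le_left).add (h2'.restrict (V := W₁ ⊓ W₁') inf_le_right)
  have e1 : ∀ (A : κ → E.Fn O) (B : κ' → E.Fn O'), (fun a => P.pullOn hW (Sum.elim
      (fun a => E.res (inf_le_left : O ⊓ O' ≤ O) (A a))
      (fun a => E.res (inf_le_right : O ⊓ O' ≤ O') (B a)) a)) =
      Sum.elim (fun a => VE.res (inf_le_left : W₁ ⊓ W₁' ≤ W₁) (P.pullOn h (A a)))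
        (fun a => VE.res (inf_le_right : W₁ ⊓ W₁' ≤ W₁') (P.pullOn h' (B a))) := by
    intro A B
    funext x
    cases x
    · exact (P.pullOn_res _ _ _).trans (P.res_pullOn _ _ _).symm
    · exact (P.pullOn_res _ _ _).trans (P.res_pullOn _ _ _).symm
  rw [e1, e1]
  exact this

/-- Contraction of a pullback with a projectable vector field. -/
theorem IsPullback.ev_of_projects {U : Opens E.X} {W : Opens VE.X} {β : OneForm E.toGradedSpace U}
    {η : OneForm VE.toGradedSpace W} (H : IsPullback P β η) (hW : W ≤ P.pre U) {j : ℤ}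
    {v : VField E.toGradedSpace U j} {k : VField VE.toGradedSpace W j} (hk : Projects P k v) :
    η.ev W le_rfl k = P.pullOn hW (β.ev U le_rfl v) := by
  rw [isPullback_iff] at H
  refine GradedSpace.eq_of_locally fun p hp => ?_
  obtain ⟨O, W₁, hO, hW₁, h, κ, _, e, g, s, hpW, h1, h2⟩ := H p hp
  refine ⟨W₁, hW₁, hpW, ?_⟩
  rw [P.res_pullOn, ← P.pullOn_res hO h, ← β.ev_res, ← η.ev_res]
  have e1 := h1.2 O le_rfl j (v.restrict hO)
  have e2 := h2.2 W₁ le_rfl j (k.restrict hW₁)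
  refine e2.trans (Eq.trans ?_ (congrArg (P.pullOn h) e1).symm)
  rw [map_sum]
  refine Finset.sum_congr rfl fun a _ => ?_
  rw [map_mul]
  simp only [GradedSpace.res_self]
  exact congrArg (· * _) (hk O hO W₁ hW₁ h (g a))

/-- `Z` annihilates the functions on `VE` pulled back from the base `T` by way of `E`. -/
def IsVerticalOver (π : Hom E T) (P : Hom VE E) {N : Opens VE.X} {j : ℤ}
    (Z : VField VE.toGradedSpace N j) : Prop :=
  ∀ (V : Opens E.X) (e : ℤ) (g : E.Fn V), IsBasic π V e g → ∀ (W : Opens VE.X) (hW : W ≤ N)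
    (h : W ≤ P.pre V), Z.app W hW (P.pullOn h g) = 0

/-- Local form of the pullback of a form in the ideal of the base. -/
theorem IsBaseForm.exists_isRep_pullback (hVE : IsVerticalTangentBundle π P D) {U : Opens E.X}
    {β : OneForm E.toGradedSpace U} (hβ : IsBaseForm π β) {N : Opens VE.X} (hN : N ≤ P.pre U)
    {η : OneForm VE.toGradedSpace N} (H : IsPullback P β η) {p : VE.X} (hp : p ∈ N) :
    ∃ (c : VerticalChart π P D) (V : Opens E.X) (W : Opens VE.X) (hW : W ≤ N) (h : W ≤ P.pre V)
      (κ : Type) (_ : Fintype κ) (e : κ → ℤ) (g s : κ → E.Fn V), V ≤ c.a.source ∧ p ∈ W ∧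
      (∀ a, IsBasic π V (e a) (g a)) ∧
      (η.restrict hW).IsRep e (fun a => P.pullOn h (g a)) fun a => P.pullOn h (s a) := by
  obtain ⟨V, hV, κ, inst, e, g, s, hpV, hg, hr⟩ := hβ (P.body p) (hN hp)
  obtain ⟨c, hc⟩ := hVE.exists_chart (P.body p)
  have hV' : V ⊓ c.a.source ≤ V := inf_le_left
  have hr' := hr.restrict hV'
  exact ⟨c, V ⊓ c.a.source, N ⊓ P.pre (V ⊓ c.a.source), inf_le_left, inf_le_right, κ, inst, e, _, _,
    inf_le_right, ⟨hp, hpV, hc⟩, fun a => (hg a).res hV',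
    c.isRep_pullOn H inf_le_right (hV'.trans hV) inf_le_left inf_le_right hr'⟩

/-- The pullback of a form in the ideal of the base `T` vanishes on vector fields over `T`. -/
theorem IsBaseForm.pullback_ev_eq_zero (hVE : IsVerticalTangentBundle π P D) {U : Opens E.X}
    {β : OneForm E.toGradedSpace U} (hβ : IsBaseForm π β) {N : Opens VE.X} (hN : N ≤ P.pre U)
    {η : OneForm VE.toGradedSpace N} (H : IsPullback P β η) {j : ℤ}
    {Z : VField VE.toGradedSpace N j} (hZ : IsVerticalOver π P Z) : η.ev N le_rfl Z = 0 := by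
  refine GradedSpace.eq_of_locally fun p hp => ?_
  obtain ⟨c, V, W, hW, h, κ, _, e, g, s, -, hpW, hg, hr⟩ := hβ.exists_isRep_pullback hVE hN H hp
  refine ⟨W, hW, hpW, ?_⟩
  rw [← η.ev_res, map_zero]
  refine (hr.2 W le_rfl j (Z.restrict hW)).trans (Finset.sum_eq_zero fun a _ => ?_)
  rw [GradedSpace.res_self]
  have : (Z.restrict hW).app W le_rfl (P.pullOn h (g a)) = 0 := hZ V (e a) (g a) (hg a) W hW h
  rw [this, zero_mul]

/-- For a lift `k` of `v`, both `Γ k` and `k Γ` send `P^* f` to `D (v f)`. -/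
theorem IsLift.isVertical_bracket {C : AffineConnection E} {Γ : VField VE.toGradedSpace ⊤ 0}
    (hΓ : IsConnectionField π P D C Γ) {U : Opens E.X} {N : Opens VE.X} (hN : N ≤ P.pre U) {j : ℤ}
    {v : VField E.toGradedSpace U j} {k : VField VE.toGradedSpace N j} (hk : IsLift P D v k) :
    IsVertical P ((Γ.restrict (le_top : N ≤ ⊤)).bracket k) := by
  intro V W hW h f
  have h' : W ≤ P.pre (V ⊓ U) := fun q hq => ⟨h hq, hN (hW hq)⟩
  rw [← P.pullOn_res (V' := V ⊓ U) inf_le_left h']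
  change Γ.app W _ (k.app W hW _) - sgn (0 * j) • k.app W hW (Γ.app W _ _) = _
  rw [hk.projects _ inf_le_right W hW h', hΓ.app_pullOn, hΓ.app_pullOn,
    hk.app_D _ inf_le_right W hW h', zero_mul]
  simp [sgn]

/-- `Γ` annihilates the functions pulled back from the base `T`, and `W` all functions pulled back
from `E`. -/
theorem isVerticalOver_bracket (hVE : IsVerticalTangentBundle π P D) {C : AffineConnection E}
    {Γ : VField VE.toGradedSpace ⊤ 0}
    (hΓ : IsConnectionField π P D C Γ) {N : Opens VE.X} {j : ℤ} {W : VField VE.toGradedSpace N j}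
    (hW : IsVertical P W) : IsVerticalOver π P ((Γ.restrict (le_top : N ≤ ⊤)).bracket W) := by
  rintro V e g ⟨O, hO, g', -, rfl⟩ W' hW' h
  change Γ.app W' _ (W.app W' hW' _) - sgn (0 * j) • W.app W' hW' (Γ.app W' _ _) = _
  rw [hW _ _ _ h, hΓ.app_pullOn, hVE.D_base, map_zero, map_zero, map_zero, smul_zero, sub_zero]

end Pullback

/-! ### The second variation and the annihilator of the kernel distribution -/

section Main

variable {T E VE : GradedManifold.{u}} {π : Hom E T} {P : Hom VE E}
  {D : ∀ V : Opens E.X, E.Fn V →ₗ[ℝ] VE.Fn (P.pre V)}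

theorem annihilates_dFun {ω : TwoForm E.toGradedSpace ⊤} {V : Opens E.X} {e : ℤ} {g : E.Fn V}
    (hg : IsBasic π V e g) : Annihilates (kernelDistribution π ω) V (OneForm.dFun g) := by
  intro W hW j k hk
  exact (hg.res hW).app_eq_zero hk.1 le_rfl

/-- `i_k i_v ω = ± i_v i_k ω`, and `i_k ω` is in the ideal of the base. -/
theorem annihilates_contract {ω : TwoForm E.toGradedSpace ⊤} {V : Opens E.X} {l : ℤ}
    {v : VField E.toGradedSpace V l} (hv : IsVertical π v) :
    Annihilates (kernelDistribution π ω) V (ω.contract le_top v) := by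
  intro W hW j k hk
  have h : ω.ev W le_top (v.restrict hW) k = 0 :=
    (kernelDistribution_iff.1 hk).2.ev_eq_zero (X := v.restrict hW)
      (fun V' W' hW' => hv V' W' (hW'.trans hW)) le_rfl
  change ω.ev W le_top k (v.restrict hW) = 0
  rw [ω.ev_symm, h, smul_zero]

/-- For a form `β` in the ideal of the base `T` and a vector field `Z` over `T`, the form
`½ (L_Γ L_Γ P^* β + i_Z P^* dχ)` belongs to the ideal generated by the pullbacks of forms that
annihilate the kernel distribution: `L_Γ` only acts on the coefficients of `P^* β`, since `Γ`
annihilates the functions of `T`, and `i_Z P^* dχ` is a combination of the pullbacks of the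
contractions of `dχ` with the vertical coordinate fields of `E`. -/
theorem IsBaseForm.inPullbackIdeal (hVE : IsVerticalTangentBundle π P D)
    {χ : OneForm E.toGradedSpace ⊤} {η : OneForm VE.toGradedSpace ⊤} (Hχ : IsPullback P χ η) {m : ℤ}
    (hχ : χ.HasDegree m) {C : AffineConnection E} {Γ : VField VE.toGradedSpace ⊤ 0}
    (hΓ : IsConnectionField π P D C Γ) {U : Opens E.X}
    {β : OneForm E.toGradedSpace U} (hβ : IsBaseForm π β) {N : Opens VE.X} (hN : N ≤ P.pre U)
    {Pβ : OneForm VE.toGradedSpace N} (H : IsPullback P β Pβ) {j : ℤ}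
    {Z : VField VE.toGradedSpace N j} (hZ : IsVerticalOver π P Z) {τ : OneForm VE.toGradedSpace N}
    (hτ : ∀ (V : Opens VE.X) (hV : V ≤ N) (i : ℤ) (X : VField VE.toGradedSpace V i),
      τ.ev V hV X = (1 / 2 : ℝ) • ((OneForm.lie (Γ.restrict le_top)
        (OneForm.lie (Γ.restrict le_top) Pβ)).ev V hV X +
          η.extDeriv.ev V le_top X (Z.restrict hV))) :
    InPullbackIdeal P (Annihilates (kernelDistribution π χ.extDeriv)) τ := by
  refine InPullbackIdeal.of_fintype (fun O O' h β hβ V hV j k hk => hβ V (hV.trans h) j k hk)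
    fun p hp => ?_
  obtain ⟨c, V, W, hW, h, κ, _, e, g, s, hV, hpW, hg, hr⟩ := hβ.exists_isRep_pullback hVE hN H hp
  have hWc : W ≤ c.c.source := h.trans (c.pre_le hV)
  have hΓg : ∀ a, (Γ.restrict (le_top : W ≤ ⊤)).app W le_rfl (P.pullOn h (g a)) = 0 := by
    intro a
    obtain ⟨O, hO, g', -, e⟩ := hg a
    change Γ.app W le_top _ = 0
    rw [hΓ.app_pullOn, e, hVE.D_base, map_zero]
  have hr₂ := (hr.lie_of_app_eq_zero (Γ.restrict le_top) hΓg).lie_of_app_eq_zero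
    (Γ.restrict le_top) hΓg
  let z : c.a.FibIdx → VE.Fn W := fun A =>
    sgn ((j + c.a.total.deg A) * (1 + m + c.a.total.deg A)) •
      (Z.restrict hW).app W le_rfl (VE.res hWc (c.c.coord (c.ε (.inl A))))
  have hZc : ∀ i, Z.app W hW (VE.res hWc (c.c.coord (c.ε (.inl (c.a.emb i))))) = 0 := by
    intro i
    rw [c.coord_inl, P.res_pullOn]
    exact hZ _ _ _ ⟨_, c.a.le_pre, _, c.a.base.coord_mem i, c.a.coord_emb i⟩ W hW _
  refine ⟨W, hW, κ ⊕ c.a.FibIdx, inferInstance, Sum.elim (fun _ => V) fun _ => c.a.source,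
    Sum.rec (fun a => OneForm.dFun (g a)) fun A => χ.extDeriv.contract le_top (c.d A),
    Sum.elim (fun a => OneForm.dFun (P.pullOn h (g a)))
      fun A => (η.extDeriv.contract le_top (c.dBase A)).restrict hWc,
    fun a => (1 / 2 : ℝ) • Sum.elim (fun a => (Γ.restrict (le_top : W ≤ ⊤)).app W le_rfl
      ((Γ.restrict (le_top : W ≤ ⊤)).app W le_rfl (P.pullOn h (s a)))) z a, hpW, ?_, ?_⟩
  · rintro (a | A)
    · exact ⟨h, annihilates_dFun (hg a), IsPullback.dFun h (hg a).mem⟩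
    · exact ⟨hWc.trans c.source_eq.le, annihilates_contract (c.isVertical_d A),
        (Hχ.contract_extDeriv hVE hχ c.source_eq.le (c.projects_dBase A)).restrict hWc⟩
  · intro V' hV' i X
    have hsum := c.ev_extDeriv_eq_sum hVE Hχ hχ (hV'.trans hWc) X (Z.restrict (hV'.trans hW))
      fun i => by
        have := congrArg (VE.res hV') (hZc i)
        rw [← Z.app_res, GradedSpace.res_res, map_zero] at this
        exact this
    rw [hτ, Fintype.sum_sum_type, hsum]
    have h2 := hr₂.2 V' hV' i X
    change (OneForm.lie (Γ.restrict le_top) (OneForm.lie (Γ.restrict le_top) Pβ)).ev V'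
      (hV'.trans hW) X = _ at h2
    rw [h2, smul_add, Finset.smul_sum, Finset.smul_sum]
    congr 1
    · refine Finset.sum_congr rfl fun a _ => ?_
      rw [← mul_smul_comm, Sum.elim_inl, map_smul]
      rfl
    · refine Finset.sum_congr rfl fun A _ => ?_
      have ez : VE.res hV' (z A) = sgn ((j + c.a.total.deg A) * (1 + m + c.a.total.deg A)) •
          (Z.restrict (hV'.trans hW)).app V' le_rfl
            (VE.res (hV'.trans hWc) (c.c.coord (c.ε (.inl A)))) := by
        rw [map_smul, ← (Z.restrict hW).app_res le_rfl hV', GradedSpace.res_res]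
        rfl
      rw [← mul_smul_comm, map_smul]
      exact congrArg (fun w => _ * (1 / 2 : ℝ) • w) ez.symm

end Main

end GPDE

open GPDE in
theorem mainTheorem4 {T E VE : GPDE.GradedManifold.{u}} (n : ℕ)
    (dX : GPDE.VField T.toGradedSpace ⊤ 1) (π : GPDE.Hom E T)
    (Q : GPDE.VField E.toGradedSpace ⊤ 1) (ω : GPDE.TwoForm E.toGradedSpace ⊤) (L : E.Fn ⊤)
    (hE : GPDE.IsPresymplecticGaugePDE n dX π Q ω L)
    -- a presymplectic potential
    (χ : GPDE.OneForm E.toGradedSpace ⊤) (hχ_deg : χ.HasDegree (n - 1)) (hχ : ω = χ.extDeriv)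
    -- the vertical kernel distribution is finitely generated
    (hK : GPDE.IsFinitelyGenerated (GPDE.kernelDistribution π ω))
    -- the vertical tangent bundle and the complete lift
    (P : GPDE.Hom VE E) (D : ∀ V : Opens E.X, E.Fn V →ₗ[ℝ] VE.Fn (P.pre V))
    (hVE : GPDE.IsVerticalTangentBundle π P D)
    (Qt : GPDE.VField VE.toGradedSpace ⊤ 1) (hQt : GPDE.IsCompleteLift P D Q Qt)
    -- the connection and the vector field it defines
    (C : GPDE.AffineConnection E) (hC_symm : C.IsSymmetric) (hC_comp : C.IsCompatible π)
    (V : GPDE.VField VE.toGradedSpace ⊤ 0) (hV : GPDE.IsConnectionField π P D C V)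
    -- the pullback of the potential
    (Pχ : GPDE.OneForm VE.toGradedSpace ⊤) (hPχ : GPDE.IsPullback P χ Pχ) :
    GPDE.IsPresymplecticGaugePDEOver n dX π Q (GPDE.kernelDistribution π ω) P Qt
      ((1 / 2 : ℝ) • GPDE.OneForm.lie V (GPDE.OneForm.lie V Pχ)).extDeriv
      ((1 / 2 : ℝ) • V.app ⊤ le_rfl (V.app ⊤ le_rfl (P.pullOn (V := ⊤) (W := ⊤) (fun _ _ => trivial) L))) := by
  subst hχ
  have hT : (⊤ : Opens VE.X) ≤ P.pre ⊤ := fun _ _ => trivial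
  have hlift := hQt.isLift
  have hdeg : Pχ.HasDegree (n - 1) := hPχ.hasDegree hVE hT hχ_deg
  set f : VE.Fn ⊤ := P.pullOn hT L with hf
  -- `i_k ω̃ = ½ (L_V L_V P^* (i_v ω) + i_{[V, [V, k]]} P^* ω)` for the lift `k` of `v`
  have hvar : ∀ {U : Opens E.X} {N : Opens VE.X} (hN : N ≤ P.pre U) {j : ℤ}
      {v : VField E.toGradedSpace U j} {k : VField VE.toGradedSpace N j} (_ : IsLift P D v k)
      {W : Opens VE.X} (hW : W ≤ N) {i : ℤ} (X : VField VE.toGradedSpace W i),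
      ((1 / 2 : ℝ) • OneForm.lie V (OneForm.lie V Pχ)).extDeriv.ev W le_top X (k.restrict hW) =
      (1 / 2 : ℝ) • ((OneForm.lie (V.restrict le_top) (OneForm.lie (V.restrict le_top)
        (Pχ.extDeriv.contract le_top k))).ev W hW X + Pχ.extDeriv.ev W le_top X
          (((V.restrict le_top).bracket ((V.restrict le_top).bracket k)).restrict hW)) := by
    intro U N hN j v k hk W hW i X
    have hkW := hk.restrict le_rfl hW
    rw [OneForm.smul_extDeriv_ev, OneForm.extDeriv_lie_lie_ev Pχ V le_top X (k.restrict hW)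
      fun Y => hPχ.extDeriv_ev_eq_zero hVE hχ_deg Y (hkW.isVertical_bracket hV (hW.trans hN))]
    rfl
  have hver : ∀ {U : Opens E.X} {N : Opens VE.X} (hN : N ≤ P.pre U) {j : ℤ}
      {v : VField E.toGradedSpace U j} {k : VField VE.toGradedSpace N j} (_ : IsLift P D v k),
      IsVerticalOver π P ((V.restrict (le_top : N ≤ ⊤)).bracket ((V.restrict le_top).bracket k)) :=
    fun hN _ _ _ hk => isVerticalOver_bracket hVE hV (hk.isVertical_bracket hV hN)
  have hβ : IsBaseForm π (χ.extDeriv.contract le_rfl Q + OneForm.dFun L) :=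
    inBaseIdeal_iff.1 hE.compat
  have hPβ : IsPullback P (χ.extDeriv.contract le_rfl Q + OneForm.dFun L)
      (Pχ.extDeriv.contract le_rfl Qt + OneForm.dFun f) :=
    (hPχ.contract_extDeriv hVE hχ_deg hT hlift.projects).add (IsPullback.dFun hT hE.deg_fun)
  refine
    { background := hE.isWeakGaugePDE hK
      bundle := hVE.bundle
      projects := hlift.projects
      deg_form := (((hdeg.lie V).lie V).smul _).extDeriv
      deg_fun := ?_
      closed := OneForm.isClosed_extDeriv _
      compat := ?_
      master := ?_
      lift := ?_ }
  · have := V.app_mem le_rfl (V.app_mem le_rfl (P.pullOn_mem hT hE.deg_fun))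
    rw [zero_add, zero_add] at this
    exact Submodule.smul_mem _ _ this
  · refine hβ.inPullbackIdeal hVE hPχ hχ_deg hV hT hPβ (hver hT hlift) fun W hW i X => ?_
    have e1 := hvar hT hlift hW X
    rw [OneForm.lie_add, OneForm.lie_add, OneForm.lie_dFun_of_degree_zero,
      OneForm.lie_dFun_of_degree_zero]
    have e2 : (OneForm.dFun ((1 / 2 : ℝ) • V.app ⊤ le_rfl (V.app ⊤ le_rfl f))).ev W hW X =
        (1 / 2 : ℝ) • (OneForm.dFun (V.app ⊤ le_rfl (V.app ⊤ le_rfl f))).ev W hW X := by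
      change X.app W le_rfl (VE.res hW (_ • _)) = _ • X.app W le_rfl _
      rw [map_smul, map_smul]
    refine (congrArg₂ (· + ·) e1 e2).trans ?_
    rw [← smul_add, add_right_comm]
    rfl
  · -- With `Z = [V, [V, Q̃]]`, the left hand side is `½ V V P^*` of the master equation of `E` plus
    -- half of the value of `P^* (i_Q ω + dL)` on `Z`, which vanishes.
    have hW := hlift.isVertical_bracket hV hT
    have hμQ : Pχ.extDeriv.ev ⊤ le_top Qt Qt = P.pullOn hT (χ.extDeriv.ev ⊤ le_top Q Q) :=
      (hPχ.contract_extDeriv hVE hχ_deg hT hlift.projects).ev_of_projects hT hlift.projects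
    have hμW : Pχ.extDeriv.ev ⊤ le_top ((V.restrict le_top).bracket Qt) Qt = 0 := by
      rw [Pχ.extDeriv.ev_symm, hPχ.extDeriv_ev_eq_zero hVE hχ_deg Qt hW, smul_zero]
    have hμZ : Pχ.extDeriv.ev ⊤ le_top Qt
          ((V.restrict le_top).bracket ((V.restrict le_top).bracket Qt)) =
        Pχ.extDeriv.ev ⊤ le_top ((V.restrict le_top).bracket ((V.restrict le_top).bracket Qt))
          Qt := by
      rw [Pχ.extDeriv.ev_symm, sgn, if_pos (by decide), one_smul]
    have hZf : Pχ.extDeriv.ev ⊤ le_top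
          ((V.restrict le_top).bracket ((V.restrict le_top).bracket Qt)) Qt +
        ((V.restrict le_top).bracket ((V.restrict le_top).bracket Qt)).app ⊤ le_rfl f = 0 := by
      have := hβ.pullback_ev_eq_zero hVE hT hPβ (hver hT hlift)
      change _ + VField.app _ ⊤ le_rfl (VE.res le_rfl f) = 0 at this
      rwa [GradedSpace.res_self] at this
    have e1 := hvar hT hlift le_rfl Qt
    rw [OneForm.lie_lie_ev] at e1
    have hQf : Qt.app ⊤ le_rfl f = P.pullOn hT (Q.app ⊤ le_rfl L) :=
      hlift.projects ⊤ le_rfl ⊤ le_rfl hT L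
    -- `V` and `Q̃` commute on the functions pulled back from `E`
    have hWf : Qt.app ⊤ le_rfl (V.app ⊤ le_rfl f) = V.app ⊤ le_rfl (Qt.app ⊤ le_rfl f) := by
      have h : V.app ⊤ le_rfl (Qt.app ⊤ le_rfl f) -
        sgn (0 * 1) • Qt.app ⊤ le_rfl (V.app ⊤ le_rfl f) = 0 := hW ⊤ ⊤ le_rfl hT L
      rw [zero_mul, sgn, if_pos Even.zero, one_smul] at h
      exact (sub_eq_zero.1 h).symm
    have hZV : ((V.restrict le_top).bracket ((V.restrict le_top).bracket Qt)).app ⊤ le_rfl f =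
        Qt.app ⊤ le_rfl (V.app ⊤ le_rfl (V.app ⊤ le_rfl f)) -
          V.app ⊤ le_rfl (V.app ⊤ le_rfl (Qt.app ⊤ le_rfl f)) := by
      change V.app ⊤ le_rfl (V.app ⊤ le_rfl (Qt.app ⊤ le_rfl f) -
        sgn (0 * 1) • Qt.app ⊤ le_rfl (V.app ⊤ le_rfl f)) - sgn (0 * (0 + 1)) •
        (V.app ⊤ le_rfl (Qt.app ⊤ le_rfl (V.app ⊤ le_rfl f)) -
          sgn (0 * 1) • Qt.app ⊤ le_rfl (V.app ⊤ le_rfl (V.app ⊤ le_rfl f))) = _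
      rw [zero_mul, zero_mul, sgn, if_pos Even.zero, one_smul, one_smul, one_smul, hWf, sub_self,
        map_zero, zero_sub, neg_sub]
    have hm := congrArg (fun g => V.app ⊤ le_rfl (V.app ⊤ le_rfl (P.pullOn hT g))) hE.master
    simp only [map_add, map_smul, map_zero] at hm
    change _ = (1 / 2 : ℝ) • (V.app ⊤ le_rfl (V.app ⊤ le_rfl (Pχ.extDeriv.ev ⊤ le_top Qt Qt)) -
      (2 : ℝ) • V.app ⊤ le_rfl (Pχ.extDeriv.ev ⊤ le_top ((V.restrict le_top).bracket Qt) Qt) +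
      Pχ.extDeriv.ev ⊤ le_top ((V.restrict le_top).bracket ((V.restrict le_top).bracket Qt)) Qt +
      Pχ.extDeriv.ev ⊤ le_top Qt
        ((V.restrict le_top).bracket ((V.restrict le_top).bracket Qt))) at e1
    rw [hμQ, hμW, hμZ, map_zero, smul_zero, sub_zero] at e1
    rw [hZV, hQf] at hZf
    refine (congrArg (fun w => (1 / 2 : ℝ) • w + _) e1).trans ?_
    rw [map_smul]
    linear_combination (norm := module) (1 / 2 : ℝ) • hm + (1 / 2 : ℝ) • hZf
  · intro U j v hv
    obtain ⟨k, hk⟩ := exists_isLift hVE hV v hv.1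
    refine ⟨k, hk.projects, ?_⟩
    refine (kernelDistribution_iff.1 hv).2.inPullbackIdeal hVE hPχ hχ_deg hV le_rfl
      (hPχ.contract_extDeriv hVE hχ_deg le_rfl hk.projects) (hver le_rfl hk) fun W hW i X => ?_
    exact hvar le_rfl hk hW X
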